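/- All manifolds with corners here are modelled on $[0,\infty)^m$ (equivalently, on $[0,\infty)^k\times\mathbb R^{m-k}$, $0\le k\le m$) with smooth transition maps. A boundary hypersurface of a manifold with corners $X$ is the closure of a connected component of the part of $\partial X$ of codimension one. As part of the definition of a manifold with corners, each boundary hypersurface is required to be embedded: near each of its points it is the zero set of a smooth function that is positive off the hypersurface and has non-vanishing differential at the point. The set of boundary hypersurfaces is denoted $\mathcal M_1(X)$. A collective boundary hypersurface is a finite set $B\subset\mathcal M_1(X)$ of pairwise disjoint boundary hypersurfaces, with $\operatorname{supp}(B)=\bigcup_{H\in B}H$. The double of $X$ across $B$ is the quotient space $2_BX=(X\sqcup X)/\!\sim$ obtained by identifying the two copies of each point of $\operatorname{supp}(B)$; there is a natural projection $\pi:2_BX\to X$. If $\mathcal M_1(X)=B_1\sqcup\dots\sqcup B_l$ is a partition into collective boundary hypersurfaces, a successive doubling of $X$ across $B_1,\dots,B_l$ is obtained as follows. If $l=0$ it is $X$. If $l\ge 1$, equip $X_1=2_{B_1}X$ with a structure of compact manifold with corners for which both copies of $X$ are smoothly embedded and for which the sets $\widetilde B_i=\{K\in\mathcal M_1(X_1):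 K\subset\pi^{-1}(\operatorname{supp}(B_i))\}$, $2\le i\le l$, partition $\mathcal M_1(X_1)$ into collective boundary hypersurfaces; then continue with a successive doubling of $X_1$ across $\widetilde B_2,\dots,\widetilde B_l$. The space $X$ is mapped into the final manifold as the first copy at every step. **Theorem.** Let $G$ be a compact Lie group acting smoothly on a compact manifold with corners $M$, and let $\mathcal M_1(M)=B_1\sqcup\dots\sqcup B_l$ be a partition into collective boundary hypersurfaces that are $G$-invariant, i.e. $g\cdot H\in B_i$ for all $g\in G$, $H\in B_i$. Then there is a successive doubling $\widehat M$ of $M$ across $B_1,\dots,B_l$ that is a compact manifold without boundary, and there is a smooth action of $\mathbb Z_2^l\times G$ on $\widehat M$, such that the map $\iota:M\to\widehat M$ onto the first copy is a $G$-equivariant smooth embedding whose image $D=\iota(M)$ is a fundamental domain for the $\mathbb Z_2^l$-action: $D$ is the closure of its interior, every $\mathbb Z_2^l$-orbit meets $D$ in exactly one point, and $\gamma D\cap\operatorname{int}D=\emptyset$ for every $\gamma\in\mathbb Z_2^l$ with $\gamma\ne 1$. -/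

import Mathlib

open Set Function
open scoped Manifold ContDiff

namespace CornerDoubling

/-- The local model `[0,∞)^m ⊂ ℝ^m` of an `m`-dimensional manifold with corners. (The models
`[0,∞)^k × ℝ^(m-k)` are locally diffeomorphic to it, so they give the same manifolds.) -/
noncomputable abbrev cornerModel (m : ℕ) :
    ModelWithCorners ℝ (EuclideanSpace ℝ (Fin m)) (EuclideanQuadrant m) :=
  modelWithCornersEuclideanQuadrant m

section Faces

variable (m : ℕ) (X : Type*) [TopologicalSpace X] [ChartedSpace (EuclideanQuadrant m) X]

/-- The part of the boundary of smooth codimension one: the points at which exactly one coordinate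
of a chart vanishes. -/
def codimOnePart : Set X :=
  {x | {i : Fin m | (chartAt (EuclideanQuadrant m) x x).val i = 0}.ncard = 1}

/-- `ℳ₁(X)`: a boundary hypersurface is the closure of a connected component of the part of the
boundary of smooth codimension one. -/
def boundaryHypersurfaces : Set (Set X) :=
  {H | ∃ x ∈ codimOnePart m X, H = closure (connectedComponentIn (codimOnePart m X) x)}

/-- Near each of its points, `H` is the zero set of a smooth function that is positive off `H` and
has non-vanishing differential at the point. -/
def IsEmbeddedHypersurface (H : Set X) : Prop :=
  ∀ p ∈ H, ∃ U : Set X, IsOpen U ∧ p ∈ U ∧ ∃ ρ : X → ℝ,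
    ContMDiffOn (cornerModel m) 𝓘(ℝ, ℝ) ∞ ρ U ∧
    (∀ x ∈ U, x ∈ H → ρ x = 0) ∧ (∀ x ∈ U, x ∉ H → 0 < ρ x) ∧
    mfderiv (cornerModel m) 𝓘(ℝ, ℝ) ρ p ≠ 0

/-- A compact manifold with corners of dimension `m`: compact, Hausdorff, with smooth transition
maps between open subsets of `[0,∞)^m`, and with embedded boundary hypersurfaces. -/
structure IsCompactManifoldWithCorners : Prop where
  compactSpace : CompactSpace X
  t2Space : T2Space X
  isManifold : IsManifold (cornerModel m) ∞ X
  embedded : ∀ H ∈ boundaryHypersurfaces m X, IsEmbeddedHypersurface m X H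

variable {X}

/-- A collective boundary hypersurface, given by its elements: finitely many pairwise disjoint
boundary hypersurfaces. -/
structure IsCollectiveHypersurface (𝓑 : Set (Set X)) : Prop where
  finite : 𝓑.Finite
  subset : 𝓑 ⊆ boundaryHypersurfaces m X
  pairwiseDisjoint : 𝓑.PairwiseDisjoint id

/-- `B 0, …, B (l - 1)` partition `ℳ₁(X)` into collective boundary hypersurfaces
(some of which may be empty). -/
structure IsBoundaryPartition {l : ℕ} (B : Fin l → Set (Set X)) : Prop where
  collective : ∀ i, IsCollectiveHypersurface m (B i)
  existsUnique : ∀ H ∈ boundaryHypersurfaces m X, ∃! i, H ∈ B i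

end Faces

/-- A smooth embedding of manifolds with corners: a smooth topological embedding with injective
differentials. -/
structure IsSmoothCornerEmbedding (m : ℕ) {X Y : Type*}
    [TopologicalSpace X] [ChartedSpace (EuclideanQuadrant m) X]
    [TopologicalSpace Y] [ChartedSpace (EuclideanQuadrant m) Y] (f : X → Y) : Prop where
  contMDiff : ContMDiff (cornerModel m) (cornerModel m) ∞ f
  isEmbedding : Topology.IsEmbedding f
  injective_mfderiv : ∀ x, Injective (mfderiv (cornerModel m) (cornerModel m) f x)

section Double

universe u

/-- Two copies of `X`, labelled by `Bool`, with each point of `F` in one copy identified with the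
same point in the other copy. -/
def doubleSetoid (X : Type u) (F : Set X) : Setoid (X × Bool) where
  r p q := p.1 = q.1 ∧ (p.2 = q.2 ∨ p.1 ∈ F)
  iseqv :=
    { refl := fun _ => ⟨rfl, Or.inl rfl⟩
      symm := by
        rintro ⟨x, a⟩ ⟨y, b⟩ ⟨h, h'⟩
        dsimp only at h h' ⊢
        subst h
        exact ⟨rfl, h'.imp Eq.symm id⟩
      trans := by
        rintro ⟨x, a⟩ ⟨y, b⟩ ⟨z, c⟩ ⟨h, h'⟩ ⟨k, k'⟩
        dsimp only at h h' k k' ⊢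
        subst h
        subst k
        refine ⟨rfl, ?_⟩
        rcases h' with h' | h'
        · rcases k' with k' | k'
          · exact Or.inl (h'.trans k')
          · exact Or.inr k'
        · exact Or.inr h' }

/-- The double of `X` across `F`: the quotient of `X ⊔ X` gluing the two copies along `F`. -/
def Double (X : Type u) (F : Set X) : Type u := Quotient (doubleSetoid X F)

instance (X : Type u) [TopologicalSpace X] (F : Set X) : TopologicalSpace (Double X F) :=
  inferInstanceAs (TopologicalSpace (Quotient (doubleSetoid X F)))

/-- The inclusion of the copy of `X` with label `b` into the double. -/
def Double.incl {X : Type u} (F : Set X) (b : Bool) (x : X) : Double X F :=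
  Quotient.mk (doubleSetoid X F) (x, b)

/-- The natural projection of the double onto `X`. -/
def Double.fold {X : Type u} (F : Set X) : Double X F → X :=
  Quotient.lift (fun p : X × Bool => p.1) (fun _ _ h => h.1)

/-- The collection of boundary hypersurfaces of the double induced by a collection `𝓑` of boundary
hypersurfaces of `X`: those that lie over the union of the elements of `𝓑`. -/
def inducedCollection (m : ℕ) {X : Type u} [TopologicalSpace X] (F : Set X)
    [ChartedSpace (EuclideanQuadrant m) (Double X F)] (𝓑 : Set (Set X)) :
    Set (Set (Double X F)) :=
  {H | H ∈ boundaryHypersurfaces m (Double X F) ∧ H ⊆ Double.fold F ⁻¹' (⋃₀ 𝓑)}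

/-- A successive doubling of the manifold with corners `X` across `B 0, …, B (l - 1)`.

If `l = 0` nothing is done. Otherwise one forms the double `X₁` of `X` across the union of the
elements of `B 0`, chooses on it a structure of a compact manifold with corners for which both
copies of `X` are smoothly embedded and the collections induced by `B 1, …, B (l - 1)` partition
`ℳ₁(X₁)` into collective boundary hypersurfaces, and goes on with a successive doubling of `X₁`
across these induced collections. -/
inductive SuccessiveDoubling (m : ℕ) : (l : ℕ) → (X : Type u) → [TopologicalSpace X] →
    [ChartedSpace (EuclideanQuadrant m) X] → (Fin l → Set (Set X)) → Type (u + 1)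
  | done (X : Type u) [TopologicalSpace X] [ChartedSpace (EuclideanQuadrant m) X]
      (B : Fin 0 → Set (Set X)) : SuccessiveDoubling m 0 X B
  | step (l : ℕ) (X : Type u) [TopologicalSpace X] [ChartedSpace (EuclideanQuadrant m) X]
      (B : Fin (l + 1) → Set (Set X))
      [ChartedSpace (EuclideanQuadrant m) (Double X (⋃₀ B 0))]
      (isManifold : IsCompactManifoldWithCorners m (Double X (⋃₀ B 0)))
      (isEmbedding : ∀ b, IsSmoothCornerEmbedding m (Double.incl (⋃₀ B 0) b))
      (isPartition : IsBoundaryPartition m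
        (fun i : Fin l => inducedCollection m (⋃₀ B 0) (B i.succ)))
      (next : SuccessiveDoubling m l (Double X (⋃₀ B 0))
        (fun i : Fin l => inducedCollection m (⋃₀ B 0) (B i.succ))) :
      SuccessiveDoubling m (l + 1) X B

namespace SuccessiveDoubling

variable {m : ℕ}

/-- The underlying set of the last manifold of a successive doubling. -/
def Total : {l : ℕ} → {X : Type u} → [TopologicalSpace X] →
    [ChartedSpace (EuclideanQuadrant m) X] → {B : Fin l → Set (Set X)} →
    SuccessiveDoubling m l X B → Type u
  | _, _, _, _, _, done X _ => X
  | _, _, _, _, _, step _ _ _ _ _ _ next => next.Total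

/-- The topology of the last manifold. -/
instance instTopologicalSpaceTotal : {l : ℕ} → {X : Type u} → [TopologicalSpace X] →
    [ChartedSpace (EuclideanQuadrant m) X] → {B : Fin l → Set (Set X)} →
    (D : SuccessiveDoubling m l X B) → TopologicalSpace D.Total
  | _, _, t, _, _, done _ _ => t
  | _, _, _, _, _, step _ _ _ _ _ _ next => instTopologicalSpaceTotal next

/-- The charts of the last manifold. -/
instance instChartedSpaceTotal : {l : ℕ} → {X : Type u} → [TopologicalSpace X] →
    [ChartedSpace (EuclideanQuadrant m) X] → {B : Fin l → Set (Set X)} →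
    (D : SuccessiveDoubling m l X B) → ChartedSpace (EuclideanQuadrant m) D.Total
  | _, _, _, c, _, done _ _ => c
  | _, _, _, _, _, step _ _ _ _ _ _ next => instChartedSpaceTotal next

/-- The map of `X` into the last manifold as the first copy at every step. -/
def incl : {l : ℕ} → {X : Type u} → [TopologicalSpace X] →
    [ChartedSpace (EuclideanQuadrant m) X] → {B : Fin l → Set (Set X)} →
    (D : SuccessiveDoubling m l X B) → X → D.Total
  | _, _, _, _, _, done _ _ => fun x => x
  | _, _, _, _, B, step _ _ _ _ _ _ next => fun x => next.incl (Double.incl (⋃₀ B 0) true x)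

end SuccessiveDoubling

end Double

/-- A fundamental domain for the action of a (discrete) group `Γ` on a space `Y`: a set that is the
closure of its interior, that meets every orbit in exactly one point, and whose interior is
disjoint from every translate of the set by a non-trivial element of `Γ`. -/
structure IsFundamentalDomain (Γ : Type*) {Y : Type*} [Group Γ] [TopologicalSpace Y]
    [MulAction Γ Y] (D : Set Y) : Prop where
  closure_interior : closure (interior D) = D
  existsUnique : ∀ y : Y, ∃! x, x ∈ D ∧ x ∈ MulAction.orbit Γ y
  disjoint : ∀ γ : Γ, γ ≠ 1 → Disjoint ((fun y => γ • y) '' D) (interior D)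

/-- The group `ℤ₂^l`, written multiplicatively. -/
abbrev Z2Pow (l : ℕ) : Type := Fin l → Multiplicative (ZMod 2)

end CornerDoubling

/-! Topologically the double across F = supp(B) is canonical, but charts across F depend on a
collar, and the group has to act smoothly in them. The role of the collar is played by a vector
field V that points strictly into the manifold along F and is tangent to the boundary off F (hence,
by continuity, to the other faces at points of F). Locally a coordinate field does this. The
conditions are convex, so local fields glue by a partition of unity (`exists_pointsInto`), and
averaging over the compact group with Haar measure makes V invariant
(`IsSmoothAction.exists_invariant_field`).

Near F the flow of V yields straight charts, in which F = {t = 0} for one coordinate t and V is the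
coordinate field of t (`exists_flowBox`, `exists_isStraight`). To flow in a quadrant, the field is
extended to a Lipschitz field on ℝ^m. There a quantitative inverse function theorem gives a local
homeomorphism, and its smoothness is proved on the quadrant only (`contDiffOn_flow`,
`contDiffOn_of_inverse`).

In straight charts a map that preserves V and F is a product: it moves the points of F and leaves t
unchanged (`coord_eq_of_isStraight`). Replacing t by t on one copy and by -t on the other, shifted
by 1 to stay in the quadrant, gives formulas that are smooth across F. This one computation
(`contMDiffWithinAt_coord_map`) covers the transition maps of the double, the action and the
interchange of the copies.

The boundary is tracked by face systems: closed sets, each locally the zero set of one coordinate,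
such that every point of codimension one lies in exactly one of them. Embeddedness is what excludes
two coordinates (`exists_index_of_isEmbeddedHypersurface`). Boundary partitions give face systems
and conversely, and the preimages under folding of all members but F form a face system of the
double (`IsDoubleStructure.isFaceSystem`).

So a doubling lowers l by one and enlarges a finite group Γ of swaps acting together with G; the
theorem follows by induction (`exists_isDoublingAction`). With no collections left there are no
points of codimension one, hence no boundary. Fundamental domains are carried backwards: if the
double is one for ℤ₂^l, then its first copy is one for ℤ₂^(l+1), because the complement of F is
dense (`IsFundamentalDomainVia.double`). -/

namespace CornerDoubling

open Filter Topology MeasureTheory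
open scoped NNReal

universe u

/-! ### Existence for linear differential equations -/

section LinearODE

variable {F : Type*} [NormedAddCommGroup F] [NormedSpace ℝ F] [CompleteSpace F]

/-- Short-time existence for a linear differential equation with bounded coefficients. -/
theorem exists_linear_ode_short {A : ℝ → F →L[ℝ] F} (hA : Continuous A) {K : ℝ}
    (hK0 : 0 ≤ K) (hK : ∀ t, ‖A t‖ ≤ K) {δ : ℝ} (hδ : 0 ≤ δ) (hKδ : K * δ ≤ 1 / 2) (s : ℝ) (w : F) :
    ∃ z : ℝ → F, z s = w ∧
      ∀ t ∈ Icc s (s + δ), HasDerivWithinAt z (A t (z t)) (Icc s (s + δ)) t := by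
  have h0 : s ∈ Icc s (s + δ) := ⟨le_rfl, by linarith⟩
  -- On the ball of radius ‖w‖ about w one has ‖x‖ ≤ 2‖w‖, so the speed is at most 2K‖w‖ and time δ
  -- with Kδ ≤ 1/2 is too short to leave the ball. The admissible δ does not depend on w, which is
  -- what makes linear equations globally solvable.
  have H : IsPicardLindelof (fun t x => A t x) (⟨s, h0⟩ : Icc s (s + δ)) w
      ⟨‖w‖, norm_nonneg w⟩ 0 ⟨K * (2 * ‖w‖), by positivity⟩ ⟨K, hK0⟩ := by
    constructor
    · intro t _
      apply LipschitzWith.lipschitzOnWith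
      refine LipschitzWith.of_dist_le_mul fun x y => ?_
      rw [dist_eq_norm, dist_eq_norm, ← map_sub]
      exact (A t).le_of_opNorm_le (hK t) _
    · intro x _
      exact (hA.clm_apply continuous_const).continuousOn
    · intro t _ x hx
      refine (A t).le_of_opNorm_le_of_le (hK t) ?_
      rw [mem_closedBall_iff_norm] at hx
      have : ‖x‖ ≤ ‖x - w‖ + ‖w‖ := by simpa using norm_add_le (x - w) w
      change ‖x - w‖ ≤ ‖w‖ at hx
      linarith
    · simp only [add_sub_cancel_left, sub_self, NNReal.coe_zero, sub_zero]
      rw [max_eq_left hδ]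
      change K * (2 * ‖w‖) * δ ≤ ‖w‖
      nlinarith [norm_nonneg w]
  exact H.exists_eq_forall_mem_Icc_hasDerivWithinAt₀

/-- Global existence for a linear differential equation with continuous coefficients. -/
theorem exists_linear_ode {A : ℝ → F →L[ℝ] F} (hA : ContinuousOn A (Icc 0 1)) (w : F) :
    ∃ z : ℝ → F, z 0 = w ∧ ∀ t ∈ Icc (0 : ℝ) 1, HasDerivWithinAt z (A t (z t)) (Icc 0 1) t := by
  -- Freezing A outside [0, 1] keeps it continuous and bounded on the whole line, as the short-time
  -- statement requires.
  set A' : ℝ → F →L[ℝ] F := IccExtend zero_le_one (domRestrict (Icc 0 1) A) with hA'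
  have hA'c : Continuous A' := (continuousOn_iff_continuous_domRestrict.1 hA).Icc_extend'
  have hA'eq : ∀ t ∈ Icc (0 : ℝ) 1, A' t = A t := fun t ht => by
    rw [hA', IccExtend_of_mem _ _ ht]; rfl
  obtain ⟨K, hK⟩ := isCompact_Icc.exists_bound_of_continuousOn hA
  have hKA : ∀ t, ‖A' t‖ ≤ K := fun t => by
    rw [hA', IccExtend]; exact hK _ (projIcc 0 1 zero_le_one t).2
  have hK0 : 0 ≤ K := (norm_nonneg _).trans (hKA 0)
  obtain ⟨N, hN⟩ := exists_nat_gt (2 * K)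
  have hNpos : (0 : ℝ) < N := by linarith
  set δ : ℝ := 1 / N with hδ
  have hδpos : 0 < δ := by positivity
  have hKδ : K * δ ≤ 1 / 2 := by
    rw [hδ, mul_one_div, div_le_div_iff₀ hNpos two_pos]; linarith
  -- Solutions on intervals of the fixed length δ = 1/N are glued; N of them reach time 1 exactly.
  have key : ∀ n : ℕ, ∃ z : ℝ → F, z 0 = w ∧
      ∀ t ∈ Icc (0 : ℝ) (n * δ), HasDerivWithinAt z (A' t (z t)) (Icc 0 (n * δ)) t := by
    intro n
    induction n with
    | zero =>
      refine ⟨fun _ => w, rfl, fun t ht => ?_⟩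
      have : Icc (0 : ℝ) ((0 : ℕ) * δ) = {0} := by simp
      rw [this] at ht ⊢
      rw [mem_singleton_iff.1 ht]
      exact HasFDerivWithinAt.of_subsingleton subsingleton_singleton
    | succ n ih =>
      obtain ⟨z, hz0, hz⟩ := ih
      obtain ⟨y, hy0, hy⟩ := exists_linear_ode_short hA'c hK0 hKA hδpos.le hKδ (n * δ) (z (n * δ))
      have hs : ((n : ℝ) * δ + δ) = ((n + 1 : ℕ) : ℝ) * δ := by push_cast; ring
      rw [hs] at hy
      have hn0 : (0 : ℝ) ≤ n * δ := by positivity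
      have hn1 : (n : ℝ) * δ ≤ ((n + 1 : ℕ) : ℝ) * δ := by rw [← hs]; linarith
      set u : ℝ → F := fun t => if t ≤ n * δ then z t else y t with hu
      have huz : EqOn u z (Icc 0 (n * δ)) := fun t ht => if_pos ht.2
      have huy : EqOn u y (Icc (n * δ) (((n + 1 : ℕ) : ℝ) * δ)) := fun t ht => by
        by_cases h : t ≤ n * δ
        · have : t = n * δ := le_antisymm h ht.1
          simp only [hu, this, le_refl, if_true, hy0]
        · simp only [hu, if_neg h]
      refine ⟨u, by rw [← hz0]; exact huz ⟨le_rfl, hn0⟩, fun t ht => ?_⟩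
      rw [← Icc_union_Icc_eq_Icc hn0 hn1]
      rcases lt_trichotomy t (n * δ) with h | h | h
      · have h1 := ((hz t ⟨ht.1, h.le⟩).congr huz (huz ⟨ht.1, h.le⟩))
        rw [← huz ⟨ht.1, h.le⟩] at h1
        refine h1.mono_of_mem_nhdsWithin ?_
        refine mem_nhdsWithin.2 ⟨Iio (n * δ), isOpen_Iio, h, fun x hx => ?_⟩
        rcases hx.2 with h' | h'
        · exact h'
        · exact absurd hx.1 (not_lt.2 h'.1)
      · have m1 : t ∈ Icc (0 : ℝ) (n * δ) := ⟨ht.1, h.le⟩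
        have m2 : t ∈ Icc (n * δ) (((n + 1 : ℕ) : ℝ) * δ) := ⟨h.ge, ht.2⟩
        have h1 := (hz t m1).congr huz (huz m1)
        have h2 := (hy t m2).congr huy (huy m2)
        rw [← huz m1] at h1
        rw [← huy m2] at h2
        exact h1.union h2
      · have m2 : t ∈ Icc (n * δ) (((n + 1 : ℕ) : ℝ) * δ) := ⟨h.le, ht.2⟩
        have h2 := (hy t m2).congr huy (huy m2)
        rw [← huy m2] at h2
        refine h2.mono_of_mem_nhdsWithin ?_
        refine mem_nhdsWithin.2 ⟨Ioi (n * δ), isOpen_Ioi, h, fun x hx => ?_⟩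
        rcases hx.2 with h' | h'
        · exact absurd hx.1 (not_lt.2 h'.2)
        · exact h'
  obtain ⟨z, hz0, hz⟩ := key N
  have hN1 : (N : ℝ) * δ = 1 := by rw [hδ]; field_simp
  rw [hN1] at hz
  exact ⟨z, hz0, fun t ht => by rw [← hA'eq t ht]; exact hz t ht⟩

end LinearODE

/-! ### Smooth dependence of solutions on parameters, on convex sets -/

section SmoothDependence

variable {E₀ : Type*} [NormedAddCommGroup E₀]
  {E : Type*} [NormedAddCommGroup E] [NormedSpace ℝ E]

/-- Gronwall's bound δ e^{Kt} + (ε/K)(e^{Kt} - 1), coarsened by K ≥ 1 and t ≤ 1 to an expression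
linear in δ and ε. -/
theorem norm_le_of_hasDerivWithinAt_le {u u' : ℝ → E} {K δ ε : ℝ} (hK : 1 ≤ K) (hδ : 0 ≤ δ)
    (hε : 0 ≤ ε) (hu : ∀ t ∈ Icc (0 : ℝ) 1, HasDerivWithinAt u (u' t) (Icc 0 1) t)
    (h0 : ‖u 0‖ ≤ δ) (hb : ∀ t ∈ Icc (0 : ℝ) 1, ‖u' t‖ ≤ K * ‖u t‖ + ε) :
    ∀ t ∈ Icc (0 : ℝ) 1, ‖u t‖ ≤ (δ + ε) * Real.exp K := by
  intro t ht
  have h := norm_le_gronwallBound_of_norm_deriv_right_le (f := u) (f' := u') (δ := δ) (K := K)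
    (ε := ε) (a := 0) (b := 1) (fun t ht => (hu t ht).continuousWithinAt)
    (fun t ht => (hu t ⟨ht.1, ht.2.le⟩).mono_of_mem_nhdsWithin (Icc_mem_nhdsGE_of_mem ht)) h0
    (fun t ht => hb t ⟨ht.1, ht.2.le⟩) t ht
  refine h.trans ?_
  have hK0 : 0 < K := by linarith
  rw [gronwallBound_of_K_ne_0 hK0.ne', sub_zero]
  have e1 : Real.exp (K * t) ≤ Real.exp K := Real.exp_le_exp.2 (by nlinarith [ht.1, ht.2])
  have e2 : ε / K ≤ ε := div_le_self hε hK
  have e3 : 0 ≤ ε / K := by positivity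
  have e4 := Real.exp_pos (K * t)
  have e5 : 1 ≤ Real.exp (K * t) := Real.one_le_exp (mul_nonneg hK0.le ht.1)
  have : ε / K * (Real.exp (K * t) - 1) ≤ ε * Real.exp K :=
    mul_le_mul e2 (by linarith) (by linarith) hε
  nlinarith

variable {S₀ : Set E₀} {S : Set E} {v : E → E} {v' : E → E →L[ℝ] E} {Φ : E₀ → ℝ → E}

/-- Along the solutions `Φ x`, the vector field is uniformly well approximated by its
linearization at a given solution. -/
theorem eventually_norm_sub_sub_le (hS : Convex ℝ S)
    (hv : ∀ z ∈ S, HasFDerivWithinAt v (v' z) S z) (hv' : ContinuousOn v' S)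
    (hΦc : ContinuousOn (uncurry Φ) (S₀ ×ˢ Icc (0 : ℝ) 1))
    (hΦS : ∀ x ∈ S₀, ∀ t ∈ Icc (0 : ℝ) 1, Φ x t ∈ S) {x₀ : E₀} (hx₀ : x₀ ∈ S₀) {ε : ℝ}
    (hε : 0 < ε) :
    ∀ᶠ x in 𝓝[S₀] x₀, ∀ t ∈ Icc (0 : ℝ) 1,
      ‖v (Φ x t) - v (Φ x₀ t) - v' (Φ x₀ t) (Φ x t - Φ x₀ t)‖ ≤ ε * ‖Φ x t - Φ x₀ t‖ ∧
      ‖v' (Φ x t) - v' (Φ x₀ t)‖ ≤ ε := by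
  -- The derivative of v along the segment from Φ x₀ t to Φ x t, which lies in S by convexity. At x
  -- = x₀ it equals v' (Φ x₀ t) for every s, so compactness of the square of all (t, s) bounds the
  -- deviation at all times simultaneously; the mean value inequality then gives the first estimate.
  set f : E₀ → ℝ × ℝ → E →L[ℝ] E := fun x p =>
    v' (AffineMap.lineMap (Φ x₀ p.1) (Φ x p.1) p.2) with hf
  have hmem : ∀ x ∈ S₀, ∀ p ∈ Icc (0 : ℝ) 1 ×ˢ Icc (0 : ℝ) 1,
      AffineMap.lineMap (Φ x₀ p.1) (Φ x p.1) p.2 ∈ S := fun x hx p hp =>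
    hS.lineMap_mem (hΦS x₀ hx₀ _ hp.1) (hΦS x hx _ hp.1) hp.2
  have hfc : ContinuousOn (uncurry f) (S₀ ×ˢ (Icc (0 : ℝ) 1 ×ˢ Icc (0 : ℝ) 1)) := by
    refine hv'.comp ?_ (fun q hq => hmem q.1 hq.1 q.2 hq.2)
    have c1 : ContinuousOn (fun q : E₀ × ℝ × ℝ => Φ q.1 q.2.1)
        (S₀ ×ˢ (Icc (0 : ℝ) 1 ×ˢ Icc (0 : ℝ) 1)) :=
      hΦc.comp (f := fun q : E₀ × ℝ × ℝ => (q.1, q.2.1)) (by fun_prop)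
        (fun q hq => ⟨hq.1, hq.2.1⟩)
    have c2 : ContinuousOn (fun q : E₀ × ℝ × ℝ => Φ x₀ q.2.1)
        (S₀ ×ˢ (Icc (0 : ℝ) 1 ×ˢ Icc (0 : ℝ) 1)) :=
      hΦc.comp (f := fun q : E₀ × ℝ × ℝ => (x₀, q.2.1)) (by fun_prop)
        (fun q hq => ⟨hx₀, hq.2.1⟩)
    simp only [AffineMap.lineMap_apply_module]
    exact ((by fun_prop : Continuous fun q : E₀ × ℝ × ℝ => 1 - q.2.2).continuousOn.smul c2).add
      ((by fun_prop : Continuous fun q : E₀ × ℝ × ℝ => q.2.2).continuousOn.smul c1)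
  obtain ⟨N, hN, hNf⟩ := (isCompact_Icc.prod isCompact_Icc).mem_uniformity_of_prod hfc hx₀
    (Metric.dist_mem_uniformity hε)
  filter_upwards [hN, self_mem_nhdsWithin] with x hxN hx t ht
  have key : ∀ s ∈ Icc (0 : ℝ) 1,
      ‖v' (AffineMap.lineMap (Φ x₀ t) (Φ x t) s) - v' (Φ x₀ t)‖ ≤ ε := by
    intro s hs
    have := hNf x hxN (t, s) ⟨ht, hs⟩
    simp only [hf, mem_ofPred_eq, dist_eq_norm, AffineMap.lineMap_same, AffineMap.const_apply]
      at this
    exact this.le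
  constructor
  · have hseg : segment ℝ (Φ x₀ t) (Φ x t) ⊆ S :=
      hS.segment_subset (hΦS x₀ hx₀ t ht) (hΦS x hx t ht)
    refine Convex.norm_image_sub_le_of_norm_hasFDerivWithin_le' (f' := v')
      (s := segment ℝ (Φ x₀ t) (Φ x t))
      (fun z hz => (hv z (hseg hz)).mono hseg) (fun z hz => ?_) (convex_segment _ _)
      (left_mem_segment _ _ _) (right_mem_segment _ _ _)
    rw [segment_eq_image_lineMap] at hz
    obtain ⟨s, hs, rfl⟩ := hz
    exact key s hs
  · simpa using key 1 ⟨zero_le_one, le_rfl⟩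

theorem exists_bound_along (hv' : ContinuousOn v' S)
    (hΦc : ContinuousOn (uncurry Φ) (S₀ ×ˢ Icc (0 : ℝ) 1))
    (hΦS : ∀ x ∈ S₀, ∀ t ∈ Icc (0 : ℝ) 1, Φ x t ∈ S) {x₀ : E₀} (hx₀ : x₀ ∈ S₀) :
    ∃ K : ℝ, 1 ≤ K ∧ ∀ t ∈ Icc (0 : ℝ) 1, ‖v' (Φ x₀ t)‖ ≤ K := by
  have c : ContinuousOn (fun t => v' (Φ x₀ t)) (Icc (0 : ℝ) 1) :=
    hv'.comp (hΦc.comp (f := fun t : ℝ => (x₀, t)) (by fun_prop) (fun t ht => ⟨hx₀, ht⟩))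
      (fun t ht => hΦS x₀ hx₀ t ht)
  obtain ⟨K, hK⟩ := isCompact_Icc.exists_bound_of_continuousOn c
  exact ⟨max K 1, le_max_right _ _, fun t ht => (hK t ht).trans (le_max_left _ _)⟩

variable [NormedSpace ℝ E₀] {Ψ : E₀ → ℝ → E₀ →L[ℝ] E}

/-- The solutions of the linearized equation are the derivatives of the solutions with respect to
the parameter. -/
theorem hasFDerivWithinAt_flow (hS : Convex ℝ S)
    (hv : ∀ z ∈ S, HasFDerivWithinAt v (v' z) S z) (hv' : ContinuousOn v' S)
    (hΦc : ContinuousOn (uncurry Φ) (S₀ ×ˢ Icc (0 : ℝ) 1))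
    (hΦS : ∀ x ∈ S₀, ∀ t ∈ Icc (0 : ℝ) 1, Φ x t ∈ S)
    (hΦ : ∀ x ∈ S₀, ∀ t ∈ Icc (0 : ℝ) 1, HasDerivWithinAt (Φ x) (v (Φ x t)) (Icc 0 1) t)
    {x₀ : E₀} (hx₀ : x₀ ∈ S₀)
    (hΨ : ∀ t ∈ Icc (0 : ℝ) 1,
      HasDerivWithinAt (Ψ x₀) (v' (Φ x₀ t) ∘L Ψ x₀ t) (Icc 0 1) t)
    (h0 : HasFDerivWithinAt (fun x => Φ x 0) (Ψ x₀ 0) S₀ x₀) {t : ℝ} (ht : t ∈ Icc (0 : ℝ) 1) :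
    HasFDerivWithinAt (fun x => Φ x t) (Ψ x₀ t) S₀ x₀ := by
  obtain ⟨K, hK1, hK⟩ := exists_bound_along hv' hΦc hΦS hx₀
  have h0' := hasFDerivWithinAt_iff_isLittleO.1 h0
  -- Lipschitz estimate
  have lip : ∀ᶠ x in 𝓝[S₀] x₀, ∀ t ∈ Icc (0 : ℝ) 1,
      ‖Φ x t - Φ x₀ t‖ ≤ ((‖Ψ x₀ 0‖ + 1) * Real.exp (K + 1)) * ‖x - x₀‖ := by
    filter_upwards [eventually_norm_sub_sub_le hS hv hv' hΦc hΦS hx₀ one_pos,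
      h0'.def one_pos, self_mem_nhdsWithin] with x hx hx0 hxS
    intro t ht
    have := norm_le_of_hasDerivWithinAt_le (u := fun t => Φ x t - Φ x₀ t)
      (u' := fun t => v (Φ x t) - v (Φ x₀ t)) (K := K + 1) (δ := (‖Ψ x₀ 0‖ + 1) * ‖x - x₀‖)
      (ε := 0) (by linarith) (by positivity) le_rfl
      (fun t ht => (hΦ x hxS t ht).sub (hΦ x₀ hx₀ t ht)) ?_ ?_ t ht
    · calc _ ≤ _ := this
        _ = _ := by ring
    · have e1 : Φ x 0 - Φ x₀ 0 = (Φ x 0 - Φ x₀ 0 - Ψ x₀ 0 (x - x₀)) + Ψ x₀ 0 (x - x₀) := by abel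
      have e2 := (Ψ x₀ 0).le_opNorm (x - x₀)
      rw [e1]
      refine (norm_add_le _ _).trans ?_
      rw [one_mul] at hx0
      linarith
    · intro t ht
      have e1 : v (Φ x t) - v (Φ x₀ t) = (v (Φ x t) - v (Φ x₀ t) - v' (Φ x₀ t) (Φ x t - Φ x₀ t))
        + v' (Φ x₀ t) (Φ x t - Φ x₀ t) := by abel
      rw [e1]
      refine (norm_add_le _ _).trans ?_
      have e2 := (v' (Φ x₀ t)).le_of_opNorm_le (hK t ht) (Φ x t - Φ x₀ t)
      have e3 := (hx t ht).1
      linarith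
  set C : ℝ := (‖Ψ x₀ 0‖ + 1) * Real.exp (K + 1) with hC
  have hC0 : 0 ≤ C := by positivity
  refine HasFDerivWithinAt.of_isLittleO (Asymptotics.isLittleO_iff.2 fun c hc => ?_)
  -- The remainder has initial error at most ε‖x - x₀‖ and forcing at most εC‖x - x₀‖, so with this
  -- choice Gronwall's bound is exactly c‖x - x₀‖.
  set ε : ℝ := c / ((1 + C) * Real.exp K) with hεd
  have hε : 0 < ε := by positivity
  filter_upwards [eventually_norm_sub_sub_le hS hv hv' hΦc hΦS hx₀ hε,
      h0'.def hε, self_mem_nhdsWithin, lip] with x hx hx0 hxS hlip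
  have := norm_le_of_hasDerivWithinAt_le (u := fun t => Φ x t - Φ x₀ t - Ψ x₀ t (x - x₀))
      (u' := fun t => v (Φ x t) - v (Φ x₀ t) - v' (Φ x₀ t) (Ψ x₀ t (x - x₀))) (K := K)
      (δ := ε * ‖x - x₀‖) (ε := ε * C * ‖x - x₀‖) hK1 (by positivity) (by positivity)
      (fun t ht => ((hΦ x hxS t ht).sub (hΦ x₀ hx₀ t ht)).sub ?_) hx0 ?_ t ht
  · calc _ ≤ _ := this
      _ = c * ‖x - x₀‖ := by rw [hεd]; field_simp
  · have := (hΨ t ht).clm_apply (hasDerivWithinAt_const t (Icc (0 : ℝ) 1) (x - x₀))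
    simpa using this
  · intro t ht
    have e1 : v (Φ x t) - v (Φ x₀ t) - v' (Φ x₀ t) (Ψ x₀ t (x - x₀)) =
        v' (Φ x₀ t) (Φ x t - Φ x₀ t - Ψ x₀ t (x - x₀)) +
        (v (Φ x t) - v (Φ x₀ t) - v' (Φ x₀ t) (Φ x t - Φ x₀ t)) := by
      rw [map_sub (v' (Φ x₀ t)) (Φ x t - Φ x₀ t)]; abel
    rw [e1]
    refine (norm_add_le _ _).trans ?_
    have e2 := (v' (Φ x₀ t)).le_of_opNorm_le (hK t ht) (Φ x t - Φ x₀ t - Ψ x₀ t (x - x₀))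
    have e3 := (hx t ht).1
    have e4 := mul_le_mul_of_nonneg_left (hlip t ht) hε.le
    rw [← mul_assoc] at e4
    linarith

/-- The solutions of the linearized equation depend continuously on the parameter. -/
theorem continuousOn_linearized_flow (hS : Convex ℝ S)
    (hv : ∀ z ∈ S, HasFDerivWithinAt v (v' z) S z) (hv' : ContinuousOn v' S)
    (hΦc : ContinuousOn (uncurry Φ) (S₀ ×ˢ Icc (0 : ℝ) 1))
    (hΦS : ∀ x ∈ S₀, ∀ t ∈ Icc (0 : ℝ) 1, Φ x t ∈ S)
    (hΨ : ∀ x ∈ S₀, ∀ t ∈ Icc (0 : ℝ) 1,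
      HasDerivWithinAt (Ψ x) (v' (Φ x t) ∘L Ψ x t) (Icc 0 1) t)
    (h0 : ContinuousOn (fun x => Ψ x 0) S₀) :
    ContinuousOn (uncurry Ψ) (S₀ ×ˢ Icc (0 : ℝ) 1) := by
  rintro ⟨x₀, t₀⟩ ⟨hx₀, ht₀⟩
  obtain ⟨K, hK1, hK⟩ := exists_bound_along hv' hΦc hΦS hx₀
  have hΨc : ContinuousOn (Ψ x₀) (Icc 0 1) := fun t ht => (hΨ x₀ hx₀ t ht).continuousWithinAt
  obtain ⟨M, hM⟩ := isCompact_Icc.exists_bound_of_continuousOn hΨc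
  have hM0 : 0 ≤ M := (norm_nonneg _).trans (hM t₀ ht₀)
  have hd : ∀ c > 0, ∀ᶠ x in 𝓝[S₀] x₀, ∀ t ∈ Icc (0 : ℝ) 1, ‖Ψ x t - Ψ x₀ t‖ ≤ c := by
    intro c hc
    -- The difference of two linearized solutions solves the equation at x, whose coefficient has
    -- norm at most K + 1 since ε ≤ 1, with an inhomogeneity of norm at most εM. Gronwall's bound is
    -- then ε(1 + M)e^{K+1} ≤ c.
    set ε : ℝ := min 1 (c / ((1 + M) * Real.exp (K + 1))) with hεd
    have hε : 0 < ε := by positivity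
    have hε1 : ε ≤ 1 := min_le_left _ _
    have hεc : ε * ((1 + M) * Real.exp (K + 1)) ≤ c := by
      rw [← le_div_iff₀ (by positivity)]; exact min_le_right _ _
    filter_upwards [eventually_norm_sub_sub_le hS hv hv' hΦc hΦS hx₀ hε,
      self_mem_nhdsWithin, (h0 x₀ hx₀).eventually (Metric.closedBall_mem_nhds _ hε)]
      with x hx hxS hx0 t ht
    rw [dist_eq_norm] at hx0
    have := norm_le_of_hasDerivWithinAt_le (u := fun t => Ψ x t - Ψ x₀ t)
      (u' := fun t => v' (Φ x t) ∘L Ψ x t - v' (Φ x₀ t) ∘L Ψ x₀ t) (K := K + 1)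
      (δ := ε) (ε := ε * M) (by linarith) hε.le (by positivity)
      (fun t ht => (hΨ x hxS t ht).sub (hΨ x₀ hx₀ t ht)) hx0 ?_ t ht
    · calc _ ≤ _ := this
        _ = ε * ((1 + M) * Real.exp (K + 1)) := by ring
        _ ≤ c := hεc
    · intro t ht
      have e1 : v' (Φ x t) ∘L Ψ x t - v' (Φ x₀ t) ∘L Ψ x₀ t =
          v' (Φ x t) ∘L (Ψ x t - Ψ x₀ t) + (v' (Φ x t) - v' (Φ x₀ t)) ∘L Ψ x₀ t := by
        rw [ContinuousLinearMap.comp_sub, ContinuousLinearMap.sub_comp]; abel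
      rw [e1]
      refine (norm_add_le _ _).trans ?_
      have n1 : ‖v' (Φ x t)‖ ≤ K + 1 := by
        have e : v' (Φ x t) = (v' (Φ x t) - v' (Φ x₀ t)) + v' (Φ x₀ t) := by abel
        rw [e]
        exact (norm_add_le _ _).trans (by linarith [(hx t ht).2, hK t ht])
      refine add_le_add ?_ ?_
      · exact (ContinuousLinearMap.opNorm_comp_le _ _).trans
          (mul_le_mul_of_nonneg_right n1 (norm_nonneg _))
      · exact (ContinuousLinearMap.opNorm_comp_le _ _).trans
          (mul_le_mul (hx t ht).2 (hM t ht) (norm_nonneg _) hε.le)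
  rw [Metric.continuousWithinAt_iff']
  intro c hc
  rw [nhdsWithin_prod_eq]
  filter_upwards [(hd (c / 3) (by positivity)).prod_mk
    (((hΨc t₀ ht₀).eventually (Metric.ball_mem_nhds _ (half_pos hc))).and self_mem_nhdsWithin)]
    with p hp
  have h1 := hp.1 p.2 hp.2.2
  have h2 := hp.2.1
  rw [dist_eq_norm] at h2 ⊢
  change ‖Ψ p.1 p.2 - Ψ x₀ t₀‖ < c
  have e : Ψ p.1 p.2 - Ψ x₀ t₀ = (Ψ p.1 p.2 - Ψ x₀ p.2) + (Ψ x₀ p.2 - Ψ x₀ t₀) := by abel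
  rw [e]
  exact (norm_add_le _ _).trans_lt (by linarith)

end SmoothDependence

/-- Solutions of a smooth differential equation on a convex set depend smoothly on parameters. -/
theorem contDiffOn_flow_nat {E₀ : Type u} [NormedAddCommGroup E₀] [NormedSpace ℝ E₀]
    {S₀ : Set E₀} (hS₀ : UniqueDiffOn ℝ S₀) (n : ℕ) :
    ∀ {E : Type u} [NormedAddCommGroup E] [NormedSpace ℝ E] [CompleteSpace E] {S : Set E}
      {v : E → E} {Φ : E₀ → ℝ → E}, Convex ℝ S → UniqueDiffOn ℝ S → ContDiffOn ℝ n v S →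
      ContinuousOn (uncurry Φ) (S₀ ×ˢ Icc (0 : ℝ) 1) →
      (∀ x ∈ S₀, ∀ t ∈ Icc (0 : ℝ) 1, Φ x t ∈ S) →
      (∀ x ∈ S₀, ∀ t ∈ Icc (0 : ℝ) 1, HasDerivWithinAt (Φ x) (v (Φ x t)) (Icc 0 1) t) →
      ContDiffOn ℝ n (fun x => Φ x 0) S₀ →
      ∀ t ∈ Icc (0 : ℝ) 1, ContDiffOn ℝ n (fun x => Φ x t) S₀ := by
  -- The space E is generalized: Φ together with its derivative Ψ solves an equation of the same
  -- kind on E × (E₀ →L[ℝ] E), whose field (v, v' ∘ ·) has one order of smoothness less. This is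
  -- also why E₀ and E share a universe.
  induction n with
  | zero =>
    intro E _ _ _ S v Φ _ _ _ hΦc _ _ _ t ht
    rw [Nat.cast_zero, contDiffOn_zero]
    exact hΦc.comp (f := fun x : E₀ => (x, t)) (by fun_prop) (fun x hx => ⟨hx, ht⟩)
  | succ n ih =>
    intro E _ _ _ S v Φ hSc hSu hv hΦc hΦS hΦ h0 t ht
    push_cast at hv h0 ⊢
    obtain ⟨hvd, -, hv'⟩ := (contDiffOn_succ_iff_fderivWithin hSu).1 hv
    obtain ⟨h0d, -, h0'⟩ := (contDiffOn_succ_iff_fderivWithin hS₀).1 h0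
    set v' := fderivWithin ℝ v S
    have hvd' : ∀ z ∈ S, HasFDerivWithinAt v (v' z) S z := fun z hz => (hvd z hz).hasFDerivWithinAt
    have hlin : ∀ x : E₀, ∃ z : ℝ → E₀ →L[ℝ] E, x ∈ S₀ →
        z 0 = fderivWithin ℝ (fun x => Φ x 0) S₀ x ∧ ∀ t ∈ Icc (0 : ℝ) 1,
          HasDerivWithinAt z (v' (Φ x t) ∘L z t) (Icc 0 1) t := by
      intro x
      by_cases hx : x ∈ S₀
      · have c : ContinuousOn (fun t => v' (Φ x t)) (Icc (0 : ℝ) 1) :=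
          hv'.continuousOn.comp (hΦc.comp (f := fun t : ℝ => (x, t)) (by fun_prop)
            (fun t ht => ⟨hx, ht⟩)) (fun t ht => hΦS x hx t ht)
        obtain ⟨z, hz0, hz⟩ := exists_linear_ode
          (A := fun t => ContinuousLinearMap.compL ℝ E₀ E E (v' (Φ x t)))
          ((ContinuousLinearMap.compL ℝ E₀ E E).continuous.comp_continuousOn c)
          (fderivWithin ℝ (fun x => Φ x 0) S₀ x)
        exact ⟨z, fun _ => ⟨hz0, hz⟩⟩
      · exact ⟨0, fun h => absurd h hx⟩
    choose Ψ hΨ using hlin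
    have hΨc : ContinuousOn (uncurry Ψ) (S₀ ×ˢ Icc (0 : ℝ) 1) :=
      continuousOn_linearized_flow hSc hvd' hv'.continuousOn hΦc hΦS (fun x hx => (hΨ x hx).2)
        (h0'.continuousOn.congr fun x hx => (hΨ x hx).1)
    have hder : ∀ x ∈ S₀, HasFDerivWithinAt (fun x => Φ x t) (Ψ x t) S₀ x := fun x hx =>
      hasFDerivWithinAt_flow hSc hvd' hv'.continuousOn hΦc hΦS hΦ hx (hΨ x hx).2
        ((hΨ x hx).1 ▸ (h0d x hx).hasFDerivWithinAt) ht
    have haug := ih (E := E × (E₀ →L[ℝ] E)) (S := S ×ˢ univ)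
      (v := fun p => (v p.1, v' p.1 ∘L p.2)) (Φ := fun x t => (Φ x t, Ψ x t))
      (hSc.prod convex_univ) (hSu.prod uniqueDiffOn_univ)
      (ContDiffOn.prodMk
        ((hv.of_le (by exact_mod_cast Nat.le_succ n)).comp contDiff_fst.contDiffOn fun p hp => hp.1)
        ((hv'.comp contDiff_fst.contDiffOn fun p hp => hp.1).clm_comp contDiff_snd.contDiffOn))
      (ContinuousOn.prodMk hΦc hΨc) (fun x hx t ht => ⟨hΦS x hx t ht, mem_univ _⟩)
      (fun x hx t ht => (hΦ x hx t ht).prodMk ((hΨ x hx).2 t ht))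
      (ContDiffOn.prodMk (h0.of_le (by exact_mod_cast Nat.le_succ n))
        (h0'.congr fun x hx => (hΨ x hx).1)) t ht
    refine (contDiffOn_succ_iff_fderivWithin hS₀).2
      ⟨fun x hx => (hder x hx).differentiableWithinAt, by simp, ?_⟩
    exact (contDiff_snd.comp_contDiffOn haug).congr
      fun x hx => (hder x hx).fderivWithin (hS₀ x hx)

theorem contDiffOn_flow {E₀ : Type u} [NormedAddCommGroup E₀] [NormedSpace ℝ E₀]
    {S₀ : Set E₀} (hS₀ : UniqueDiffOn ℝ S₀)
    {E : Type u} [NormedAddCommGroup E] [NormedSpace ℝ E] [CompleteSpace E] {S : Set E}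
    {v : E → E} {Φ : E₀ → ℝ → E} (hSc : Convex ℝ S) (hSu : UniqueDiffOn ℝ S)
    (hv : ContDiffOn ℝ ∞ v S) (hΦc : ContinuousOn (uncurry Φ) (S₀ ×ˢ Icc (0 : ℝ) 1))
    (hΦS : ∀ x ∈ S₀, ∀ t ∈ Icc (0 : ℝ) 1, Φ x t ∈ S)
    (hΦ : ∀ x ∈ S₀, ∀ t ∈ Icc (0 : ℝ) 1, HasDerivWithinAt (Φ x) (v (Φ x t)) (Icc 0 1) t)
    (h0 : ContDiffOn ℝ ∞ (fun x => Φ x 0) S₀) {t : ℝ} (ht : t ∈ Icc (0 : ℝ) 1) :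
    ContDiffOn ℝ ∞ (fun x => Φ x t) S₀ :=
  contDiffOn_infty.2 fun n => contDiffOn_flow_nat hS₀ n hSc hSu (contDiffOn_infty.1 hv n) hΦc hΦS hΦ
    (contDiffOn_infty.1 h0 n) t ht

/-! ### Smoothness of inverse maps on sets with unique derivatives -/

section InverseWithin

variable {E F : Type*} [NormedAddCommGroup E] [NormedSpace ℝ E] [CompleteSpace E]
  [NormedAddCommGroup F] [NormedSpace ℝ F]

/-- A continuous inverse of a smooth map between sets with unique derivatives is smooth, if the
derivatives are invertible. -/
theorem contDiffOn_of_inverse {f : E → F} {g : F → E} {s : Set E} {t : Set F}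
    (hs : UniqueDiffOn ℝ s) (ht : UniqueDiffOn ℝ t) (hf : ContDiffOn ℝ ∞ f s)
    (hf' : ∀ x ∈ s, ∃ A : E ≃L[ℝ] F, HasFDerivWithinAt f (A : E →L[ℝ] F) s x)
    (hg : ContinuousOn g t) (hgs : MapsTo g t s) (hfg : ∀ y ∈ t, f (g y) = y) :
    ContDiffOn ℝ ∞ g t := by
  have hder : ∀ y ∈ t, HasFDerivWithinAt g
      (ContinuousLinearMap.inverse (fderivWithin ℝ f s (g y))) t y := fun y hy => by
    obtain ⟨A, hA⟩ := hf' _ (hgs hy)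
    rw [hA.fderivWithin (hs _ (hgs hy)), ContinuousLinearMap.inverse_equiv]
    exact HasFDerivWithinAt.of_local_left_inverse (f := f) (t := s)
      (tendsto_nhdsWithin_of_tendsto_nhds_of_eventually_within _ (hg y hy)
        (eventually_mem_nhdsWithin.mono hgs)) hA hy (eventually_mem_nhdsWithin.mono hfg)
  -- Bootstrapping: the derivative of g is the composite of operator inversion, the derivative of f,
  -- and g itself. So if g is C^n, its derivative is C^n, and g is C^(n+1).
  have hf'' : ContDiffOn ℝ ∞ (fderivWithin ℝ f s) s := hf.fderivWithin hs (by simp)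
  rw [contDiffOn_infty]
  intro n
  induction n with
  | zero => rw [Nat.cast_zero, contDiffOn_zero]; exact hg
  | succ n ih =>
    push_cast
    refine (contDiffOn_succ_iff_fderivWithin ht).2
      ⟨fun x hx => (hder x hx).differentiableWithinAt, by simp, ?_⟩
    have h1 : ContDiffOn ℝ n (fun y => ContinuousLinearMap.inverse (fderivWithin ℝ f s (g y))) t := by
      intro y hy
      obtain ⟨A, hA⟩ := hf' _ (hgs hy)
      have h3 := contDiffAt_map_inverse (𝕜 := ℝ) (n := n) A
      rw [← hA.fderivWithin (hs _ (hgs hy))] at h3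
      exact h3.comp_contDiffWithinAt y
        (((contDiffOn_infty.1 hf'' n).comp ih hgs) y hy)
    exact h1.congr fun y hy => (hder y hy).fderivWithin (ht y hy)

end InverseWithin

/-! ### Lipschitz extension of a vector field from the quadrant -/

section Extension

variable {m : ℕ}

/-- The quadrant `[0,∞)^m` as a subset of `ℝ^m`. -/
def quadrant (m : ℕ) : Set (EuclideanSpace ℝ (Fin m)) := {z | ∀ i, 0 ≤ z i}

theorem range_cornerModel (m : ℕ) : range (cornerModel m) = quadrant m := range_euclideanQuadrant m

theorem convex_quadrant (m : ℕ) : Convex ℝ (quadrant m) := EuclideanQuadrant.convex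

theorem uniqueDiffOn_quadrant (m : ℕ) : UniqueDiffOn ℝ (quadrant m) :=
  range_cornerModel m ▸ (cornerModel m).uniqueDiffOn

theorem abs_apply_le_norm (z : EuclideanSpace ℝ (Fin m)) (k : Fin m) : |z k| ≤ ‖z‖ :=
  PiLp.norm_apply_le z k

/-- The nearest point of a box. -/
noncomputable def clipBox (lo hi : Fin m → ℝ) (z : EuclideanSpace ℝ (Fin m)) :
    EuclideanSpace ℝ (Fin m) := WithLp.toLp 2 fun k => max (lo k) (min (hi k) (z k))

theorem lipschitzWith_clipBox (lo hi : Fin m → ℝ) : LipschitzWith 1 (clipBox lo hi) := by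
  refine LipschitzWith.of_dist_le_mul fun x y => ?_
  rw [NNReal.coe_one, one_mul, EuclideanSpace.dist_eq, EuclideanSpace.dist_eq]
  refine Real.sqrt_le_sqrt (Finset.sum_le_sum fun k _ => ?_)
  refine pow_le_pow_left₀ dist_nonneg ?_ 2
  simp only [clipBox, Real.dist_eq]
  rw [max_comm (lo k), max_comm (lo k)]
  refine (abs_max_sub_max_le_abs _ _ _).trans ?_
  simpa using abs_min_sub_min_le_max (hi k) (x k) (hi k) (y k)

/-- Near a point of the quadrant, a smooth vector field that is tangent to all faces but the
`i`-th extends to a bounded Lipschitz vector field whose other normal components vanish outside of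
the quadrant. -/
theorem exists_lipschitz_extension {a : EuclideanSpace ℝ (Fin m)} (ha : a ∈ quadrant m)
    {i : Fin m} {N : Set (EuclideanSpace ℝ (Fin m))} (hN : N ∈ 𝓝 a)
    {v : EuclideanSpace ℝ (Fin m) → EuclideanSpace ℝ (Fin m)}
    (hv : ContDiffOn ℝ ∞ v (quadrant m ∩ N))
    (htan : ∀ z ∈ quadrant m ∩ N, ∀ k ≠ i, z k = 0 → v z k = 0) :
    ∃ (w : EuclideanSpace ℝ (Fin m) → EuclideanSpace ℝ (Fin m)) (r : ℝ) (K L : ℝ≥0), 0 < r ∧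
      LipschitzWith K w ∧ (∀ z, ‖w z‖ ≤ L) ∧ (∀ z, ∃ y ∈ quadrant m ∩ N, w z = v y) ∧
      (∀ z ∈ quadrant m, ‖z - a‖ < r → w z = v z) ∧
      (∀ k ≠ i, a k = 0 → ∀ z, |w z k| ≤ K * max (z k) 0) ∧ (∀ k, a k ≠ 0 → r ≤ a k) ∧
      Metric.ball a r ⊆ N := by
  have hc : Tendsto (fun w : Fin m → ℝ => (WithLp.toLp 2 w : EuclideanSpace ℝ (Fin m)))
      (𝓝 a.ofLp) (𝓝 a) := (PiLp.continuous_toLp 2 (fun _ : Fin m => ℝ)).tendsto' _ _ rfl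
  -- A ball for the sup norm, since the field will be clipped to a box.
  obtain ⟨r₁, hr₁, hr₁N⟩ := Metric.nhds_basis_closedBall.mem_iff.1 (hc hN)
  obtain ⟨r₂, hr₂, hr₂N⟩ := Metric.mem_nhds_iff.1 hN
  have hr₃ : ∃ r₃ > 0, ∀ k, a k ≠ 0 → r₃ ≤ a k := by
    have : ∀ k, ∀ᶠ r in 𝓝[>] (0 : ℝ), a k ≠ 0 → r ≤ a k := by
      intro k
      by_cases h : a k = 0
      · simp [h]
      · have hpos : 0 < a k := lt_of_le_of_ne (ha k) (Ne.symm h)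
        filter_upwards [nhdsWithin_le_nhds (Iio_mem_nhds hpos)] with r hr _ using le_of_lt hr
    obtain ⟨r, hr, hr0⟩ := ((eventually_all.2 this).and self_mem_nhdsWithin).exists
    exact ⟨r, hr0, hr⟩
  obtain ⟨r₃, hr₃, hr₃a⟩ := hr₃
  set r := min r₁ (min r₂ r₃) with hr
  have hrpos : 0 < r := by positivity
  have h1 : r ≤ r₁ := min_le_left _ _
  have h2 : r ≤ r₂ := (min_le_right _ _).trans (min_le_left _ _)
  have h3 : r ≤ r₃ := (min_le_right _ _).trans (min_le_right _ _)
  -- The box around a, cut off at the faces, lies in quadrant ∩ N, and its k-th lower bound is 0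
  -- whenever a k = 0. On it v is Lipschitz by compactness and convexity; the extension is v
  -- composed with the nearest-point map of the box.
  set lo : Fin m → ℝ := fun k => max 0 (a k - r) with hlo
  set hi : Fin m → ℝ := fun k => a k + r with hhi
  have hlohi : ∀ k, lo k ≤ hi k := fun k => max_le (by have := ha k; simp only [hhi]; linarith)
    (by simp only [hhi]; linarith)
  set B : Set (EuclideanSpace ℝ (Fin m)) := {z | ∀ k, z k ∈ Icc (lo k) (hi k)} with hB
  have hBQ : B ⊆ quadrant m ∩ N := by
    intro z hz
    refine ⟨fun k => (le_max_left _ _).trans (hz k).1, ?_⟩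
    have : z.ofLp ∈ Metric.closedBall a.ofLp r₁ := by
      rw [Metric.mem_closedBall, dist_pi_le_iff hr₁.le]
      intro k
      rw [Real.dist_eq, abs_le]
      have e1 := (le_max_right _ _).trans (hz k).1
      have e2 := (hz k).2
      simp only [hhi] at e2
      constructor <;> linarith
    exact hr₁N this
  have hBconv : Convex ℝ B := by
    have : B = ⋂ k, (EuclideanSpace.proj (𝕜 := ℝ) k) ⁻¹' Icc (lo k) (hi k) := by
      ext z; simp [hB]
    rw [this]
    exact convex_iInter fun k => (convex_Icc _ _).linear_preimage (EuclideanSpace.proj k).toLinearMap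
  have hBcomp : IsCompact B := by
    have : B = (fun w : Fin m → ℝ => (WithLp.toLp 2 w : EuclideanSpace ℝ (Fin m))) ''
        (Set.pi univ fun k => Icc (lo k) (hi k)) := by
      ext z
      constructor
      · intro hz
        exact ⟨z.ofLp, fun k _ => hz k, rfl⟩
      · rintro ⟨w, hw, rfl⟩ k
        exact hw k (mem_univ k)
    rw [this]
    exact (isCompact_univ_pi fun k => isCompact_Icc).image (PiLp.continuous_toLp 2 _)
  have hvB : ContDiffOn ℝ ∞ v B := hv.mono hBQ
  obtain ⟨K, hK⟩ := hvB.exists_lipschitzOnWith (by simp) hBconv hBcomp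
  obtain ⟨L, hL⟩ := hBcomp.exists_bound_of_continuousOn hvB.continuousOn
  have hclip : ∀ z, clipBox lo hi z ∈ B := fun z k =>
    ⟨le_max_left _ _, max_le (hlohi k) (min_le_left _ _)⟩
  have hclip_eq : ∀ z ∈ quadrant m, ‖z - a‖ < r → clipBox lo hi z = z := by
    intro z hz hza
    ext k
    have := (abs_lt.1 ((abs_apply_le_norm (z - a) k).trans_lt hza))
    simp only [PiLp.sub_apply] at this
    simp only [clipBox, hlo, hhi]
    rw [min_eq_right (by linarith), max_eq_right (max_le (hz k) (by linarith))]
  refine ⟨fun z => v (clipBox lo hi z), r, K, L.toNNReal, hrpos, ?_, ?_, ?_, ?_, ?_, ?_, ?_⟩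
  · have := hK.comp (lipschitzWith_clipBox lo hi).lipschitzOnWith (fun z (_ : z ∈ univ) => hclip z)
    rw [mul_one, lipschitzOnWith_univ] at this
    exact this
  · intro z
    exact (hL _ (hclip z)).trans (Real.le_coe_toNNReal L)
  · exact fun z => ⟨_, hBQ (hclip z), rfl⟩
  · intro z hz hza
    simp only [hclip_eq z hz hza]
  · intro k hk hak z
    set y := clipBox lo hi z with hy
    -- The foot of y on the k-th face is still in the box. There v has no k-th component by
    -- tangency, so the Lipschitz bound between y and y' gives |v y k| ≤ K |y k|.
    set y' : EuclideanSpace ℝ (Fin m) := y - EuclideanSpace.single k (y k) with hy'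
    have hlok : lo k = 0 := by simp only [hlo, hak]; rw [max_eq_left (by linarith)]
    have hy'k : y' k = 0 := by simp [hy']
    have hy'B : y' ∈ B := by
      intro j
      by_cases hj : j = k
      · subst hj; rw [hy'k, hlok]; exact ⟨le_rfl, hlok ▸ hlohi j⟩
      · have : y' j = y j := by simp [hy', hj]
        rw [this]; exact hclip z j
    have hv0 : v y' k = 0 := htan y' (hBQ hy'B) k hk hy'k
    have hyk : 0 ≤ y k ∧ y k ≤ max (z k) 0 := by
      refine ⟨hlok ▸ (hclip z k).1, ?_⟩
      simp only [hy, clipBox, hlok]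
      exact max_le (le_max_right _ _) ((min_le_right _ _).trans (le_max_left _ _))
    calc |v y k| = |(v y - v y') k| := by simp [hv0]
      _ ≤ ‖v y - v y'‖ := abs_apply_le_norm _ _
      _ ≤ K * ‖y - y'‖ := by
        have := hK.dist_le_mul y (hclip z) y' hy'B
        rwa [dist_eq_norm, dist_eq_norm] at this
      _ = K * y k := by rw [hy', sub_sub_cancel]; simp [abs_of_nonneg hyk.1]
      _ ≤ K * max (z k) 0 := mul_le_mul_of_nonneg_left hyk.2 K.2
  · exact fun k hk => h3.trans (hr₃a k hk)
  · exact (Metric.ball_subset_ball h2).trans hr₂N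

end Extension

/-! ### Straightening a vector field in the quadrant -/

section FlowBox

/-- Uniqueness of the zero solution in both time directions; the past is reduced to the future by
reversing time. -/
theorem eq_zero_of_abs_deriv_le {u u' : ℝ → ℝ} {K : ℝ}
    (hu : ∀ t ∈ Icc (-1 : ℝ) 1, HasDerivWithinAt u (u' t) (Icc (-1) 1) t)
    (hb : ∀ t ∈ Icc (-1 : ℝ) 1, ‖u' t‖ ≤ K * ‖u t‖) {t₀ : ℝ} (ht₀ : t₀ ∈ Icc (-1 : ℝ) 1)
    (h0 : u t₀ = 0) : ∀ t ∈ Icc (-1 : ℝ) 1, u t = 0 := by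
  have right : ∀ {u u' : ℝ → ℝ} {t₀ : ℝ},
      (∀ t ∈ Icc (-1 : ℝ) 1, HasDerivWithinAt u (u' t) (Icc (-1) 1) t) →
      (∀ t ∈ Icc (-1 : ℝ) 1, ‖u' t‖ ≤ K * ‖u t‖) → t₀ ∈ Icc (-1 : ℝ) 1 → u t₀ = 0 →
      ∀ t ∈ Icc t₀ 1, u t = 0 := by
    intro u u' t₀ hu hb ht₀ h0
    refine eq_zero_of_abs_deriv_le_mul_abs_self_of_eq_zero_right (f' := u') (K := K)
      (fun t ht => ((hu t ⟨ht₀.1.trans ht.1, ht.2⟩).continuousWithinAt).mono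
        (Icc_subset_Icc_left ht₀.1)) (fun t ht => ?_) h0
      (fun t ht => hb t ⟨ht₀.1.trans ht.1, ht.2.le⟩)
    exact (hu t ⟨ht₀.1.trans ht.1, ht.2.le⟩).mono_of_mem_nhdsWithin
      (Icc_mem_nhdsGE_of_mem ⟨ht₀.1.trans ht.1, ht.2⟩)
  intro t ht
  rcases le_total t₀ t with h | h
  · exact right hu hb ht₀ h0 t ⟨h, ht.2⟩
  · have neg_mem : ∀ {t : ℝ}, t ∈ Icc (-1 : ℝ) 1 → -t ∈ Icc (-1 : ℝ) 1 := fun {t} ht =>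
      ⟨by linarith [ht.2], by linarith [ht.1]⟩
    have := right (u := fun t => u (-t)) (u' := fun t => -u' (-t)) (t₀ := -t₀)
      (fun t ht => by
        have := (hu (-t) (neg_mem ht)).scomp t ((hasDerivAt_neg t).hasDerivWithinAt (s := Icc (-1) 1))
          (fun s hs => neg_mem hs)
        simpa [Function.comp_def] using this)
      (fun t ht => by simpa using hb (-t) (neg_mem ht)) (neg_mem ht₀) (by simpa using h0) (-t)
      ⟨by linarith, by linarith [ht.1]⟩
    simpa using this

variable {m : ℕ}

/-- The linear isomorphism that fixes the hyperplane `z i = 0` and maps the `i`-th basis vector to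
a vector with non-zero `i`-th coordinate. -/
noncomputable def shearEquiv (i : Fin m) (b : EuclideanSpace ℝ (Fin m)) (hb : b i ≠ 0) :
    EuclideanSpace ℝ (Fin m) ≃L[ℝ] EuclideanSpace ℝ (Fin m) :=
  ContinuousLinearEquiv.equivOfInverse
    (ContinuousLinearMap.id ℝ _ +
      (EuclideanSpace.proj (𝕜 := ℝ) i).smulRight (b - EuclideanSpace.single i 1))
    (ContinuousLinearMap.id ℝ _ -
      ((b i)⁻¹ • EuclideanSpace.proj (𝕜 := ℝ) i).smulRight (b - EuclideanSpace.single i 1))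
    (fun z => by
      have : (b i)⁻¹ * (z i + z i * (b i - 1)) = z i := by field_simp; ring
      simp [this])
    (fun z => by
      have : z i - (b i)⁻¹ * z i * (b i - 1) = (b i)⁻¹ * z i := by field_simp; ring
      simp [this])

theorem shearEquiv_apply (i : Fin m) (b : EuclideanSpace ℝ (Fin m)) (hb : b i ≠ 0)
    (z : EuclideanSpace ℝ (Fin m)) :
    shearEquiv i b hb z = (z - EuclideanSpace.single i (z i)) + z i • b := by
  have : EuclideanSpace.single i (z i) = z i • EuclideanSpace.single i (1 : ℝ) := by
    ext k; simp
  rw [this]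
  change z + z i • (b - EuclideanSpace.single i 1) = _
  rw [smul_sub]; abel

/-- A map this close to L is bounded below, hence injective, and in finite dimension injectivity
suffices. -/
theorem exists_equiv_of_norm_sub_le {E : Type*} [NormedAddCommGroup E] [NormedSpace ℝ E]
    [FiniteDimensional ℝ E] [Nontrivial E] (L : E ≃L[ℝ] E) {D : E →L[ℝ] E} {C : ℝ≥0}
    (hD : ‖D - L‖ ≤ C) (hC : C < ‖(L.symm : E →L[ℝ] E)‖₊⁻¹) :
    ∃ A : E ≃L[ℝ] E, (A : E →L[ℝ] E) = D := by
  have hinj : Injective D := by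
    rw [injective_iff_map_eq_zero]
    intro u hu
    by_contra hne
    have h1 : ‖L u‖ ≤ C * ‖u‖ := by
      have := (D - L).le_of_opNorm_le hD u
      simpa [hu] using this
    have h2 : ‖u‖ ≤ ‖(L.symm : E →L[ℝ] E)‖ * ‖L u‖ := by
      have := (L.symm : E →L[ℝ] E).le_opNorm (L u)
      simpa using this
    have h3 : 0 < ‖u‖ := norm_pos_iff.2 hne
    have h4 : (C : ℝ) * ‖(L.symm : E →L[ℝ] E)‖ < 1 := by
      have h : (C : ℝ) < ‖(L.symm : E →L[ℝ] E)‖⁻¹ := hC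
      rwa [← one_div, lt_div_iff₀ L.norm_symm_pos] at h
    have h5 : ‖(L.symm : E →L[ℝ] E)‖ * ‖L u‖ ≤ ‖(L.symm : E →L[ℝ] E)‖ * (C * ‖u‖) := by gcongr
    nlinarith
  exact ⟨(LinearEquiv.ofInjectiveEndo D.toLinearMap hinj).toContinuousLinearEquiv, by ext; rfl⟩

set_option maxHeartbeats 1000000 in
/-- A smooth vector field on the quadrant that points strictly inwards at a point of the face
`z i = 0` and is tangent to the other faces can be straightened by a smooth change of coordinates
that preserves the quadrant and the face. -/
theorem exists_flowBox {a : EuclideanSpace ℝ (Fin m)} (ha : a ∈ quadrant m)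
    {i : Fin m} (hai : a i = 0) {N : Set (EuclideanSpace ℝ (Fin m))} (hN : N ∈ 𝓝 a)
    {v : EuclideanSpace ℝ (Fin m) → EuclideanSpace ℝ (Fin m)}
    (hv : ContDiffOn ℝ ∞ v (quadrant m ∩ N))
    (htan : ∀ z ∈ quadrant m ∩ N, ∀ k ≠ i, z k = 0 → v z k = 0) (hpos : 0 < v a i) :
    ∃ e : OpenPartialHomeomorph (EuclideanSpace ℝ (Fin m)) (EuclideanSpace ℝ (Fin m)),
      a ∈ e.source ∧ e a = a ∧ e.target ⊆ N ∧ (∀ z ∈ e.source, e z ∈ quadrant m ↔ z ∈ quadrant m) ∧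
      (∀ z ∈ e.source, e z i = 0 ↔ z i = 0) ∧
      ContDiffOn ℝ ∞ e (e.source ∩ quadrant m) ∧ ContDiffOn ℝ ∞ e.symm (e.target ∩ quadrant m) ∧
      ∀ z ∈ e.source ∩ quadrant m,
        fderivWithin ℝ e (e.source ∩ quadrant m) z (EuclideanSpace.single i 1) = v (e z) := by
  have : Nontrivial (EuclideanSpace ℝ (Fin m)) :=
    ⟨⟨EuclideanSpace.single i 1, 0, by simp⟩⟩
  -- The expected derivative of the flow box at a: it fixes the hyperplane z i = 0 and sends the
  -- i-th basis vector to v a. Maps at distance less than c from it are invertible; κ = c / 4 leaves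
  -- room for two error terms.
  set L₀ := shearEquiv i (v a) hpos.ne' with hL₀
  set c : ℝ≥0 := ‖(L₀.symm : EuclideanSpace ℝ (Fin m) →L[ℝ] EuclideanSpace ℝ (Fin m))‖₊⁻¹ with hc
  have hcpos : 0 < c := inv_pos.2 L₀.nnnorm_symm_pos
  set κ : ℝ≥0 := c / 4 with hκ
  have hκpos : 0 < κ := by positivity
  -- In this smaller neighbourhood v has positive i-th component and is κ-close to v a. The
  -- extension w takes only values that v takes there, so both properties hold for w on the whole
  -- space.
  have hN' : {z | z ∈ N ∧ (z ∈ quadrant m → 0 < v z i ∧ ‖v z - v a‖ ≤ κ)} ∈ 𝓝 a := by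
    have hcv : ContinuousWithinAt v (quadrant m) a :=
      (hv.continuousOn a ⟨ha, mem_of_mem_nhds hN⟩).mono_of_mem_nhdsWithin
        (inter_mem self_mem_nhdsWithin (nhdsWithin_le_nhds hN))
    have h1 : ∀ᶠ z in 𝓝[quadrant m] a, 0 < v z i ∧ ‖v z - v a‖ ≤ κ := by
      refine Filter.Eventually.and ?_ ?_
      · exact (((EuclideanSpace.proj (𝕜 := ℝ) i).continuous.continuousAt.comp_continuousWithinAt
          hcv).eventually (lt_mem_nhds hpos))
      · have := hcv.eventually (Metric.closedBall_mem_nhds (v a) (NNReal.coe_pos.2 hκpos))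
        simpa [dist_eq_norm] using this
    filter_upwards [hN, eventually_nhdsWithin_iff.1 h1] with z hz1 hz2 using ⟨hz1, hz2⟩
  obtain ⟨w, r, K, L, hr, hwK, hwL, hwv, hwr, hwtan, hra, hrN⟩ :=
    exists_lipschitz_extension (i := i) ha hN' (hv.mono fun z hz => ⟨hz.1, hz.2.1⟩)
      (fun z hz => htan z ⟨hz.1, hz.2.1⟩)
  have hwi : ∀ z, 0 < w z i := fun z => by
    obtain ⟨y, hy, e⟩ := hwv z; rw [e]; exact (hy.2.2 hy.1).1
  have hwκ : ∀ z, ‖w z - v a‖ ≤ κ := fun z => by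
    obtain ⟨y, hy, e⟩ := hwv z; rw [e]; exact (hy.2.2 hy.1).2
  -- Since ‖w‖ ≤ L, a trajectory that starts in the unit ball about a stays within L + 1 of a for
  -- times in [-1, 1].
  have hPL : IsPicardLindelof (fun _ => w) (⟨0, by norm_num⟩ : Icc (-1 : ℝ) 1) a (L + 1) 1 L K :=
    ⟨fun t _ => hwK.lipschitzOnWith, fun x _ => continuousOn_const, fun t _ x _ => hwL x, by simp⟩
  obtain ⟨α, hα, L', hαL⟩ :=
    hPL.exists_forall_mem_closedBall_eq_hasDerivWithinAt_lipschitzOnWith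
  rw [NNReal.coe_one] at hα hαL
  have hα0 : ∀ x ∈ Metric.closedBall a 1, α x 0 = x := fun x hx => (hα x hx).1
  have hαd := fun x hx => (hα x hx).2
  have h0mem : (0 : ℝ) ∈ Icc (-1 : ℝ) 1 := by norm_num
  -- basic estimates
  have A1 : ∀ x ∈ Metric.closedBall a 1, ∀ s ∈ Icc (-1 : ℝ) 1, ∀ t ∈ Icc (-1 : ℝ) 1,
      ‖(α x t - t • v a) - (α x s - s • v a)‖ ≤ κ * ‖t - s‖ := fun x hx s hs t ht =>
    Convex.norm_image_sub_le_of_norm_hasDerivWithin_le (f := fun t => α x t - t • v a)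
      (f' := fun t => w (α x t) - v a)
      (fun t ht => by
        have := (hαd x hx t ht).sub ((hasDerivWithinAt_id t _).smul_const (v a))
        rw [one_smul] at this
        exact this)
      (fun t _ => hwκ _) (convex_Icc _ _) hs ht
  have A2 : ∀ x ∈ Metric.closedBall a 1, ∀ x' ∈ Metric.closedBall a 1, ∀ t ∈ Icc (-1 : ℝ) 1,
      ‖(α x t - α x' t) - (x - x')‖ ≤ K * (L' * ‖x - x'‖) * ‖t‖ := fun x hx x' hx' t ht => by
    have := Convex.norm_image_sub_le_of_norm_hasDerivWithin_le (f := fun t => α x t - α x' t)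
      (f' := fun t => w (α x t) - w (α x' t)) (C := K * (L' * ‖x - x'‖))
      (fun t ht => (hαd x hx t ht).sub (hαd x' hx' t ht))
      (fun t ht => by
        have h1 := hwK.dist_le_mul (α x t) (α x' t)
        have h2 := (hαL t ht).dist_le_mul x hx x' hx'
        rw [dist_eq_norm, dist_eq_norm] at h1 h2
        exact h1.trans (mul_le_mul_of_nonneg_left h2 K.2)) (convex_Icc _ _) h0mem ht
    simpa [hα0 x hx, hα0 x' hx'] using this
  have A3 : ∀ x ∈ Metric.closedBall a 1, ∀ t ∈ Icc (-1 : ℝ) 1, ‖α x t - x‖ ≤ L * |t| :=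
    fun x hx t ht => by
      have := Convex.norm_image_sub_le_of_norm_hasDerivWithin_le (f := α x) (hαd x hx)
        (fun t _ => hwL (α x t)) (convex_Icc _ _) h0mem ht
      simpa [hα0 x hx] using this
  have hcoord : ∀ x ∈ Metric.closedBall a 1, ∀ k, ∀ t ∈ Icc (-1 : ℝ) 1,
      HasDerivWithinAt (fun t => α x t k) (w (α x t) k) (Icc (-1) 1) t := fun x hx k t ht =>
    (EuclideanSpace.proj (𝕜 := ℝ) k).hasFDerivAt.comp_hasDerivWithinAt t (hαd x hx t ht)
  -- A coordinate k ≠ i with a k = 0 that is nonpositive at one time is constant: |w z k| ≤ K max(z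
  -- k, 0), so its difference u from that value satisfies |u'| ≤ K|u|. Hence trajectories do not
  -- cross the other faces through a.
  have hconst : ∀ x ∈ Metric.closedBall a 1, ∀ k ≠ i, a k = 0 → ∀ t₀ ∈ Icc (-1 : ℝ) 1,
      α x t₀ k ≤ 0 → ∀ t ∈ Icc (-1 : ℝ) 1, α x t k = α x t₀ k := by
    intro x hx k hk hak t₀ ht₀ hle t ht
    have := eq_zero_of_abs_deriv_le (u := fun t => α x t k - α x t₀ k)
      (u' := fun t => w (α x t) k) (K := K) (fun t ht => (hcoord x hx k t ht).sub_const _)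
      (fun t ht => by
        refine (hwtan k hk hak (α x t)).trans (mul_le_mul_of_nonneg_left ?_ K.2)
        rw [Real.norm_eq_abs]
        exact max_le ((by linarith : α x t k ≤ α x t k - α x t₀ k).trans (le_abs_self _))
          (abs_nonneg _)) ht₀ (sub_self _) t ht
    linarith
  have hmono : ∀ x ∈ Metric.closedBall a 1, StrictMonoOn (fun t => α x t i) (Icc (-1 : ℝ) 1) :=
    fun x hx => strictMonoOn_of_hasDerivWithinAt_pos (convex_Icc _ _)
      (fun t ht => (hcoord x hx i t ht).continuousWithinAt)
      (fun t ht => (hcoord x hx i t (interior_subset ht)).mono interior_subset)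
      (fun t _ => hwi _)
  -- On a trajectory from the hyperplane z i = 0 the i-th coordinate has the sign of the time. The
  -- other coordinates with a k = 0 stay nonnegative or stay negative by `hconst`, and those with a
  -- k ≠ 0 are positive because a k ≥ r.
  have hsign : ∀ x ∈ Metric.closedBall a 1, ‖x - a‖ < r → x i = 0 → ∀ t ∈ Icc (-1 : ℝ) 1,
      ‖α x t - a‖ < r → (α x t ∈ quadrant m ↔ x ∈ quadrant m ∧ 0 ≤ t) ∧ (α x t i = 0 ↔ t = 0) := by
    intro x hx hxa hxi t ht hta
    have hi : 0 ≤ α x t i ↔ 0 ≤ t := by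
      have := (hmono x hx).le_iff_le h0mem ht
      simpa [hα0 x hx, hxi] using this
    have hi0 : α x t i = 0 ↔ t = 0 := by
      have := (hmono x hx).injOn.eq_iff ht h0mem
      simpa [hα0 x hx, hxi] using this
    have hk : ∀ k ≠ i, (0 ≤ α x t k ↔ 0 ≤ x k) := by
      intro k hk
      by_cases hak : a k = 0
      · constructor
        · intro h
          by_contra hneg
          push Not at hneg
          have := hconst x hx k hk hak 0 h0mem (by rw [hα0 x hx]; exact hneg.le) t ht
          rw [hα0 x hx] at this; linarith
        · intro h
          by_contra hneg
          push Not at hneg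
          have := hconst x hx k hk hak t ht hneg.le 0 h0mem
          rw [hα0 x hx] at this; linarith
      · have h1 := (abs_lt.1 ((abs_apply_le_norm _ k).trans_lt hxa)).1
        have h2 := (abs_lt.1 ((abs_apply_le_norm _ k).trans_lt hta)).1
        simp only [PiLp.sub_apply] at h1 h2
        have h3 := hra k hak
        exact ⟨fun _ => by linarith, fun _ => by linarith⟩
    refine ⟨⟨fun h => ⟨fun k => ?_, hi.1 (h i)⟩, fun h k => ?_⟩, hi0⟩
    · by_cases hki : k = i
      · rw [hki, hxi]
      · exact (hk k hki).1 (h k)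
    · by_cases hki : k = i
      · rw [hki]; exact hi.2 h.2
      · exact (hk k hki).2 (h.1 k)
  -- the projection to the face
  set Y : EuclideanSpace ℝ (Fin m) → EuclideanSpace ℝ (Fin m) :=
    fun z => z - EuclideanSpace.single i (z i) with hY
  have hYsub : ∀ z z', Y z - Y z' = Y (z - z') := fun z z' => by
    ext k; by_cases hk : k = i <;> simp [hY, hk]
  have hYnorm : ∀ z, ‖Y z‖ ≤ 2 * ‖z‖ := fun z => by
    refine (norm_sub_le _ _).trans ?_
    have : ‖EuclideanSpace.single i (z i)‖ = |z i| := by simp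
    rw [this]; linarith [abs_apply_le_norm z i]
  have hYcont : ContDiff ℝ ∞ Y := by
    have : Y = fun z => z - z i • EuclideanSpace.single i (1 : ℝ) := by
      ext z k; simp [hY]
    rw [this]
    exact contDiff_id.sub (((EuclideanSpace.proj (𝕜 := ℝ) i).contDiff).smul contDiff_const)
  have hYa : Y a = a := by simp [hY, hai]
  have hYi : ∀ z, Y z i = 0 := fun z => by simp [hY]
  -- The three bounds keep |z i| and ‖Y z - a‖ at most 1, keep trajectories within r of a (the
  -- motion contributes at most Lρ, the starting point less than 2ρ), and make the error from
  -- varying the starting point at most κ.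
  set ρ : ℝ := min (1 / 2) (min (r / (L + 3)) (κ / (2 * K * L' + 1))) with hρ
  have hρpos : 0 < ρ := by positivity
  have hρ1 : ρ ≤ 1 / 2 := min_le_left _ _
  have hρr : ρ * (L + 3) ≤ r := by
    rw [← le_div_iff₀ (by positivity)]; exact (min_le_right _ _).trans (min_le_left _ _)
  have hρκ : ρ * (2 * K * L' + 1) ≤ κ := by
    rw [← le_div_iff₀ (by positivity)]; exact (min_le_right _ _).trans (min_le_right _ _)
  have hzi : ∀ z ∈ Metric.ball a ρ, |z i| < ρ := fun z hz => by
    rw [mem_ball_iff_norm] at hz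
    have := (abs_apply_le_norm (z - a) i).trans_lt hz
    simpa [hai] using this
  have hziI : ∀ z ∈ Metric.ball a ρ, ∀ s ∈ Icc (0 : ℝ) 1, s * z i ∈ Icc (-1 : ℝ) 1 :=
    fun z hz s hs => by
      have h := abs_lt.1 (hzi z hz)
      constructor <;> nlinarith [hs.1, hs.2, h.1, h.2]
  have hYball : ∀ z ∈ Metric.ball a ρ, ‖Y z - a‖ < 2 * ρ := fun z hz => by
    rw [mem_ball_iff_norm] at hz
    calc ‖Y z - a‖ = ‖Y (z - a)‖ := by rw [← hYsub, hYa]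
      _ ≤ 2 * ‖z - a‖ := hYnorm _
      _ < 2 * ρ := by linarith
  have hYmem : ∀ z ∈ Metric.ball a ρ, Y z ∈ Metric.closedBall a 1 := fun z hz => by
    rw [mem_closedBall_iff_norm]; linarith [hYball z hz]
  have hYr : ∀ z ∈ Metric.ball a ρ, ‖Y z - a‖ < r := fun z hz => by
    have := hYball z hz; nlinarith [L.2]
  have hαr : ∀ z ∈ Metric.ball a ρ, ∀ s ∈ Icc (0 : ℝ) 1, ‖α (Y z) (s * z i) - a‖ < r :=
    fun z hz s hs => by
      have h1 := A3 (Y z) (hYmem z hz) _ (hziI z hz s hs)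
      have h2 := hYball z hz
      have h3 : |s * z i| ≤ ρ := by
        rw [abs_mul, abs_of_nonneg hs.1]; nlinarith [hzi z hz, abs_nonneg (z i), hs.1, hs.2]
      have h4 : α (Y z) (s * z i) - a = (α (Y z) (s * z i) - Y z) + (Y z - a) := by abel
      rw [h4]
      refine (norm_add_le _ _).trans_lt ?_
      have h5 : (L : ℝ) * |s * z i| ≤ L * ρ := mul_le_mul_of_nonneg_left h3 L.2
      nlinarith
  have hzi1 : ∀ z ∈ Metric.ball a ρ, z i ∈ Icc (-1 : ℝ) 1 := fun z hz => by
    simpa using hziI z hz 1 (by norm_num)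
  -- The flow box: start at the projection to the hyperplane z i = 0 and flow for time z i, which
  -- may be negative.
  set Ξ : EuclideanSpace ℝ (Fin m) → EuclideanSpace ℝ (Fin m) := fun z => α (Y z) (z i) with hΞ
  -- The error splits into the motion in time from a fixed starting point (`A1`) and the change of
  -- starting point at a fixed time (`A2`); each contributes at most κ‖z - z'‖.
  have happ : ApproximatesLinearOn Ξ
      (L₀ : EuclideanSpace ℝ (Fin m) →L[ℝ] EuclideanSpace ℝ (Fin m)) (Metric.ball a ρ) (2 * κ) := by
    intro z hz z' hz'
    have h1 := A1 (Y z) (hYmem z hz) (z' i) (hzi1 z' hz') (z i) (hzi1 z hz)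
    have h2 := A2 (Y z) (hYmem z hz) (Y z') (hYmem z' hz') (z' i) (hzi1 z' hz')
    have e : Ξ z - Ξ z' - L₀ (z - z') =
        ((α (Y z) (z i) - z i • v a) - (α (Y z) (z' i) - z' i • v a)) +
        ((α (Y z) (z' i) - α (Y z') (z' i)) - (Y z - Y z')) := by
      rw [hL₀, shearEquiv_apply]
      have : (z - z') - EuclideanSpace.single i ((z - z') i) = Y z - Y z' := (hYsub z z').symm
      rw [this, PiLp.sub_apply, sub_smul]
      simp only [hΞ]; abel
    have e2 : ‖Y z - Y z'‖ ≤ 2 * ‖z - z'‖ := by rw [hYsub]; exact hYnorm _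
    have e3 : ‖z i - z' i‖ ≤ ‖z - z'‖ := abs_apply_le_norm (z - z') i
    change ‖Ξ z - Ξ z' - L₀ (z - z')‖ ≤ _
    rw [e]
    refine (norm_add_le _ _).trans ?_
    have e4 : ‖z' i‖ ≤ ρ := (hzi z' hz').le
    have e5 : (K : ℝ) * (L' * ‖Y z - Y z'‖) * ‖z' i‖ ≤ K * (L' * (2 * ‖z - z'‖)) * ρ := by
      gcongr
    have e6 : (κ : ℝ) * ‖z i - z' i‖ ≤ κ * ‖z - z'‖ := by gcongr
    have e7 : (K : ℝ) * (L' * (2 * ‖z - z'‖)) * ρ ≤ κ * ‖z - z'‖ := by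
      have : ρ * (2 * K * L') ≤ κ := by nlinarith
      calc _ = ρ * (2 * K * L') * ‖z - z'‖ := by ring
        _ ≤ _ := by gcongr
    push_cast
    linarith
  have hκc : 2 * κ < c := by
    rw [hκ, ← NNReal.coe_lt_coe]; push_cast
    have : (0 : ℝ) < c := hcpos
    linarith
  set e := happ.toOpenPartialHomeomorph Ξ (Metric.ball a ρ) (Or.inr hκc) Metric.isOpen_ball with he
  have hsrc : e.source = Metric.ball a ρ := rfl
  have hcoe : ∀ z, e z = Ξ z := fun z => rfl
  have hΞr : ∀ z ∈ Metric.ball a ρ, ‖Ξ z - a‖ < r := fun z hz => by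
    simpa using hαr z hz 1 (by norm_num)
  have hYQ : ∀ z, z ∈ quadrant m ↔ Y z ∈ quadrant m ∧ 0 ≤ z i := fun z => by
    constructor
    · refine fun h => ⟨fun k => ?_, h i⟩
      by_cases hk : k = i
      · rw [hk, hYi]
      · simpa [hY, hk] using h k
    · rintro ⟨h, hi⟩ k
      by_cases hk : k = i
      · rw [hk]; exact hi
      · simpa [hY, hk] using h k
  have hquad : ∀ z ∈ Metric.ball a ρ, Ξ z ∈ quadrant m ↔ z ∈ quadrant m := fun z hz => by
    rw [hYQ z]
    exact (hsign (Y z) (hYmem z hz) (hYr z hz) (hYi z) (z i) (hzi1 z hz) (hΞr z hz)).1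
  have hSu : UniqueDiffOn ℝ (Metric.ball a ρ ∩ quadrant m) := by
    rw [inter_comm]; exact (uniqueDiffOn_quadrant m).inter Metric.isOpen_ball
  -- Smoothness is claimed on the quadrant only, where w agrees with v. Time is rescaled to [0, 1]
  -- by the factor z i, which is carried along as a constant second component of the state.
  have hΞsmooth : ContDiffOn ℝ ∞ Ξ (Metric.ball a ρ ∩ quadrant m) := by
    have hαc : ContinuousOn (uncurry α) (Metric.closedBall a 1 ×ˢ Icc (-1 : ℝ) 1) :=
      continuousOn_prod_of_continuousOn_lipschitzOnWith _ L'
        (fun x hx t ht => (hαd x hx t ht).continuousWithinAt) hαL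
    have key := contDiffOn_flow (S₀ := Metric.ball a ρ ∩ quadrant m)
      (S := (quadrant m ∩ Metric.ball a r) ×ˢ (univ : Set ℝ))
      (v := fun p => (p.2 • v p.1, (0 : ℝ))) (Φ := fun z s => (α (Y z) (s * z i), z i)) hSu
      (((convex_quadrant m).inter (convex_ball a r)).prod convex_univ)
      (((uniqueDiffOn_quadrant m).inter Metric.isOpen_ball).prod uniqueDiffOn_univ)
      ((contDiff_snd.contDiffOn.smul ((hv.mono fun z hz => ⟨hz.1, (hrN hz.2).1⟩).comp
        contDiff_fst.contDiffOn fun p hp => hp.1)).prodMk contDiffOn_const)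
      (ContinuousOn.prodMk
        (hαc.comp (f := fun p : EuclideanSpace ℝ (Fin m) × ℝ => (Y p.1, p.2 * p.1 i))
          (Continuous.continuousOn ((hYcont.continuous.comp continuous_fst).prodMk
            (continuous_snd.mul ((EuclideanSpace.proj (𝕜 := ℝ) i).continuous.comp continuous_fst))))
          (fun p hp => ⟨hYmem _ hp.1.1, hziI _ hp.1.1 _ hp.2⟩))
        (((EuclideanSpace.proj (𝕜 := ℝ) i).continuous.comp continuous_fst).continuousOn))
      (fun z hz s hs => ⟨⟨((hsign (Y z) (hYmem z hz.1) (hYr z hz.1) (hYi z) _ (hziI z hz.1 s hs)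
        (hαr z hz.1 s hs)).1).2 ⟨((hYQ z).1 hz.2).1, mul_nonneg hs.1 (hz.2 i)⟩, by
          rw [mem_ball_iff_norm]; exact hαr z hz.1 s hs⟩, mem_univ _⟩)
      (fun z hz s hs => by
        have hQ := ((hsign (Y z) (hYmem z hz.1) (hYr z hz.1) (hYi z) _ (hziI z hz.1 s hs)
          (hαr z hz.1 s hs)).1).2 ⟨((hYQ z).1 hz.2).1, mul_nonneg hs.1 (hz.2 i)⟩
        refine HasDerivWithinAt.prodMk ?_ (hasDerivWithinAt_const _ _ _)
        have h1 := (hαd (Y z) (hYmem z hz.1) _ (hziI z hz.1 s hs)).scomp s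
          (((hasDerivAt_id s).mul_const (z i)).hasDerivWithinAt (s := Icc 0 1))
          (fun s hs => hziI z hz.1 s hs)
        rw [hwr _ hQ (hαr z hz.1 s hs)] at h1
        simpa [Function.comp_def] using h1)
      (by
        refine ContDiffOn.prodMk ?_ (EuclideanSpace.proj (𝕜 := ℝ) i).contDiff.contDiffOn
        refine hYcont.contDiffOn.congr fun z hz => ?_
        simp only [zero_mul]
        exact hα0 _ (hYmem z hz.1))
      (t := 1) (by norm_num)
    have := contDiff_fst.comp_contDiffOn key
    simpa [Function.comp_def] using this
  refine ⟨e, Metric.mem_ball_self hρpos, ?_, ?_, hquad, ?_, hΞsmooth, ?_, ?_⟩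
  · rw [hcoe, hΞ]; simp only [hYa, hai]; exact hα0 a (Metric.mem_closedBall_self zero_le_one)
  · intro y hy
    have h1 := e.map_target hy
    have h2 := hΞr _ h1
    rw [← hcoe, e.right_inv hy] at h2
    exact (hrN (mem_ball_iff_norm.2 h2)).1
  · intro z hz
    exact (hsign (Y z) (hYmem z hz) (hYr z hz) (hYi z) (z i) (hzi1 z hz) (hΞr z hz)).2
  -- At interior points of the quadrant the derivative differs from L₀ by at most the Lipschitz
  -- constant of Ξ - L₀; boundary points follow by continuity.
  · have hder : ∀ z ∈ Metric.ball a ρ ∩ quadrant m,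
        ‖fderivWithin ℝ Ξ (Metric.ball a ρ ∩ quadrant m) z - L₀‖ ≤ (2 * κ : ℝ≥0) := by
      have hcont : ContinuousOn (fun z => ‖fderivWithin ℝ Ξ (Metric.ball a ρ ∩ quadrant m) z - L₀‖)
          (Metric.ball a ρ ∩ quadrant m) :=
        ((hΞsmooth.continuousOn_fderivWithin hSu (by simp)).sub continuousOn_const).norm
      intro z hz
      have hcl : z ∈ closure (Metric.ball a ρ ∩ interior (quadrant m)) := by
        refine Metric.isOpen_ball.inter_closure ⟨hz.1, ?_⟩
        rw [(convex_quadrant m).closure_interior_eq_closure_of_nonempty_interior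
          (range_cornerModel m ▸ (cornerModel m).nonempty_interior)]
        exact subset_closure hz.2
      refine ContinuousWithinAt.closure_le hcl ((hcont z hz).mono
        (inter_subset_inter_right _ interior_subset)) continuousWithinAt_const fun y hy => ?_
      have hnhds : Metric.ball a ρ ∩ quadrant m ∈ 𝓝 y :=
        inter_mem (Metric.isOpen_ball.mem_nhds hy.1) (mem_interior_iff_mem_nhds.1 hy.2)
      have hd : HasFDerivAt Ξ (fderivWithin ℝ Ξ (Metric.ball a ρ ∩ quadrant m) y) y :=
        ((hΞsmooth.differentiableOn (by simp) y
          ⟨hy.1, interior_subset hy.2⟩).hasFDerivWithinAt).hasFDerivAt hnhds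
      refine HasFDerivAt.le_of_lipschitzOn (s := Metric.ball a ρ)
        (hd.sub (L₀ : EuclideanSpace ℝ (Fin m) →L[ℝ] EuclideanSpace ℝ (Fin m)).hasFDerivAt)
        (Metric.isOpen_ball.mem_nhds hy.1) ?_
      exact lipschitzOnWith_iff_restrict.2 happ.lipschitz_sub
    have hequiv : ∀ z ∈ Metric.ball a ρ ∩ quadrant m,
        ∃ A : EuclideanSpace ℝ (Fin m) ≃L[ℝ] EuclideanSpace ℝ (Fin m),
        HasFDerivWithinAt Ξ (A : EuclideanSpace ℝ (Fin m) →L[ℝ] EuclideanSpace ℝ (Fin m))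
          (Metric.ball a ρ ∩ quadrant m) z := by
      intro z hz
      have hd := (hΞsmooth.differentiableOn (by simp) z hz).hasFDerivWithinAt
      obtain ⟨A, hA⟩ := exists_equiv_of_norm_sub_le L₀ (hder z hz) hκc
      rw [← hA] at hd
      exact ⟨A, hd⟩
    have hT : UniqueDiffOn ℝ (e.target ∩ quadrant m) := by
      rw [inter_comm]; exact (uniqueDiffOn_quadrant m).inter e.open_target
    refine contDiffOn_of_inverse hSu hT hΞsmooth hequiv
      (e.continuousOn_symm.mono inter_subset_left) (fun y hy => ⟨e.map_target hy.1, ?_⟩)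
      (fun y hy => e.right_inv hy.1)
    have h1 := hquad _ (e.map_target hy.1)
    rw [← hcoe, e.right_inv hy.1] at h1
    exact h1.1 hy.2
  · intro z hz
    have hd := (hΞsmooth.differentiableOn (by simp) z hz).hasFDerivWithinAt
    change fderivWithin ℝ Ξ (Metric.ball a ρ ∩ quadrant m) z _ = _
    set D := fderivWithin ℝ Ξ (Metric.ball a ρ ∩ quadrant m) z
    have hQ : Ξ z ∈ quadrant m := (hquad z hz.1).2 hz.2
    have hzlt := abs_lt.1 (hzi z hz.1)
    obtain ⟨δ, hδ, hδb⟩ : ∃ δ > 0, ∀ s ∈ Icc (0 : ℝ) δ,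
        z + s • EuclideanSpace.single i (1 : ℝ) ∈ Metric.ball a ρ := by
      have hc : Continuous fun s : ℝ => z + s • EuclideanSpace.single i (1 : ℝ) := by fun_prop
      have : (fun s : ℝ => z + s • EuclideanSpace.single i (1 : ℝ)) ⁻¹' Metric.ball a ρ ∈ 𝓝 0 :=
        hc.continuousAt.preimage_mem_nhds (Metric.isOpen_ball.mem_nhds (by rw [zero_smul, add_zero]; exact hz.1))
      obtain ⟨δ, hδ, h⟩ := Metric.nhds_basis_closedBall.mem_iff.1 this
      exact ⟨δ, hδ, fun s hs => h (by
        rw [Metric.mem_closedBall, Real.dist_eq, sub_zero, abs_of_nonneg hs.1]; exact hs.2)⟩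
    -- The one-sided curve s ↦ z + s e_i stays in the quadrant even if z lies on the boundary. As Y
    -- is constant along it, Ξ maps it to a trajectory of w; comparing the two expressions for its
    -- velocity proves the claim.
    have hcurve : HasDerivWithinAt (fun s : ℝ => z + s • EuclideanSpace.single i (1 : ℝ))
        (EuclideanSpace.single i 1) (Icc 0 δ) 0 := by
      simpa using (((hasDerivAt_id (0 : ℝ)).smul_const
        (EuclideanSpace.single i (1 : ℝ))).const_add z).hasDerivWithinAt (s := Icc 0 δ)
    have hmaps : MapsTo (fun s : ℝ => z + s • EuclideanSpace.single i (1 : ℝ)) (Icc 0 δ)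
        (Metric.ball a ρ ∩ quadrant m) := by
      refine fun s hs => ⟨hδb s hs, fun k => ?_⟩
      have h1 := hz.2 k
      by_cases hk : k = i
      · subst hk; simp; linarith [hs.1]
      · simpa [hk] using h1
    have hd0 : HasFDerivWithinAt Ξ D (Metric.ball a ρ ∩ quadrant m)
      (z + (0 : ℝ) • EuclideanSpace.single i (1 : ℝ)) := by simpa using hd
    have d1 := hd0.comp_hasDerivWithinAt (0 : ℝ) hcurve hmaps
    have hYs : ∀ s : ℝ, Y (z + s • EuclideanSpace.single i (1 : ℝ)) = Y z := fun s => by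
      ext k; by_cases hk : k = i <;> simp [hY, hk]
    have d2 : HasDerivWithinAt (Ξ ∘ fun s : ℝ => z + s • EuclideanSpace.single i (1 : ℝ))
        (w (Ξ z)) (Icc 0 δ) 0 := by
      have h1 : HasDerivWithinAt (α (Y z)) (w (α (Y z) (z i + 0))) (Icc (-1) 1) (z i + 0) := by
        simpa using hαd (Y z) (hYmem z hz.1) (z i) (hzi1 z hz.1)
      have h2 := h1.scomp (0 : ℝ) (((hasDerivAt_id (0 : ℝ)).const_add (z i)).hasDerivWithinAt
        (s := Icc 0 δ)) (fun s hs => by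
          have := hzi1 _ (hδb s hs)
          simpa using this)
      have e1 : (Ξ ∘ fun s : ℝ => z + s • EuclideanSpace.single i (1 : ℝ)) =
          (α (Y z) ∘ fun s => z i + id s) := by
        funext s
        simp only [hΞ, Function.comp_apply, hYs]
        simp
      rw [e1]
      simpa using h2
    have huniq : UniqueDiffWithinAt ℝ (Icc 0 δ) (0 : ℝ) :=
      uniqueDiffOn_Icc hδ 0 ⟨le_rfl, hδ.le⟩
    have := huniq.eq_deriv _ d1 d2
    rw [this, hwr _ hQ (hΞr z hz.1), hcoe]

end FlowBox

/-! ### Coordinates in charts and their differentials -/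

section Coordinates

variable {m : ℕ} {X : Type*} [TopologicalSpace X]

/-- The coordinates of a point in a chart. -/
noncomputable def coord (e : OpenPartialHomeomorph X (EuclideanQuadrant m)) (x : X) :
    EuclideanSpace ℝ (Fin m) := (e x).val

/-- The point with given coordinates in a chart. -/
noncomputable def uncoord (e : OpenPartialHomeomorph X (EuclideanQuadrant m))
    (z : EuclideanSpace ℝ (Fin m)) : X := e.symm ((cornerModel m).symm z)

variable {e : OpenPartialHomeomorph X (EuclideanQuadrant m)} {x : X}

theorem coord_mem (e : OpenPartialHomeomorph X (EuclideanQuadrant m)) (x : X) :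
    coord e x ∈ quadrant m := (e x).2

theorem symm_val (z : EuclideanQuadrant m) : (cornerModel m).symm z.val = z :=
  (cornerModel m).left_inv z

theorem val_symm {z : EuclideanSpace ℝ (Fin m)} (hz : z ∈ quadrant m) :
    ((cornerModel m).symm z).val = z := by
  rw [← range_cornerModel] at hz
  exact (cornerModel m).right_inv hz

theorem uncoord_coord (hx : x ∈ e.source) : uncoord e (coord e x) = x := by
  rw [uncoord, coord, symm_val, e.left_inv hx]

theorem coord_uncoord {z : EuclideanSpace ℝ (Fin m)} (hz : z ∈ quadrant m)
    (hzt : (cornerModel m).symm z ∈ e.target) : coord e (uncoord e z) = z := by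
  rw [uncoord, coord, e.right_inv hzt, val_symm hz]

/-- The neighbourhood is one in all of ℝ^m, since `(cornerModel m).symm` is defined and continuous
off the quadrant too. -/
theorem eventually_symm_mem_target (hx : x ∈ e.source) :
    ∀ᶠ z in 𝓝 (coord e x), (cornerModel m).symm z ∈ e.target := by
  have : ContinuousAt (cornerModel m).symm (coord e x) := (cornerModel m).continuous_symm.continuousAt
  refine this.eventually (e.open_target.mem_nhds ?_)
  rw [coord, symm_val]
  exact e.map_source hx

theorem continuousAt_coord (hx : x ∈ e.source) : ContinuousAt (coord e) x :=
  continuous_subtype_val.continuousAt.comp (e.continuousAt hx)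

theorem continuousAt_uncoord (hx : x ∈ e.source) : ContinuousAt (uncoord e) (coord e x) := by
  refine ContinuousAt.comp ?_ (cornerModel m).continuous_symm.continuousAt
  rw [coord, symm_val]
  exact e.continuousAt_symm (e.map_source hx)

theorem tendsto_uncoord (hx : x ∈ e.source) : Tendsto (uncoord e) (𝓝 (coord e x)) (𝓝 x) := by
  have := continuousAt_uncoord hx
  rwa [ContinuousAt, uncoord_coord hx] at this

theorem eventually_comp_uncoord (hx : x ∈ e.source) {P : X → Prop} (h : ∀ᶠ u in 𝓝 x, P u) :
    ∀ᶠ z in 𝓝[quadrant m] (coord e x), P (uncoord e z) :=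
  nhdsWithin_le_nhds ((tendsto_uncoord hx).eventually h)

variable [ChartedSpace (EuclideanQuadrant m) X]

theorem contMDiffAt_coord (he : e ∈ IsManifold.maximalAtlas (cornerModel m) ∞ X)
    (hx : x ∈ e.source) : ContMDiffAt (cornerModel m) 𝓘(ℝ, EuclideanSpace ℝ (Fin m)) ∞ (coord e) x :=
  e.contMDiffAt_extend he hx

theorem contMDiffWithinAt_uncoord (he : e ∈ IsManifold.maximalAtlas (cornerModel m) ∞ X)
    (hx : x ∈ e.source) : ContMDiffWithinAt 𝓘(ℝ, EuclideanSpace ℝ (Fin m)) (cornerModel m) ∞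
      (uncoord e) (quadrant m) (coord e x) := by
  have h := contMDiffOn_extend_symm he (coord e x) ⟨e x, e.map_source hx, rfl⟩
  refine h.mono_of_mem_nhdsWithin ?_
  have := e.extend_target_mem_nhdsWithin (I := cornerModel m) hx
  have hset : cornerModel m '' e.target = (e.extend (cornerModel m)).target := by
    ext z
    rw [OpenPartialHomeomorph.extend_target]
    constructor
    · rintro ⟨y, hy, rfl⟩
      exact ⟨by rw [mem_preimage, (cornerModel m).left_inv]; exact hy, mem_range_self y⟩
    · rintro ⟨h1, h2⟩
      exact ⟨_, h1, (cornerModel m).right_inv h2⟩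
  rw [← range_cornerModel, hset]
  exact this

/-- The differential of the coordinates of a chart. -/
noncomputable def dcoord (e : OpenPartialHomeomorph X (EuclideanQuadrant m)) (x : X) :
    TangentSpace (cornerModel m) x →L[ℝ] EuclideanSpace ℝ (Fin m) :=
  mfderiv (cornerModel m) 𝓘(ℝ, EuclideanSpace ℝ (Fin m)) (coord e) x

theorem bijective_dcoord (he : e ∈ IsManifold.maximalAtlas (cornerModel m) ∞ X)
    (hx : x ∈ e.source) : Bijective (dcoord e x) := by
  have hd : e.MDifferentiable (cornerModel m) (cornerModel m) :=
    ⟨(contMDiffOn_of_mem_maximalAtlas he).mdifferentiableOn (by simp),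
      (contMDiffOn_symm_of_mem_maximalAtlas he).mdifferentiableOn (by simp)⟩
  have h1 : dcoord e x = (ContinuousLinearMap.id ℝ (EuclideanSpace ℝ (Fin m))) ∘L
      (mfderiv (cornerModel m) (cornerModel m) e x) :=
    ((cornerModel m).hasMFDerivAt.comp x (hd.mdifferentiableAt hx).hasMFDerivAt).mfderiv
  rw [h1]
  exact hd.mfderiv_bijective hx

variable {F : Type*} [NormedAddCommGroup F] [NormedSpace ℝ F]

/-- The derivative of a vector-valued function in coordinates. -/
theorem hasFDerivWithinAt_comp_uncoord (he : e ∈ IsManifold.maximalAtlas (cornerModel m) ∞ X)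
    (hx : x ∈ e.source) {f : X → F} (hf : MDifferentiableAt (cornerModel m) 𝓘(ℝ, F) f x) :
    ∃ D : EuclideanSpace ℝ (Fin m) →L[ℝ] F,
      HasFDerivWithinAt (f ∘ uncoord e) D (quadrant m) (coord e x) ∧
      ∀ v, mfderiv (cornerModel m) 𝓘(ℝ, F) f x v = D (dcoord e x v) := by
  have h1 : MDifferentiableWithinAt 𝓘(ℝ, EuclideanSpace ℝ (Fin m)) (cornerModel m) (uncoord e)
      (quadrant m) (coord e x) := (contMDiffWithinAt_uncoord he hx).mdifferentiableWithinAt (by simp)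
  have hf' : MDifferentiableAt (cornerModel m) 𝓘(ℝ, F) f (uncoord e (coord e x)) := by
    rwa [uncoord_coord hx]
  have h2 : MDifferentiableWithinAt 𝓘(ℝ, EuclideanSpace ℝ (Fin m)) 𝓘(ℝ, F) (f ∘ uncoord e)
      (quadrant m) (coord e x) := hf'.comp_mdifferentiableWithinAt _ h1
  have h3 := h2.hasMFDerivWithinAt
  refine ⟨mfderivWithin 𝓘(ℝ, EuclideanSpace ℝ (Fin m)) 𝓘(ℝ, F) (f ∘ uncoord e) (quadrant m)
    (coord e x), h3.hasFDerivWithinAt, fun v => ?_⟩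
  have h4 : HasMFDerivAt (cornerModel m) 𝓘(ℝ, EuclideanSpace ℝ (Fin m)) (coord e) x (dcoord e x) :=
    ((contMDiffAt_coord he hx).mdifferentiableAt (by simp)).hasMFDerivAt
  have h5 := HasMFDerivWithinAt.comp x h3 (h4.hasMFDerivWithinAt (s := univ))
    (fun y _ => coord_mem e y)
  rw [hasMFDerivWithinAt_univ] at h5
  have h6 : f =ᶠ[𝓝 x] (f ∘ uncoord e) ∘ coord e := by
    filter_upwards [e.open_source.mem_nhds hx] with y hy
    simp [uncoord_coord hy]
  rw [(h5.congr_of_eventuallyEq h6).mfderiv]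
  rfl

end Coordinates

/-! ### Vectors tangent to the faces, and invariance of the codimension -/

section FaceTangent

variable {m : ℕ} {X : Type*} [TopologicalSpace X] [ChartedSpace (EuclideanQuadrant m) X]

/-- A vector is tangent to all boundary faces through its base point. -/
def IsFaceTangent (m : ℕ) {X : Type*} [TopologicalSpace X] [ChartedSpace (EuclideanQuadrant m) X]
    {x : X} (v : TangentSpace (cornerModel m) x) : Prop :=
  ∀ ρ : X → ℝ, ContMDiffAt (cornerModel m) 𝓘(ℝ, ℝ) ∞ ρ x → (∀ᶠ u in 𝓝 x, 0 ≤ ρ u) → ρ x = 0 →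
    mfderiv (cornerModel m) 𝓘(ℝ, ℝ) ρ x v = 0

theorem eventually_add_smul_mem_quadrant {z w : EuclideanSpace ℝ (Fin m)} (hz : z ∈ quadrant m)
    (hw : ∀ i, z i = 0 → 0 ≤ w i) : ∀ᶠ t in 𝓝[≥] (0 : ℝ), z + t • w ∈ quadrant m := by
  have : ∀ i, ∀ᶠ t in 𝓝[≥] (0 : ℝ), 0 ≤ z i + t * w i := by
    intro i
    by_cases hi : z i = 0
    · filter_upwards [self_mem_nhdsWithin] with t ht
      rw [hi, zero_add]; exact mul_nonneg ht (hw i hi)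
    · have hpos : 0 < z i := lt_of_le_of_ne (hz i) (Ne.symm hi)
      have hc : ContinuousAt (fun t : ℝ => z i + t * w i) 0 := by fun_prop
      have := hc.eventually (lt_mem_nhds (by simpa using hpos : (0 : ℝ) < z i + 0 * w i))
      filter_upwards [nhdsWithin_le_nhds this] with t ht using le_of_lt ht
  filter_upwards [eventually_all.2 this] with t ht i
  simpa using ht i

/-- One-sided directional derivatives of a function on the quadrant. -/
theorem hasDerivWithinAt_line {F : Type*} [NormedAddCommGroup F] [NormedSpace ℝ F]
    {f : EuclideanSpace ℝ (Fin m) → F} {D : EuclideanSpace ℝ (Fin m) →L[ℝ] F}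
    {z w : EuclideanSpace ℝ (Fin m)} (hz : z ∈ quadrant m)
    (hf : HasFDerivWithinAt f D (quadrant m) z) (hw : ∀ i, z i = 0 → 0 ≤ w i) :
    HasDerivWithinAt (fun t : ℝ => f (z + t • w)) (D w) (Ici 0) 0 := by
  have h1 : HasDerivWithinAt (fun t : ℝ => z + t • w) w
      (Ici 0 ∩ {t : ℝ | z + t • w ∈ quadrant m}) 0 := by
    simpa using (((hasDerivAt_id (0 : ℝ)).smul_const w).const_add z).hasDerivWithinAt
  have h2 : HasFDerivWithinAt f D (quadrant m) (z + (0 : ℝ) • w) := by simpa using hf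
  have h3 := h2.comp_hasDerivWithinAt (0 : ℝ) h1 (fun t ht => ht.2)
  refine h3.mono_of_mem_nhdsWithin ?_
  exact inter_mem self_mem_nhdsWithin (eventually_add_smul_mem_quadrant hz hw)

/-- The difference quotients along the ray in direction w, which starts inside the quadrant, are
nonnegative. -/
theorem deriv_nonneg_of_nonneg {f : EuclideanSpace ℝ (Fin m) → ℝ}
    {D : EuclideanSpace ℝ (Fin m) →L[ℝ] ℝ} {z w : EuclideanSpace ℝ (Fin m)} (hz : z ∈ quadrant m)
    (hf : HasFDerivWithinAt f D (quadrant m) z) (hw : ∀ i, z i = 0 → 0 ≤ w i)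
    (hpos : ∀ᶠ y in 𝓝[quadrant m] z, 0 ≤ f y) (h0 : f z = 0) : 0 ≤ D w := by
  have h1 := hasDerivWithinAt_line hz hf hw
  have h2 := h1.Ioi_of_Ici
  rw [hasDerivWithinAt_iff_tendsto_slope' (by simp)] at h2
  refine ge_of_tendsto h2 ?_
  have ht : Tendsto (fun t : ℝ => z + t • w) (𝓝[≥] 0) (𝓝[quadrant m] z) := by
    refine tendsto_nhdsWithin_iff.2 ⟨?_, eventually_add_smul_mem_quadrant hz hw⟩
    have hc : Continuous fun t : ℝ => z + t • w := by fun_prop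
    exact (hc.tendsto' 0 z (by simp)).mono_left nhdsWithin_le_nhds
  filter_upwards [(ht.mono_left (nhdsWithin_mono _ Ioi_subset_Ici_self)).eventually hpos,
    self_mem_nhdsWithin] with t ht htpos
  simp only [slope, zero_smul, add_zero, h0, sub_zero, vsub_eq_sub, smul_eq_mul]
  exact mul_nonneg (inv_nonneg.2 (le_of_lt htpos)) ht

/-- Both w and -w are admissible directions in the one-sided estimate. -/
theorem deriv_eq_zero_of_nonneg {f : EuclideanSpace ℝ (Fin m) → ℝ}
    {D : EuclideanSpace ℝ (Fin m) →L[ℝ] ℝ} {z w : EuclideanSpace ℝ (Fin m)} (hz : z ∈ quadrant m)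
    (hf : HasFDerivWithinAt f D (quadrant m) z) (hw : ∀ i, z i = 0 → w i = 0)
    (hpos : ∀ᶠ y in 𝓝[quadrant m] z, 0 ≤ f y) (h0 : f z = 0) : D w = 0 := by
  have h1 := deriv_nonneg_of_nonneg hz hf (fun i hi => (hw i hi).ge) hpos h0
  have h2 := deriv_nonneg_of_nonneg (w := -w) hz hf (fun i hi => by simp [hw i hi]) hpos h0
  rw [map_neg] at h2
  linarith

variable {e : OpenPartialHomeomorph X (EuclideanQuadrant m)} {x : X}

theorem mfderiv_coord_apply (he : e ∈ IsManifold.maximalAtlas (cornerModel m) ∞ X)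
    (hx : x ∈ e.source) (i : Fin m) (v : TangentSpace (cornerModel m) x) :
    mfderiv (cornerModel m) 𝓘(ℝ, ℝ) (fun y => coord e y i) x v = dcoord e x v i := by
  have h4 : HasMFDerivAt (cornerModel m) 𝓘(ℝ, EuclideanSpace ℝ (Fin m)) (coord e) x (dcoord e x) :=
    ((contMDiffAt_coord he hx).mdifferentiableAt (by simp)).hasMFDerivAt
  have := ((EuclideanSpace.proj (𝕜 := ℝ) i).hasMFDerivAt (x := coord e x)).comp x h4
  rw [show (fun y => coord e y i) = (EuclideanSpace.proj (𝕜 := ℝ) i) ∘ coord e from rfl, this.mfderiv]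
  rfl

theorem contMDiffAt_coord_apply (he : e ∈ IsManifold.maximalAtlas (cornerModel m) ∞ X)
    (hx : x ∈ e.source) (i : Fin m) :
    ContMDiffAt (cornerModel m) 𝓘(ℝ, ℝ) ∞ (fun y => coord e y i) x :=
  (EuclideanSpace.proj (𝕜 := ℝ) i).contMDiff.contMDiffAt.comp x (contMDiffAt_coord he hx)

variable {Y : Type*} [TopologicalSpace Y] [ChartedSpace (EuclideanQuadrant m) Y]

/-- Tangency is defined by test functions in order to be natural: nonnegative functions vanishing at
the image point pull back to functions of the same kind. -/
theorem IsFaceTangent.map {f : X → Y} (hf : ContMDiffAt (cornerModel m) (cornerModel m) ∞ f x)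
    {v : TangentSpace (cornerModel m) x} (hv : IsFaceTangent m v) :
    IsFaceTangent m (mfderiv (cornerModel m) (cornerModel m) f x v) := by
  intro ρ hρ hpos h0
  have h1 : mfderiv (cornerModel m) 𝓘(ℝ, ℝ) (ρ ∘ f) x v =
      mfderiv (cornerModel m) 𝓘(ℝ, ℝ) ρ (f x) (mfderiv (cornerModel m) (cornerModel m) f x v) := by
    rw [mfderiv_comp x (hρ.mdifferentiableAt (by simp)) (hf.mdifferentiableAt (by simp))]
    rfl
  rw [← h1]
  exact hv (ρ ∘ f) (hρ.comp x hf) (hf.continuousAt.eventually hpos) h0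


/-- The coordinates that vanish at x are themselves test functions, and they suffice because a
nonnegative function has zero derivative in every direction along all faces through one of its
zeros. -/
theorem isFaceTangent_iff (he : e ∈ IsManifold.maximalAtlas (cornerModel m) ∞ X)
    (hx : x ∈ e.source) (v : TangentSpace (cornerModel m) x) :
    IsFaceTangent m v ↔ ∀ i, coord e x i = 0 → dcoord e x v i = 0 := by
  constructor
  · intro h i hi
    rw [← mfderiv_coord_apply he hx]
    exact h _ (contMDiffAt_coord_apply he hx i) (Eventually.of_forall fun y => coord_mem e y i) hi
  · intro h ρ hρ hpos h0
    obtain ⟨D, hD, hDv⟩ := hasFDerivWithinAt_comp_uncoord he hx (hρ.mdifferentiableAt (by simp))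
    rw [hDv]
    refine deriv_eq_zero_of_nonneg (coord_mem e x) hD h (eventually_comp_uncoord hx hpos) ?_
    simp [uncoord_coord hx, h0]

/-- The number of vanishing coordinates. -/
noncomputable def codim (z : EuclideanSpace ℝ (Fin m)) : ℕ := {i : Fin m | z i = 0}.ncard

/-- The vectors tangent to all faces of the quadrant through a point. -/
def faceSpace (z : EuclideanSpace ℝ (Fin m)) : Submodule ℝ (EuclideanSpace ℝ (Fin m)) where
  carrier := {w | ∀ i, z i = 0 → w i = 0}
  add_mem' {a b} ha hb i hi := by simp [ha i hi, hb i hi]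
  zero_mem' i _ := rfl
  smul_mem' c a ha i hi := by simp [ha i hi]

/-- This makes the codimension intrinsic: it is determined by the dimension of the space of
face-tangent vectors. -/
theorem finrank_faceSpace (z : EuclideanSpace ℝ (Fin m)) :
    codim z + Module.finrank ℝ (faceSpace z) = m := by
  classical
  let φ : faceSpace z ≃ₗ[ℝ] ({i : Fin m // z i ≠ 0} → ℝ) :=
    { toFun := fun w i => w.1 i.1
      map_add' := fun _ _ => rfl
      map_smul' := fun _ _ => rfl
      invFun := fun g => ⟨WithLp.toLp 2 fun i => if h : z i ≠ 0 then g ⟨i, h⟩ else 0,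
        fun i hi => by simp [hi]⟩
      left_inv := fun w => by
        ext i
        by_cases h : z i = 0
        · simp [h, w.2 i h]
        · simp [h]
      right_inv := fun g => by
        ext ⟨i, hi⟩
        simp [hi] }
  rw [φ.finrank_eq, Module.finrank_fintype_fun_eq_card, codim, Set.ncard_eq_toFinset_card',
    Fintype.card_subtype, Set.toFinset_ofPred]
  simpa using Finset.card_filter_add_card_filter_not (s := (Finset.univ : Finset (Fin m)))
    (fun i => z i = 0)

/-- A smooth map with a smooth left inverse does not increase the codimension. -/
theorem codim_le_of_leftInverse {f : X → Y} {g : Y → X}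
    [IsManifold (cornerModel m) ∞ Y]
    (hf : ContMDiffAt (cornerModel m) (cornerModel m) ∞ f x)
    (hg : ContMDiffAt (cornerModel m) (cornerModel m) ∞ g (f x)) (hgf : ∀ᶠ u in 𝓝 x, g (f u) = u)
    (he : e ∈ IsManifold.maximalAtlas (cornerModel m) ∞ X) (hx : x ∈ e.source)
    {e' : OpenPartialHomeomorph Y (EuclideanQuadrant m)}
    (he' : e' ∈ IsManifold.maximalAtlas (cornerModel m) ∞ Y) (hx' : f x ∈ e'.source) :
    codim (coord e' (f x)) ≤ codim (coord e x) := by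
  set A : TangentSpace (cornerModel m) x ≃ₗ[ℝ] EuclideanSpace ℝ (Fin m) :=
    LinearEquiv.ofBijective (dcoord e x).toLinearMap (bijective_dcoord he hx) with hA
  set T := mfderiv (cornerModel m) (cornerModel m) f x with hT
  have hTinj : Injective T := by
    have h1 : mfderiv (cornerModel m) (cornerModel m) (g ∘ f) x =
        (mfderiv (cornerModel m) (cornerModel m) g (f x)) ∘L T :=
      mfderiv_comp x (hg.mdifferentiableAt (by simp)) (hf.mdifferentiableAt (by simp))
    have h2 : HasMFDerivAt (cornerModel m) (cornerModel m) (g ∘ f) x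
        (ContinuousLinearMap.id ℝ (TangentSpace (cornerModel m) x)) :=
      (hasMFDerivAt_id x).congr_of_eventuallyEq hgf
    intro u v huv
    have h3 : ∀ w, mfderiv (cornerModel m) (cornerModel m) (g ∘ f) x w = w := fun w => by
      rw [h2.mfderiv]; rfl
    rw [← h3 u, ← h3 v, h1]
    change mfderiv (cornerModel m) (cornerModel m) g (f x) (T u) =
      mfderiv (cornerModel m) (cornerModel m) g (f x) (T v)
    rw [huv]
  -- The injective differential maps face-tangent vectors to face-tangent vectors, which compares
  -- the dimensions m - codim.
  let φ : faceSpace (coord e x) →ₗ[ℝ] faceSpace (coord e' (f x)) :=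
    LinearMap.restrict ((dcoord e' (f x)).toLinearMap ∘ₗ T.toLinearMap ∘ₗ A.symm.toLinearMap)
      (p := faceSpace (coord e x)) (q := faceSpace (coord e' (f x))) (fun w hw => by
        have h1 : IsFaceTangent m (A.symm w) := by
          rw [isFaceTangent_iff he hx]
          intro i hi
          have : dcoord e x (A.symm w) = w := A.apply_symm_apply w
          rw [this]; exact hw i hi
        exact (isFaceTangent_iff he' hx' _).1 (h1.map hf))
  have hφ : Injective φ := by
    intro u v huv
    have h1 : dcoord e' (f x) (T (A.symm u.1)) = dcoord e' (f x) (T (A.symm v.1)) :=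
      congrArg Subtype.val huv
    exact Subtype.ext (A.symm.injective (hTinj ((bijective_dcoord he' hx').1 h1)))
  have h1 := LinearMap.finrank_le_finrank_of_injective hφ
  have h2 := finrank_faceSpace (coord e x)
  have h3 := finrank_faceSpace (coord e' (f x))
  omega

variable [IsManifold (cornerModel m) ∞ X]

/-- Smooth maps with a smooth local inverse preserve the codimension. -/
theorem codim_eq_of_inverse {f : X → Y} {g : Y → X}
    [IsManifold (cornerModel m) ∞ Y]
    (hf : ContMDiffAt (cornerModel m) (cornerModel m) ∞ f x)
    (hg : ContMDiffAt (cornerModel m) (cornerModel m) ∞ g (f x)) (hgf : ∀ᶠ u in 𝓝 x, g (f u) = u)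
    (hfg : ∀ᶠ u in 𝓝 (f x), f (g u) = u)
    (he : e ∈ IsManifold.maximalAtlas (cornerModel m) ∞ X) (hx : x ∈ e.source)
    {e' : OpenPartialHomeomorph Y (EuclideanQuadrant m)}
    (he' : e' ∈ IsManifold.maximalAtlas (cornerModel m) ∞ Y) (hx' : f x ∈ e'.source) :
    codim (coord e' (f x)) = codim (coord e x) := by
  refine le_antisymm (codim_le_of_leftInverse hf hg hgf he hx he' hx') ?_
  have hgfx : g (f x) = x := hgf.self_of_nhds
  have := codim_le_of_leftInverse (f := g) (g := f) (x := f x) hg (by rwa [hgfx]) hfg he' hx' he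
    (by rwa [hgfx])
  rwa [hgfx] at this

/-- The codimension does not depend on the chart. -/
theorem codim_eq_of_charts (he : e ∈ IsManifold.maximalAtlas (cornerModel m) ∞ X) (hx : x ∈ e.source)
    {e' : OpenPartialHomeomorph X (EuclideanQuadrant m)}
    (he' : e' ∈ IsManifold.maximalAtlas (cornerModel m) ∞ X) (hx' : x ∈ e'.source) :
    codim (coord e' x) = codim (coord e x) :=
  codim_eq_of_inverse (f := id) (g := id) contMDiffAt_id contMDiffAt_id (Eventually.of_forall
    fun _ => rfl) (Eventually.of_forall fun _ => rfl) he hx he' hx'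

theorem mem_codimOnePart_iff (he : e ∈ IsManifold.maximalAtlas (cornerModel m) ∞ X)
    (hx : x ∈ e.source) : x ∈ codimOnePart m X ↔ codim (coord e x) = 1 := by
  rw [← codim_eq_of_charts he hx (IsManifold.chart_mem_maximalAtlas x) (mem_chart_source _ x)]
  rfl

end FaceTangent

theorem eventually_coord_pos {m : ℕ} {X : Type*} [TopologicalSpace X]
    {e : OpenPartialHomeomorph X (EuclideanQuadrant m)} {p : X}
    (hp : p ∈ e.source) {i : Fin m} (hi : coord e p i ≠ 0) :
    ∀ᶠ u in 𝓝 p, 0 < coord e u i := by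
  have hc : ContinuousAt (fun u => coord e u i) p :=
    (EuclideanSpace.proj (𝕜 := ℝ) i).continuous.continuousAt.comp (continuousAt_coord hp)
  exact hc.eventually (lt_mem_nhds (lt_of_le_of_ne (coord_mem e p i) (Ne.symm hi)))

/-- A connected set stays connected when a limit point is added, so components are relatively
closed. -/
theorem mem_connectedComponentIn_of_mem_closure {X : Type*} [TopologicalSpace X] {A : Set X} {x u : X} (hx : x ∈ A) (hu : u ∈ A)
    (h : u ∈ closure (connectedComponentIn A x)) : u ∈ connectedComponentIn A x := by
  have h1 : IsPreconnected (insert u (connectedComponentIn A x)) :=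
    isPreconnected_connectedComponentIn.subset_closure (subset_insert _ _)
      (insert_subset h subset_closure)
  exact h1.subset_connectedComponentIn (mem_insert_of_mem _ (mem_connectedComponentIn hx))
    (insert_subset hu (connectedComponentIn_subset _ _)) (mem_insert _ _)

/-! ### Face sets, embedded hypersurfaces and boundary partitions -/

section FaceSets

variable {m : ℕ} {X : Type*} [TopologicalSpace X] [ChartedSpace (EuclideanQuadrant m) X]

/-- A closed set that is locally the zero set of one of the coordinates of a chart. -/
structure IsFaceSet (m : ℕ) {X : Type*} [TopologicalSpace X] [ChartedSpace (EuclideanQuadrant m) X]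
    (F : Set X) : Prop where
  isClosed : IsClosed F
  exists_chart : ∀ p ∈ F, ∃ e ∈ IsManifold.maximalAtlas (cornerModel m) ∞ X, p ∈ e.source ∧
    ∃ i, coord e p i = 0 ∧ ∀ᶠ u in 𝓝 p, (u ∈ F ↔ coord e u i = 0)

/-- Sets that locally are face sets are embedded hypersurfaces. -/
theorem isEmbeddedHypersurface_of_locally {H : Set X}
    (hH : ∀ p ∈ H, ∃ F, IsFaceSet m F ∧ p ∈ F ∧ ∀ᶠ u in 𝓝 p, (u ∈ H ↔ u ∈ F)) :
    IsEmbeddedHypersurface m X H := by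
  intro p hp
  obtain ⟨F, hF, hpF, hFH⟩ := hH p hp
  obtain ⟨e, he, hpe, i, hi, hFi⟩ := hF.exists_chart p hpF
  obtain ⟨W, hWp, hW, hpW⟩ := mem_nhds_iff.1 (hFi.and hFH)
  refine ⟨W ∩ e.source, hW.inter e.open_source, ⟨hpW, hpe⟩, fun u => coord e u i, ?_, ?_, ?_, ?_⟩
  · exact fun u hu => (contMDiffAt_coord_apply he hu.2 i).contMDiffWithinAt
  · exact fun u hu huH => (hWp hu.1).1.1 ((hWp hu.1).2.1 huH)
  · exact fun u hu huH => lt_of_le_of_ne (coord_mem e u i)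
      fun h => huH ((hWp hu.1).2.2 ((hWp hu.1).1.2 h.symm))
  · obtain ⟨v, hv⟩ := (bijective_dcoord he hpe).2 (EuclideanSpace.single i 1)
    intro h
    have h1 := mfderiv_coord_apply he hpe i v
    rw [h, hv] at h1
    simp only [PiLp.single_apply, if_true] at h1
    exact zero_ne_one (α := ℝ) h1

section

variable [IsManifold (cornerModel m) ∞ X]
  {e : OpenPartialHomeomorph X (EuclideanQuadrant m)} {p : X}

/-- Near a point, the part of codimension one is the union of the open faces `S i`, one for each
coordinate that vanishes at the point. -/
theorem exists_localFaces (he : e ∈ IsManifold.maximalAtlas (cornerModel m) ∞ X)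
    (hp : p ∈ e.source) {W : Set X} (hW : W ∈ 𝓝 p) :
    ∃ U : Set X, IsOpen U ∧ p ∈ U ∧ U ⊆ e.source ∩ W ∧ ∃ S : Fin m → Set X,
      (∀ i, IsPreconnected (S i) ∧ S i ⊆ codimOnePart m X ∧ (∀ u ∈ S i, u ∈ U ∧ coord e u i = 0) ∧
        ∀ u ∈ U, coord e u i = 0 → u ∈ closure (S i)) ∧
      (∀ u ∈ U, u ∈ codimOnePart m X → ∀ i, coord e u i = 0 → u ∈ S i) ∧
      ∀ u ∈ U, ∀ i, coord e u i = 0 → coord e p i = 0 := by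
  have h1 : ∀ᶠ z in 𝓝 (coord e p), ∀ k, coord e p k ≠ 0 → z k ≠ 0 := by
    refine eventually_all.2 fun k => ?_
    by_cases hk : coord e p k = 0
    · simp [hk]
    · have hc : ContinuousAt (fun z : EuclideanSpace ℝ (Fin m) => z k) (coord e p) := by fun_prop
      filter_upwards [hc.eventually_ne hk] with z hz _ using hz
  obtain ⟨δ, hδ, hball⟩ := Metric.eventually_nhds_iff_ball.1
    (((eventually_symm_mem_target hp).and h1).and ((tendsto_uncoord hp).eventually hW))
  have hcont : ∀ z ∈ Metric.ball (coord e p) δ, ContinuousAt (uncoord e) z := fun z hz =>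
    ContinuousAt.comp (e.continuousAt_symm (hball z hz).1.1)
      (cornerModel m).continuous_symm.continuousAt
  -- The open i-th face inside a ball is convex, so its image in X is connected.
  set A : Fin m → Set (EuclideanSpace ℝ (Fin m)) := fun i =>
    {z | z ∈ Metric.ball (coord e p) δ ∧ z ∈ quadrant m ∧ z i = 0 ∧ ∀ k, k ≠ i → 0 < z k} with hA
  have hsrc : ∀ z ∈ Metric.ball (coord e p) δ, uncoord e z ∈ e.source := fun z hz =>
    e.map_target (hball z hz).1.1
  have hco : ∀ z ∈ Metric.ball (coord e p) δ, z ∈ quadrant m → coord e (uncoord e z) = z :=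
    fun z hz hq => coord_uncoord hq (hball z hz).1.1
  refine ⟨e.source ∩ coord e ⁻¹' Metric.ball (coord e p) δ, ?_, ⟨hp, Metric.mem_ball_self hδ⟩,
    fun u hu => ⟨hu.1, by
      have := (hball _ hu.2).2
      rw [uncoord_coord hu.1] at this
      exact this⟩, fun i => uncoord e '' A i, fun i => ⟨?_, ?_, ?_, ?_⟩, ?_, ?_⟩
  · have : ContinuousOn (coord e) e.source := fun x hx => (continuousAt_coord hx).continuousWithinAt
    exact this.isOpen_inter_preimage e.open_source Metric.isOpen_ball
  · have hconv : Convex ℝ (A i) := by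
      have h2 : Convex ℝ {z : EuclideanSpace ℝ (Fin m) | z i = 0 ∧ ∀ k, k ≠ i → 0 < z k} := by
        intro x hx y hy a b ha hb hab
        refine ⟨by simp [hx.1, hy.1], fun k hk => ?_⟩
        have hxk := hx.2 k hk
        have hyk := hy.2 k hk
        simp only [PiLp.add_apply, PiLp.smul_apply, smul_eq_mul]
        rcases ha.eq_or_lt with h | h
        · have : b = 1 := by linarith
          rw [← h, this]; simpa using hyk
        · have := mul_pos h hxk
          have := mul_nonneg hb hyk.le
          linarith
      have h3 := ((convex_ball (coord e p) δ).inter (convex_quadrant m)).inter h2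
      exact fun x hx y hy a b ha hb hab =>
        have h := h3 (x := x) ⟨⟨hx.1, hx.2.1⟩, hx.2.2⟩ (y := y) ⟨⟨hy.1, hy.2.1⟩, hy.2.2⟩ ha hb hab
        ⟨h.1.1, h.1.2, h.2⟩
    exact hconv.isPreconnected.image _ fun z hz => (hcont z hz.1).continuousWithinAt
  · rintro _ ⟨z, ⟨hz, hq, hi, hk⟩, rfl⟩
    rw [mem_codimOnePart_iff he (hsrc z hz), hco z hz hq, codim, Set.ncard_eq_one]
    refine ⟨i, ?_⟩
    ext k
    simp only [mem_ofPred_eq, mem_singleton_iff]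
    refine ⟨fun h => ?_, fun h => h ▸ hi⟩
    by_contra hne
    exact (hk k hne).ne' h
  · rintro _ ⟨z, ⟨hz, hq, hi, hk⟩, rfl⟩
    refine ⟨⟨hsrc z hz, ?_⟩, ?_⟩
    · rw [mem_preimage, hco z hz hq]; exact hz
    · rw [hco z hz hq]; exact hi
  · rintro u ⟨hu, hub⟩ hi
    rw [mem_preimage] at hub
    -- Moving a point of the i-th face in this direction keeps the i-th coordinate zero and makes
    -- all others positive, so the point is a limit of the open face.
    set w : EuclideanSpace ℝ (Fin m) := WithLp.toLp 2 fun k => if k = i then 0 else 1 with hw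
    have hwi : w i = 0 := by simp [hw]
    have hwk : ∀ k, k ≠ i → w k = 1 := fun k hk => by simp [hw, hk]
    have hw0 : ∀ k, 0 ≤ w k := fun k => by
      by_cases hk : k = i
      · rw [hk, hwi]
      · rw [hwk k hk]; exact zero_le_one
    have ht : Tendsto (fun t : ℝ => coord e u + t • w) (𝓝[>] 0) (𝓝 (coord e u)) := by
      have hc : Continuous fun t : ℝ => coord e u + t • w := by fun_prop
      exact (hc.tendsto' 0 _ (by simp)).mono_left nhdsWithin_le_nhds
    refine mem_closure_of_tendsto ((tendsto_uncoord hu).comp ht) ?_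
    filter_upwards [ht.eventually (Metric.isOpen_ball.mem_nhds hub), self_mem_nhdsWithin]
      with t ht1 ht2
    have ht3 : (0 : ℝ) < t := ht2
    have hq : ∀ k, 0 ≤ coord e u k := coord_mem e u
    refine mem_image_of_mem _ ⟨ht1, fun k => ?_, by simp [hi, hwi], fun k hk => ?_⟩
    · simpa using add_nonneg (hq k) (mul_nonneg ht3.le (hw0 k))
    · simpa [hwk k hk] using add_pos_of_nonneg_of_pos (hq k) ht3
  · rintro u ⟨hu, hub⟩ hu1 i hi
    rw [mem_codimOnePart_iff he hu, codim, Set.ncard_eq_one] at hu1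
    obtain ⟨j, hj⟩ := hu1
    have hji : i = j := by
      have : i ∈ {i | coord e u i = 0} := hi
      rwa [hj] at this
    refine ⟨coord e u, ⟨hub, coord_mem e u, hi, fun k hk => ?_⟩, uncoord_coord hu⟩
    refine lt_of_le_of_ne (coord_mem e u k) fun h => hk ?_
    have : k ∈ {i | coord e u i = 0} := h.symm
    rw [hj] at this
    rw [hji]; exact this
  · rintro u ⟨hu, hub⟩ i hi
    by_contra h
    exact (hball _ hub).1.2 i h hi

theorem codimOnePart_unique (he : e ∈ IsManifold.maximalAtlas (cornerModel m) ∞ X)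
    (hp : p ∈ e.source) (hp1 : p ∈ codimOnePart m X) {i j : Fin m} (hi : coord e p i = 0)
    (hj : coord e p j = 0) : i = j := by
  rw [mem_codimOnePart_iff he hp, codim, Set.ncard_eq_one] at hp1
  obtain ⟨k, hk⟩ := hp1
  have h1 : i ∈ {i | coord e p i = 0} := hi
  have h2 : j ∈ {i | coord e p i = 0} := hj
  rw [hk] at h1 h2
  exact h1.trans h2.symm

theorem exists_coord_eq_zero_of_mem_codimOnePart
    (he : e ∈ IsManifold.maximalAtlas (cornerModel m) ∞ X)
    (hp : p ∈ e.source) (hp1 : p ∈ codimOnePart m X) : ∃ i, coord e p i = 0 := by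
  rw [mem_codimOnePart_iff he hp, codim, Set.ncard_eq_one] at hp1
  obtain ⟨k, hk⟩ := hp1
  have : k ∈ {i | coord e p i = 0} := by rw [hk]; rfl
  exact ⟨k, this⟩

/-- The local structure of a face set. -/
theorem IsFaceSet.exists_local {F : Set X} (hF : IsFaceSet m F) (hp : p ∈ F) :
    ∃ U : Set X, IsOpen U ∧ p ∈ U ∧ ∃ S : Set X, IsPreconnected S ∧ S ⊆ codimOnePart m X ∩ F ∩ U ∧
      (∀ u ∈ U, u ∈ F → u ∈ codimOnePart m X → u ∈ S) ∧ ∀ u ∈ U, u ∈ F → u ∈ closure S := by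
  obtain ⟨e, he, hpe, i, hi, hF⟩ := hF.exists_chart p hp
  obtain ⟨W, hWp, hW, hpW⟩ := mem_nhds_iff.1 hF
  obtain ⟨U, hU, hpU, hUW, S, hS, hS', -⟩ := exists_localFaces he hpe (hW.mem_nhds hpW)
  refine ⟨U, hU, hpU, S i, (hS i).1, fun u hu => ⟨⟨(hS i).2.1 hu, ?_⟩, ((hS i).2.2.1 u hu).1⟩, ?_, ?_⟩
  · have h := (hS i).2.2.1 u hu
    exact (hWp (hUW h.1).2).2 h.2
  · exact fun u hu huF hu1 => hS' u hu hu1 i ((hWp (hUW hu).2).1 huF)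
  · exact fun u hu huF => (hS i).2.2.2 u hu ((hWp (hUW hu).2).1 huF)

theorem IsFaceSet.subset_closure {F : Set X} (hF : IsFaceSet m F) :
    F ⊆ closure (F ∩ codimOnePart m X) := fun p hp => by
  obtain ⟨U, -, hpU, S, -, hS, -, hcl⟩ := hF.exists_local hp
  exact closure_mono (fun u hu => ⟨(hS hu).1.2, (hS hu).1.1⟩ : S ⊆ F ∩ codimOnePart m X) (hcl p hpU hp)

/-- At a point of codimension one only the coordinate that cuts out F vanishes, and no other one
vanishes nearby. So F is relatively open as well as closed in the part of codimension one. -/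
theorem IsFaceSet.eventually_mem {F : Set X} (hF : IsFaceSet m F) (hp : p ∈ F)
    (hp1 : p ∈ codimOnePart m X) : ∀ᶠ u in 𝓝 p, u ∈ codimOnePart m X → u ∈ F := by
  obtain ⟨e, he, hpe, i, hi, hF⟩ := hF.exists_chart p hp
  have h1 : ∀ᶠ u in 𝓝 p, ∀ k, k ≠ i → 0 < coord e u k := by
    refine eventually_all.2 fun k => ?_
    by_cases hk : k = i
    · simp [hk]
    · have hk0 : coord e p k ≠ 0 := fun h => hk (codimOnePart_unique he hpe hp1 h hi)
      filter_upwards [eventually_coord_pos hpe hk0] with u hu _ using hu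
  filter_upwards [hF, h1, e.open_source.mem_nhds hpe] with u hu h1 hue hu1
  obtain ⟨k, hk⟩ := exists_coord_eq_zero_of_mem_codimOnePart he hue hu1
  rw [hu]
  by_contra h
  exact (h1 k (fun hki => h (hki ▸ hk))).ne' hk

/-- A face set contains every connected part of codimension one that it meets. -/
theorem IsFaceSet.subset_of_isPreconnected {F S : Set X} (hF : IsFaceSet m F)
    (hS : IsPreconnected S) (hS1 : S ⊆ codimOnePart m X) (hSF : (S ∩ F).Nonempty) : S ⊆ F := by
  have h1 := isPreconnected_iff_subset_of_disjoint.1 hS (interior {u | u ∈ codimOnePart m X → u ∈ F})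
    Fᶜ isOpen_interior hF.isClosed.isOpen_compl (fun u hu => ?_) ?_
  · rcases h1 with h | h
    · exact fun u hu => interior_subset (h hu) (hS1 hu)
    · obtain ⟨u, hu, huF⟩ := hSF
      exact absurd huF (h hu)
  · by_cases huF : u ∈ F
    · exact Or.inl (mem_interior_iff_mem_nhds.2 (hF.eventually_mem huF (hS1 hu)))
    · exact Or.inr huF
  · rw [Set.eq_empty_iff_forall_notMem]
    rintro u ⟨hu, h2, h3⟩
    exact h3 (interior_subset h2 (hS1 hu))

/-- An embedded set of faces is given by one coordinate in every chart. -/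
theorem exists_index_of_isEmbeddedHypersurface {F : Set X} (hcl : IsClosed F)
    (hemb : IsEmbeddedHypersurface m X F) (hsub : F ⊆ closure (F ∩ codimOnePart m X))
    (hsat : ∀ S, IsPreconnected S → S ⊆ codimOnePart m X → (S ∩ F).Nonempty → S ⊆ F)
    (hp : p ∈ F) (he : e ∈ IsManifold.maximalAtlas (cornerModel m) ∞ X) (hpe : p ∈ e.source) :
    ∃ i, coord e p i = 0 ∧ ∀ᶠ u in 𝓝 p, (u ∈ F ↔ coord e u i = 0) := by
  obtain ⟨U₁, hU₁, hpU₁, ρ, hρ, hρ0, hρpos, hdρ⟩ := hemb p hp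
  obtain ⟨U, hU, hpU, hUe, S, hS, hS', hSp⟩ := exists_localFaces he hpe (hU₁.mem_nhds hpU₁)
  -- Near p the set F is the union of those coordinate faces whose open part lies in F: `hF1` holds
  -- by closedness, `hF2` by density of the points of codimension one and saturation under connected
  -- sets.
  have hF1 : ∀ u ∈ U, ∀ i, S i ⊆ F → coord e u i = 0 → u ∈ F := fun u hu i hi hui =>
    hcl.closure_subset_iff.2 hi ((hS i).2.2.2 u hu hui)
  have hF2 : ∀ u ∈ U, u ∈ F → ∃ i, S i ⊆ F ∧ coord e u i = 0 := by
    intro u hu huF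
    by_contra! hcon
    have h1 : ∀ᶠ y in 𝓝 u, ∀ i, S i ⊆ F → 0 < coord e y i := by
      refine eventually_all.2 fun i => ?_
      by_cases hi : S i ⊆ F
      · filter_upwards [eventually_coord_pos (hUe hu).1 (hcon i hi)] with y hy _ using hy
      · simp [hi]
    obtain ⟨y, ⟨hy1, hyU⟩, hyF, hyc⟩ :=
      mem_closure_iff_nhds.1 (hsub huF) _ (h1.and (hU.mem_nhds hu))
    obtain ⟨k, hk⟩ := exists_coord_eq_zero_of_mem_codimOnePart he (hUe hyU).1 hyc
    have hyS := hS' y hyU hyc k hk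
    exact (hy1 k (hsat _ (hS k).1 (hS k).2.1 ⟨y, hyS, hyF⟩)).ne' hk
  obtain ⟨i, hiF, hpi⟩ := hF2 p hpU hp
  refine ⟨i, hpi, ?_⟩
  filter_upwards [hU.mem_nhds hpU] with u hu
  refine ⟨fun huF => ?_, hF1 u hu i hiF⟩
  obtain ⟨j, hjF, huj⟩ := hF2 u hu huF
  have hpj := hSp u hu j huj
  suffices h : i = j by rw [h]; exact huj
  by_contra hij
  -- If two different faces i and j occurred, ρ would vanish on both. Every basis vector points
  -- along one of them, so the differential of ρ at p would be zero, contrary to embeddedness.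
  have hρp : ContMDiffAt (cornerModel m) 𝓘(ℝ, ℝ) ∞ ρ p := hρ.contMDiffAt (hU₁.mem_nhds hpU₁)
  obtain ⟨D, hD, hDv⟩ := hasFDerivWithinAt_comp_uncoord he hpe (hρp.mdifferentiableAt (by simp))
  have hD0 : ∀ k l, coord e p l = 0 → S l ⊆ F → k ≠ l → D (EuclideanSpace.single k 1) = 0 := by
    intro k l hl hlF hkl
    have hw : ∀ r, coord e p r = 0 → 0 ≤ (EuclideanSpace.single k (1 : ℝ)) r := fun r _ => by
      by_cases h : r = k
      · simp [h]
      · simp [h]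
    have h1 := hasDerivWithinAt_line (coord_mem e p) hD hw
    have h2 : ∀ᶠ t in 𝓝[≥] (0 : ℝ),
        (ρ ∘ uncoord e) (coord e p + t • EuclideanSpace.single k 1) = 0 := by
      have ht : Tendsto (fun t : ℝ => coord e p + t • EuclideanSpace.single k (1 : ℝ)) (𝓝[≥] 0)
          (𝓝 (coord e p)) := by
        have hc : Continuous fun t : ℝ => coord e p + t • EuclideanSpace.single k (1 : ℝ) := by
          fun_prop
        exact (hc.tendsto' 0 _ (by simp)).mono_left nhdsWithin_le_nhds
      filter_upwards [eventually_add_smul_mem_quadrant (coord_mem e p) hw,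
        ht.eventually (eventually_symm_mem_target hpe),
        ht.eventually ((tendsto_uncoord hpe).eventually (hU.mem_nhds hpU))] with t h3 h4 h5
      refine hρ0 _ (hUe h5).2 (hF1 _ h5 l hlF ?_)
      rw [coord_uncoord h3 h4]
      simp [hl, hkl.symm]
    have h3 : HasDerivWithinAt (fun t : ℝ => (ρ ∘ uncoord e)
        (coord e p + t • EuclideanSpace.single k 1)) 0 (Ici 0) 0 :=
      (hasDerivWithinAt_const (0 : ℝ) (Ici 0) (0 : ℝ)).congr_of_eventuallyEq h2
        (by simpa using h2.self_of_nhdsWithin (by simp))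
    exact (uniqueDiffOn_Ici (0 : ℝ) 0 (by simp)).eq_deriv _ h1 h3
  apply hdρ
  have hDz : D = 0 := by
    refine ContinuousLinearMap.coe_injective
      ((EuclideanSpace.basisFun (Fin m) ℝ).toBasis.ext fun k => ?_)
    simp only [OrthonormalBasis.coe_toBasis, EuclideanSpace.basisFun_apply]
    by_cases hk : k = i
    · exact hD0 k j hpj hjF (by rw [hk]; exact hij)
    · exact hD0 k i hpi hiF hk
  ext v
  rw [hDv, hDz]
  rfl

/-- The definition provides one suitable chart at p; being embedded provides the index in every
chart, in particular in the straight ones. -/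
theorem IsFaceSet.exists_index {F : Set X} (hF : IsFaceSet m F) (hp : p ∈ F)
    (he : e ∈ IsManifold.maximalAtlas (cornerModel m) ∞ X) (hpe : p ∈ e.source) :
    ∃ i, coord e p i = 0 ∧ ∀ᶠ u in 𝓝 p, (u ∈ F ↔ coord e u i = 0) :=
  exists_index_of_isEmbeddedHypersurface hF.isClosed
    (isEmbeddedHypersurface_of_locally fun _ hp => ⟨F, hF, hp, Eventually.of_forall fun _ => Iff.rfl⟩)
    hF.subset_closure (fun _ h1 h2 h3 => hF.subset_of_isPreconnected h1 h2 h3) hp he hpe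

/-- Near a point of a face set there is only one boundary hypersurface inside the face set. -/
theorem IsFaceSet.exists_unique_near {F : Set X} (hF : IsFaceSet m F) (hp : p ∈ F) :
    ∃ U : Set X, IsOpen U ∧ p ∈ U ∧ ∃ H₀ : Set X, (∀ u ∈ U, u ∈ F → u ∈ H₀) ∧
      ∀ H ∈ boundaryHypersurfaces m X, H ⊆ F → (H ∩ U).Nonempty → H = H₀ := by
  obtain ⟨U, hU, hpU, S, hS, hSsub, hS1, hcl⟩ := hF.exists_local hp
  obtain ⟨s, -, hs⟩ := mem_closure_iff.1 (hcl p hpU hp) U hU hpU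
  have hSc : S ⊆ connectedComponentIn (codimOnePart m X) s :=
    hS.subset_connectedComponentIn hs fun u hu => (hSsub hu).1.1
  refine ⟨U, hU, hpU, closure (connectedComponentIn (codimOnePart m X) s),
    fun u hu huF => closure_mono hSc (hcl u hu huF), ?_⟩
  rintro H ⟨x, hx, rfl⟩ hHF ⟨y, hy, hyU⟩
  obtain ⟨u, huU, hu⟩ := mem_closure_iff.1 hy U hU hyU
  have huS := hS1 u huU (hHF (_root_.subset_closure hu)) (connectedComponentIn_subset _ _ hu)
  rw [connectedComponentIn_eq hu, connectedComponentIn_eq (hSc huS)]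

theorem IsFaceSet.closure_component_subset {F : Set X} (hF : IsFaceSet m F) (hp : p ∈ F)
    (hp1 : p ∈ codimOnePart m X) : closure (connectedComponentIn (codimOnePart m X) p) ⊆ F :=
  hF.isClosed.closure_subset_iff.2 (hF.subset_of_isPreconnected isPreconnected_connectedComponentIn
    (connectedComponentIn_subset _ _) ⟨p, mem_connectedComponentIn hp1, hp⟩)

end

/-- Face sets that cover the part of codimension one and are pairwise disjoint on it. -/
structure IsFaceSystem (m : ℕ) {X : Type*} [TopologicalSpace X]
    [ChartedSpace (EuclideanQuadrant m) X] {ι : Type*} (F : ι → Set X) : Prop where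
  isFaceSet : ∀ k, IsFaceSet m (F k)
  exists_mem : ∀ x ∈ codimOnePart m X, ∃ k, x ∈ F k
  eq_of_mem : ∀ x ∈ codimOnePart m X, ∀ j k, x ∈ F j → x ∈ F k → j = k

variable [IsManifold (cornerModel m) ∞ X]

/-- Near each of its points a boundary hypersurface fills the face set that contains it, so the
coordinate cutting out the face set serves as defining function. -/
theorem IsFaceSystem.isEmbeddedHypersurface {ι : Type*} {F : ι → Set X} (hF : IsFaceSystem m F)
    {H : Set X} (hH : H ∈ boundaryHypersurfaces m X) : IsEmbeddedHypersurface m X H := by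
  have hH' := hH
  obtain ⟨x, hx, rfl⟩ := hH
  obtain ⟨k, hk⟩ := hF.exists_mem x hx
  have hsub := (hF.isFaceSet k).closure_component_subset hk hx
  refine isEmbeddedHypersurface_of_locally fun p hp => ⟨F k, hF.isFaceSet k, hsub hp, ?_⟩
  obtain ⟨U, hU, hpU, H₀, h1, h2⟩ := (hF.isFaceSet k).exists_unique_near (hsub hp)
  have h3 := h2 _ hH' hsub ⟨p, hp, hpU⟩
  filter_upwards [hU.mem_nhds hpU] with u hu
  exact ⟨fun h => hsub h, fun h => by rw [h3]; exact h1 u hu h⟩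

/-- Near a given point there is at most one boundary hypersurface inside F k. So these hypersurfaces
are disjoint and locally finite, hence finite by compactness. The collections are written in the
form of `inducedCollection`. -/
theorem IsFaceSystem.isBoundaryPartition [CompactSpace X] {l : ℕ} {F : Fin l → Set X}
    (hF : IsFaceSystem m F) :
    IsBoundaryPartition m (fun k => {H | H ∈ boundaryHypersurfaces m X ∧ H ⊆ F k}) := by
  refine ⟨fun k => ⟨?_, fun H hH => hH.1, ?_⟩, ?_⟩
  · have hfin : LocallyFinite
        (fun H : {H : Set X // H ∈ boundaryHypersurfaces m X ∧ H ⊆ F k} => H.1) := by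
      intro p
      by_cases hp : p ∈ F k
      · obtain ⟨U, hU, hpU, H₀, -, h2⟩ := (hF.isFaceSet k).exists_unique_near hp
        refine ⟨U, hU.mem_nhds hpU, Set.Subsingleton.finite ?_⟩
        rintro ⟨H, hH⟩ h3 ⟨H', hH'⟩ h4
        exact Subtype.ext ((h2 H hH.1 hH.2 h3).trans (h2 H' hH'.1 hH'.2 h4).symm)
      · refine ⟨(F k)ᶜ, (hF.isFaceSet k).isClosed.isOpen_compl.mem_nhds hp, ?_⟩
        refine Set.Subsingleton.finite ?_
        rintro ⟨H, hH⟩ ⟨y, hy, hyF⟩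
        exact absurd (hH.2 hy) hyF
    have hne : ∀ H : {H : Set X // H ∈ boundaryHypersurfaces m X ∧ H ⊆ F k}, H.1.Nonempty := by
      rintro ⟨H, ⟨x, hx, rfl⟩, -⟩
      exact ⟨x, subset_closure (mem_connectedComponentIn hx)⟩
    exact Set.finite_coe_iff.1 (Set.finite_univ_iff.1 (hfin.finite_of_compact hne))
  · rintro H hH H' hH' hne
    refine Set.disjoint_left.2 fun p hp hp' => hne ?_
    obtain ⟨U, hU, hpU, H₀, -, h2⟩ := (hF.isFaceSet k).exists_unique_near (hH.2 hp)
    exact (h2 H hH.1 hH.2 ⟨p, hp, hpU⟩).trans (h2 H' hH'.1 hH'.2 ⟨p, hp', hpU⟩).symm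
  · intro H hH
    have hH' := hH
    obtain ⟨x, hx, rfl⟩ := hH
    obtain ⟨k, hk⟩ := hF.exists_mem x hx
    refine ⟨k, ⟨hH', (hF.isFaceSet k).closure_component_subset hk hx⟩, ?_⟩
    rintro j ⟨-, hj⟩
    exact hF.eq_of_mem x hx j k (hj (subset_closure (mem_connectedComponentIn hx))) hk

/-- Saturation under connected sets holds because a component is relatively closed in the part of
codimension one. -/
theorem isFaceSet_of_mem_boundaryHypersurfaces {H : Set X} (hH : H ∈ boundaryHypersurfaces m X)
    (hemb : IsEmbeddedHypersurface m X H) : IsFaceSet m H := by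
  obtain ⟨x, hx, rfl⟩ := hH
  refine ⟨isClosed_closure, fun p hp => ⟨chartAt _ p, IsManifold.chart_mem_maximalAtlas p,
    mem_chart_source _ p, exists_index_of_isEmbeddedHypersurface isClosed_closure hemb ?_ ?_ hp
    (IsManifold.chart_mem_maximalAtlas p) (mem_chart_source _ p)⟩⟩
  · exact closure_mono fun u hu => ⟨subset_closure hu, connectedComponentIn_subset _ _ hu⟩
  · rintro S hS hS1 ⟨u, huS, hu⟩
    have h1 := mem_connectedComponentIn_of_mem_closure hx (hS1 huS) hu
    rw [connectedComponentIn_eq h1]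
    exact (hS.subset_connectedComponentIn huS hS1).trans subset_closure

/-- The unions of the members of a boundary partition form a face system. -/
theorem IsBoundaryPartition.isFaceSystem (hM : IsCompactManifoldWithCorners m X) {l : ℕ}
    {B : Fin l → Set (Set X)} (hB : IsBoundaryPartition m B) : IsFaceSystem m fun k => ⋃₀ B k := by
  have hface : ∀ k, ∀ H ∈ B k, IsFaceSet m H := fun k H hH =>
    isFaceSet_of_mem_boundaryHypersurfaces ((hB.collective k).subset hH)
      (hM.embedded H ((hB.collective k).subset hH))
  refine ⟨fun k => ⟨by
      rw [sUnion_eq_biUnion]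
      exact (hB.collective k).finite.isClosed_biUnion fun H hH => (hface k H hH).isClosed,
    ?_⟩, ?_, ?_⟩
  · rintro p ⟨H, hH, hp⟩
    obtain ⟨e, he, hpe, i, hi, hFi⟩ := (hface k H hH).exists_chart p hp
    refine ⟨e, he, hpe, i, hi, ?_⟩
    -- By disjointness the finitely many other members avoid a neighbourhood of p, so there the
    -- union is H alone.
    have hcl : IsClosed (⋃₀ (B k \ {H})) := by
      rw [sUnion_eq_biUnion]
      exact ((hB.collective k).finite.subset sdiff_subset).isClosed_biUnion
        fun H' hH' => (hface k H' hH'.1).isClosed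
    have hpn : p ∉ ⋃₀ (B k \ {H}) := by
      rintro ⟨H', ⟨hH', hne⟩, hp'⟩
      exact Set.disjoint_left.1 ((hB.collective k).pairwiseDisjoint hH' hH hne) hp' hp
    filter_upwards [hFi, hcl.isOpen_compl.mem_nhds hpn] with u hu hun
    rw [← hu]
    refine ⟨?_, fun h => ⟨H, hH, h⟩⟩
    rintro ⟨H', hH', hu'⟩
    by_cases h : H' = H
    · exact h ▸ hu'
    · exact absurd ⟨H', ⟨hH', h⟩, hu'⟩ hun
  · intro x hx
    obtain ⟨k, hk, -⟩ := hB.existsUnique _ ⟨x, hx, rfl⟩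
    exact ⟨k, _, hk, subset_closure (mem_connectedComponentIn hx)⟩
  · have key : ∀ x ∈ codimOnePart m X, ∀ k, x ∈ ⋃₀ B k →
        closure (connectedComponentIn (codimOnePart m X) x) ∈ B k := by
      rintro x hx k ⟨H, hH, hxH⟩
      obtain ⟨y, hy, rfl⟩ := (hB.collective k).subset hH
      rwa [← connectedComponentIn_eq (mem_connectedComponentIn_of_mem_closure hy hx hxH)]
    exact fun x hx j k hj hk => (hB.existsUnique _ ⟨x, hx, rfl⟩).unique (key x hx j hj) (key x hx k hk)

/-- The indices of different members of a face system in a chart are different. -/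
theorem IsFaceSystem.index_ne {ι : Type*} {F : ι → Set X} (hF : IsFaceSystem m F) {j k : ι}
    (hjk : j ≠ k) {e : OpenPartialHomeomorph X (EuclideanQuadrant m)} {p : X} {i i' : Fin m}
    (hp : p ∈ F j) (hi : ∀ᶠ u in 𝓝 p, (u ∈ F j ↔ coord e u i = 0))
    (hi' : ∀ᶠ u in 𝓝 p, (u ∈ F k ↔ coord e u i' = 0)) : i ≠ i' := by
  rintro rfl
  obtain ⟨u, ⟨h1, h2⟩, hu, hu1⟩ :=
    mem_closure_iff_nhds.1 ((hF.isFaceSet j).subset_closure hp) _ (hi.and hi')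
  exact hjk (hF.eq_of_mem u hu1 j k hu (h2.2 (h1.1 hu)))

/-- A vanishing coordinate at x would make x a limit of an open face, which consists of points of
codimension one. -/
theorem boundarylessManifold_of_codimOnePart_eq_empty (h : codimOnePart m X = ∅) :
    BoundarylessManifold (cornerModel m) X := by
  refine ⟨fun x => ?_⟩
  have he := IsManifold.chart_mem_maximalAtlas (I := cornerModel m) (n := ∞) x
  have hx := mem_chart_source (EuclideanQuadrant m) x
  have hpos : ∀ i, 0 < coord (chartAt (EuclideanQuadrant m) x) x i := by
    intro i
    refine lt_of_le_of_ne (coord_mem _ x i) fun hi => ?_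
    obtain ⟨U, hU, hpU, -, S, hS, -⟩ := exists_localFaces he hx univ_mem
    obtain ⟨u, -, hu⟩ := mem_closure_iff.1 ((hS i).2.2.2 x hpU hi.symm) U hU hpU
    have := (hS i).2.1 hu
    rw [h] at this
    exact this
  rw [ModelWithCorners.IsInteriorPoint, range_cornerModel, mem_interior_iff_mem_nhds]
  have h1 : ∀ᶠ z in 𝓝 (coord (chartAt (EuclideanQuadrant m) x) x), ∀ i, 0 < z i := by
    refine eventually_all.2 fun i => ?_
    have hc : ContinuousAt (fun z : EuclideanSpace ℝ (Fin m) => z i)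
      (coord (chartAt (EuclideanQuadrant m) x) x) := by fun_prop
    exact hc.eventually (lt_mem_nhds (hpos i))
  filter_upwards [h1] with z hz i using (hz i).le

end FaceSets

/-! ### Differentiation of integrals over a compact manifold -/

section ParametricIntegral

/-- The derivative in the second variable of a jointly smooth map is jointly smooth. -/
theorem contMDiffWithinAt_fderivWithin {E' N E₁ F₁ : Type*} [NormedAddCommGroup E']
    [NormedSpace ℝ E'] [TopologicalSpace N] [ChartedSpace E' N] [IsManifold 𝓘(ℝ, E') ∞ N]
    [NormedAddCommGroup E₁] [NormedSpace ℝ E₁] [NormedAddCommGroup F₁] [NormedSpace ℝ F₁]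
    {Φ : N → E₁ → F₁} {t : Set E₁} (ht : UniqueDiffOn ℝ t) {n₀ : N} {z₀ : E₁} (hz : z₀ ∈ t)
    (h : ContMDiffWithinAt (𝓘(ℝ, E').prod 𝓘(ℝ, E₁)) 𝓘(ℝ, F₁) ∞ (uncurry Φ) (univ ×ˢ t) (n₀, z₀)) :
    ContMDiffWithinAt (𝓘(ℝ, E').prod 𝓘(ℝ, E₁)) 𝓘(ℝ, E₁ →L[ℝ] F₁) ∞
      (fun p : N × E₁ => fderivWithin ℝ (Φ p.1) t p.2) (univ ×ˢ t) (n₀, z₀) := by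
  set ψ := extChartAt 𝓘(ℝ, E') n₀ with hψ
  have h1 : ContMDiffAt 𝓘(ℝ, E') 𝓘(ℝ, E') ∞ ψ.symm (ψ n₀) :=
    (contMDiffOn_extChartAt_symm n₀).contMDiffAt (extChartAt_target_mem_nhds n₀)
  have hn : ψ.symm (ψ n₀) = n₀ := extChartAt_to_inv n₀
  -- Only the parameter in N is read in a chart. The evaluation point is made part of the parameter,
  -- so that both may vary in the smoothness statement for derivatives.
  set f : E' × E₁ → E₁ → F₁ := fun a z => Φ (ψ.symm a.1) z with hf
  have h2 : ContMDiffWithinAt 𝓘(ℝ, (E' × E₁) × E₁) (𝓘(ℝ, E').prod 𝓘(ℝ, E₁)) ∞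
      (fun q : (E' × E₁) × E₁ => ((ψ.symm q.1.1, q.2) : N × E₁)) ((univ ×ˢ t) ×ˢ t)
      ((ψ n₀, z₀), z₀) := by
    refine ContMDiffWithinAt.prodMk ?_ (contDiff_snd.contMDiff _).contMDiffWithinAt
    exact ContMDiffAt.comp_contMDiffWithinAt (x := ((ψ n₀, z₀), z₀)) h1
      (f := fun q : (E' × E₁) × E₁ => q.1.1)
      ((contDiff_fst.comp contDiff_fst).contMDiff _).contMDiffWithinAt
  have h3 : ContDiffWithinAt ℝ ∞ (uncurry f) ((univ ×ˢ t) ×ˢ t) ((ψ n₀, z₀), z₀) := by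
    rw [← contMDiffWithinAt_iff_contDiffWithinAt]
    have h' : ContMDiffWithinAt (𝓘(ℝ, E').prod 𝓘(ℝ, E₁)) 𝓘(ℝ, F₁) ∞ (uncurry Φ) (univ ×ˢ t)
      (ψ.symm (ψ n₀), z₀) := by rwa [hn]
    exact ContMDiffWithinAt.comp (t := univ ×ˢ t) ((ψ n₀, z₀), z₀) h' h2
      fun q hq => ⟨mem_univ _, hq.2⟩
  have h4 : ContDiffWithinAt ℝ ∞ (fun a : E' × E₁ => fderivWithin ℝ (f a) t a.2) (univ ×ˢ t)
      (ψ n₀, z₀) := by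
    have hz' : ((ψ n₀, z₀) : E' × E₁) ∈ (univ ×ˢ t : Set (E' × E₁)) := ⟨mem_univ _, hz⟩
    refine ContDiffWithinAt.fderivWithin' (n := ∞) (g := fun a : E' × E₁ => a.2)
      (by rwa [insert_eq_of_mem hz']) contDiff_snd.contDiffWithinAt ?_ (by simp) fun a ha => ha.2
    rw [insert_eq_of_mem hz']
    filter_upwards [self_mem_nhdsWithin] with a ha using ht _ ha.2
  have h5 : ContMDiffWithinAt (𝓘(ℝ, E').prod 𝓘(ℝ, E₁)) 𝓘(ℝ, E' × E₁) ∞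
      (fun p : N × E₁ => (ψ p.1, p.2)) (univ ×ˢ t) (n₀, z₀) := by
    refine ContMDiffWithinAt.prodMk_space ?_ contMDiffWithinAt_snd
    exact (contMDiffAt_extChartAt (I := 𝓘(ℝ, E')) (x := n₀)).comp_contMDiffWithinAt
      (x := ((n₀, z₀) : N × E₁)) contMDiffWithinAt_fst
  have h6 := ContMDiffWithinAt.comp (x := ((n₀, z₀) : N × E₁)) (t := univ ×ˢ t)
    h4.contMDiffWithinAt h5 fun p hp => ⟨mem_univ _, hp.2⟩
  refine h6.congr_of_eventuallyEq ?_ ?_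
  · have h7 : ∀ᶠ p : N × E₁ in 𝓝 (n₀, z₀), p.1 ∈ ψ.source :=
      continuous_fst.continuousAt.eventually (extChartAt_source_mem_nhds n₀)
    filter_upwards [nhdsWithin_le_nhds h7] with p hp
    simp only [comp, hf, ψ.left_inv hp]
  · simp only [comp, hf, hn]

variable {K : Type*} [TopologicalSpace K] [CompactSpace K] [MeasurableSpace K] [BorelSpace K]
  (μ : Measure K) [IsFiniteMeasure μ]

theorem _root_.Continuous.integrable_of_compactSpace {F₁ : Type*} [NormedAddCommGroup F₁]
    {f : K → F₁} (hf : Continuous f) : Integrable f μ :=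
  hf.integrable_of_hasCompactSupport (HasCompactSupport.of_compactSpace f)

/-- By compactness D k y tends to D k z uniformly in k, and the mean value inequality then bounds
the remainder uniformly under the integral. -/
theorem hasFDerivWithinAt_integral {E₁ F₁ : Type*} [NormedAddCommGroup E₁] [NormedSpace ℝ E₁]
    [NormedAddCommGroup F₁] [NormedSpace ℝ F₁] [CompleteSpace F₁] {t : Set E₁} (ht : Convex ℝ t)
    {Φ : K → E₁ → F₁} {D : K → E₁ → E₁ →L[ℝ] F₁} (hΦ : ContinuousOn (uncurry Φ) (univ ×ˢ t))
    (hD : ContinuousOn (uncurry D) (univ ×ˢ t))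
    (hder : ∀ k, ∀ z ∈ t, HasFDerivWithinAt (Φ k) (D k z) t z) {z : E₁} (hz : z ∈ t) :
    HasFDerivWithinAt (fun y => ∫ k, Φ k y ∂μ) (∫ k, D k z ∂μ) t z := by
  have hcs : ∀ y ∈ t, Continuous fun k : K => ((k, y) : K × E₁) := fun y _ => by fun_prop
  have hΦc : ∀ y ∈ t, Continuous fun k => Φ k y := fun y hy =>
    hΦ.comp_continuous (hcs y hy) fun k => ⟨mem_univ _, hy⟩
  have hDc : Continuous fun k => D k z := hD.comp_continuous (hcs z hz) fun k => ⟨mem_univ _, hz⟩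
  have hΦi : ∀ y ∈ t, Integrable (fun k => Φ k y) μ := fun y hy =>
    (hΦc y hy).integrable_of_compactSpace μ
  have hDi : Integrable (fun k => D k z) μ := hDc.integrable_of_compactSpace μ
  rw [hasFDerivWithinAt_iff_isLittleO, Asymptotics.isLittleO_iff]
  intro c hc
  set ε : ℝ := c / (μ.real univ + 1) with hε
  have hμ : 0 < μ.real univ + 1 := by positivity
  have hεpos : 0 < ε := div_pos hc hμ
  have h1 : ∀ᶠ y in 𝓝 z, ∀ k ∈ (univ : Set K), y ∈ t → ‖D k y - D k z‖ < ε := by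
    refine isCompact_univ.eventually_forall_of_forall_eventually fun k _ => ?_
    have h2 : ContinuousWithinAt (uncurry D) (univ ×ˢ t) (k, z) := hD (k, z) ⟨mem_univ _, hz⟩
    have h3 : ContinuousAt (fun p : K × E₁ => D p.1 z) (k, z) :=
      hDc.continuousAt.comp continuous_fst.continuousAt
    have h4 : Tendsto (fun p : K × E₁ => ‖D p.1 p.2 - D p.1 z‖) (𝓝[univ ×ˢ t] (k, z)) (𝓝 0) := by
      have := (h2.tendsto.sub (h3.tendsto.mono_left nhdsWithin_le_nhds)).norm
      simpa [uncurry] using this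
    have h5 := eventually_nhdsWithin_iff.1 (h4.eventually (gt_mem_nhds hεpos))
    have h6 : Tendsto (fun p : E₁ × K => (p.2, p.1)) (𝓝 (z, k)) (𝓝 (k, z)) :=
      (continuous_swap.tendsto (z, k))
    filter_upwards [h6.eventually h5] with p hp hpt using hp ⟨mem_univ _, hpt⟩
  obtain ⟨r, hr, hball⟩ := Metric.eventually_nhds_iff_ball.1 h1
  filter_upwards [inter_mem_nhdsWithin t (Metric.ball_mem_nhds z hr)] with y hy
  have h7 : ∀ k, ‖Φ k y - Φ k z - D k z (y - z)‖ ≤ ε * ‖y - z‖ := fun k =>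
    Convex.norm_image_sub_le_of_norm_hasFDerivWithin_le' (s := t ∩ Metric.ball z r)
      (fun x hx => (hder k x hx.1).mono inter_subset_left)
      (fun x hx => (hball x hx.2 k (mem_univ _) hx.1).le) (ht.inter (convex_ball z r))
      ⟨hz, Metric.mem_ball_self hr⟩ hy
  have h8 : (∫ k, Φ k y ∂μ) - (∫ k, Φ k z ∂μ) - (∫ k, D k z ∂μ) (y - z) =
      ∫ k, (Φ k y - Φ k z - D k z (y - z)) ∂μ := by
    rw [integral_sub, integral_sub, ContinuousLinearMap.integral_apply hDi]
    · exact hΦi y hy.1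
    · exact hΦi z hz
    · exact (hΦi y hy.1).sub (hΦi z hz)
    · exact hDi.apply_continuousLinearMap _
  rw [h8]
  refine (norm_integral_le_of_norm_le_const (Eventually.of_forall h7)).trans ?_
  have h9 : ε * μ.real univ ≤ c := by
    rw [hε, div_mul_eq_mul_div, div_le_iff₀ hμ]
    nlinarith
  calc ε * ‖y - z‖ * μ.real univ = ε * μ.real univ * ‖y - z‖ := by ring
    _ ≤ c * ‖y - z‖ := mul_le_mul_of_nonneg_right h9 (norm_nonneg _)

theorem hasFDerivWithinAt_integral_fderivWithin {E' : Type*} [NormedAddCommGroup E']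
    [NormedSpace ℝ E'] [ChartedSpace E' K] [IsManifold 𝓘(ℝ, E') ∞ K] {E₁ F₁ : Type*}
    [NormedAddCommGroup E₁] [NormedSpace ℝ E₁] {t : Set E₁} (ht : Convex ℝ t)
    (htu : UniqueDiffOn ℝ t) [NormedAddCommGroup F₁] [NormedSpace ℝ F₁] [CompleteSpace F₁]
    {Φ : K → E₁ → F₁}
    (hΦ : ContMDiffOn (𝓘(ℝ, E').prod 𝓘(ℝ, E₁)) 𝓘(ℝ, F₁) ∞ (uncurry Φ) (univ ×ˢ t)) {z : E₁}
    (hz : z ∈ t) :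
    HasFDerivWithinAt (fun y => ∫ k, Φ k y ∂μ) (∫ k, fderivWithin ℝ (Φ k) t z ∂μ) t z := by
  have hD : ContMDiffOn (𝓘(ℝ, E').prod 𝓘(ℝ, E₁)) 𝓘(ℝ, E₁ →L[ℝ] F₁) ∞
      (uncurry fun k z => fderivWithin ℝ (Φ k) t z) (univ ×ˢ t) :=
    fun p hp => contMDiffWithinAt_fderivWithin htu hp.2 (hΦ p hp)
  refine hasFDerivWithinAt_integral μ ht hΦ.continuousOn hD.continuousOn (fun k y hy => ?_) hz
  have h1 : ContMDiffWithinAt 𝓘(ℝ, E₁) (𝓘(ℝ, E').prod 𝓘(ℝ, E₁)) ∞ (fun y : E₁ => ((k, y) : K × E₁))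
      t y := contMDiffWithinAt_const.prodMk contMDiffWithinAt_id
  have h2 : ContMDiffWithinAt 𝓘(ℝ, E₁) 𝓘(ℝ, F₁) ∞ (Φ k) t y :=
    ContMDiffWithinAt.comp (t := univ ×ˢ t) y (hΦ (k, y) ⟨mem_univ _, hy⟩) h1
      fun q hq => ⟨mem_univ _, hq⟩
  exact (h2.contDiffWithinAt.differentiableWithinAt (by simp)).hasFDerivWithinAt

/-- Integrals over a compact manifold of smooth families of functions are smooth. -/
theorem contDiffOn_integral {E' : Type*} [NormedAddCommGroup E'] [NormedSpace ℝ E']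
    [ChartedSpace E' K] [IsManifold 𝓘(ℝ, E') ∞ K] {E₁ : Type u} [NormedAddCommGroup E₁]
    [NormedSpace ℝ E₁] {t : Set E₁} (ht : Convex ℝ t) (htu : UniqueDiffOn ℝ t) {F₁ : Type u}
    [NormedAddCommGroup F₁] [NormedSpace ℝ F₁] [CompleteSpace F₁] {Φ : K → E₁ → F₁}
    (hΦ : ContMDiffOn (𝓘(ℝ, E').prod 𝓘(ℝ, E₁)) 𝓘(ℝ, F₁) ∞ (uncurry Φ) (univ ×ˢ t)) :
    ContDiffOn ℝ ∞ (fun y => ∫ k, Φ k y ∂μ) t := by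
  refine contDiffOn_infty.2 fun n => ?_
  -- The inductive step applies the hypothesis to the derivative, with values in E₁ →L[ℝ] F₁; hence
  -- the common universe.
  induction n generalizing F₁ with
  | zero =>
    exact contDiffOn_zero.2 fun z hz =>
      (hasFDerivWithinAt_integral_fderivWithin μ ht htu hΦ hz).continuousWithinAt
  | succ n ih =>
    have hD : ContMDiffOn (𝓘(ℝ, E').prod 𝓘(ℝ, E₁)) 𝓘(ℝ, E₁ →L[ℝ] F₁) ∞
        (uncurry fun k z => fderivWithin ℝ (Φ k) t z) (univ ×ˢ t) :=
      fun p hp => contMDiffWithinAt_fderivWithin htu hp.2 (hΦ p hp)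
    have h1 := fun z hz => hasFDerivWithinAt_integral_fderivWithin μ ht htu hΦ (z := z) hz
    push_cast
    refine (contDiffOn_succ_iff_fderivWithin htu).2
      ⟨fun z hz => (h1 z hz).differentiableWithinAt, by simp, (ih hD).congr fun z hz => ?_⟩
    exact (h1 z hz).fderivWithin (htu z hz)

end ParametricIntegral

/-! ### Vector fields pointing into the manifold along a face set -/

section Fields

variable {m : ℕ} {X : Type*} [TopologicalSpace X] [ChartedSpace (EuclideanQuadrant m) X]
  {e e' : OpenPartialHomeomorph X (EuclideanQuadrant m)} {x : X}

/-- A vector field is smooth if its coordinates in all charts are. -/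
def IsSmoothField (m : ℕ) {X : Type*} [TopologicalSpace X] [ChartedSpace (EuclideanQuadrant m) X]
    (V : ∀ x : X, TangentSpace (cornerModel m) x) : Prop :=
  ∀ e ∈ IsManifold.maximalAtlas (cornerModel m) ∞ X, ∀ x ∈ e.source,
    ContMDiffAt (cornerModel m) 𝓘(ℝ, EuclideanSpace ℝ (Fin m)) ∞ (fun y => dcoord e y (V y)) x

theorem contMDiffAt_iff_comp_uncoord {F₁ : Type*} [NormedAddCommGroup F₁] [NormedSpace ℝ F₁]
    (he : e ∈ IsManifold.maximalAtlas (cornerModel m) ∞ X) (hx : x ∈ e.source) {f : X → F₁} :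
    ContMDiffAt (cornerModel m) 𝓘(ℝ, F₁) ∞ f x ↔
      ContDiffWithinAt ℝ ∞ (f ∘ uncoord e) (quadrant m) (coord e x) := by
  constructor
  · intro h
    rw [← contMDiffWithinAt_iff_contDiffWithinAt]
    have h' : ContMDiffAt (cornerModel m) 𝓘(ℝ, F₁) ∞ f (uncoord e (coord e x)) := by
      rwa [uncoord_coord hx]
    exact h'.comp_contMDiffWithinAt _ (contMDiffWithinAt_uncoord he hx)
  · intro h
    have h1 := ContMDiffWithinAt.comp (s := univ) x h.contMDiffWithinAt
      (contMDiffAt_coord he hx).contMDiffWithinAt fun y _ => coord_mem e y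
    rw [contMDiffWithinAt_univ] at h1
    refine h1.congr_of_eventuallyEq ?_
    filter_upwards [e.open_source.mem_nhds hx] with y hy
    simp [uncoord_coord hy]

theorem mfderiv_eq_fderivWithin {F₁ : Type*} [NormedAddCommGroup F₁] [NormedSpace ℝ F₁]
    (he : e ∈ IsManifold.maximalAtlas (cornerModel m) ∞ X) (hx : x ∈ e.source) {f : X → F₁}
    (hf : MDifferentiableAt (cornerModel m) 𝓘(ℝ, F₁) f x) (v : TangentSpace (cornerModel m) x) :
    mfderiv (cornerModel m) 𝓘(ℝ, F₁) f x v =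
      fderivWithin ℝ (f ∘ uncoord e) (quadrant m) (coord e x) (dcoord e x v) := by
  obtain ⟨D, hD, hDv⟩ := hasFDerivWithinAt_comp_uncoord he hx hf
  rw [hDv, hD.fderivWithin (uniqueDiffOn_quadrant m _ (coord_mem e x))]

/-- Smoothness of a vector field can be tested in one chart. -/
theorem contMDiffAt_dcoord_of_chart (he : e ∈ IsManifold.maximalAtlas (cornerModel m) ∞ X)
    (hx : x ∈ e.source) (he' : e' ∈ IsManifold.maximalAtlas (cornerModel m) ∞ X)
    (hx' : x ∈ e'.source) {V : ∀ x : X, TangentSpace (cornerModel m) x}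
    (hV : ContMDiffAt (cornerModel m) 𝓘(ℝ, EuclideanSpace ℝ (Fin m)) ∞
      (fun y => dcoord e y (V y)) x) :
    ContMDiffAt (cornerModel m) 𝓘(ℝ, EuclideanSpace ℝ (Fin m)) ∞
      (fun y => dcoord e' y (V y)) x := by
  have h1 := (contMDiffAt_iff_comp_uncoord he hx).1 (contMDiffAt_coord he' hx')
  have h2 := h1.fderivWithin_right (m := ∞) (uniqueDiffOn_quadrant m) (by simp) (coord_mem e x)
  have h3 := ContMDiffWithinAt.comp (s := univ) x h2.contMDiffWithinAt
    (contMDiffAt_coord he hx).contMDiffWithinAt fun y _ => coord_mem e y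
  rw [contMDiffWithinAt_univ] at h3
  refine (h3.clm_apply hV).congr_of_eventuallyEq ?_
  filter_upwards [e.open_source.mem_nhds hx, e'.open_source.mem_nhds hx'] with y hy hy'
  exact mfderiv_eq_fderivWithin he hy
    ((contMDiffAt_coord he' hy').mdifferentiableAt (by simp)) (V y)

/-- The trivialization of the tangent bundle at x is the differential of the chart at x. This
translates between smooth sections, for which partitions of unity are available, and
`IsSmoothField`. -/
theorem contMDiffAt_section_iff [IsManifold (cornerModel m) ∞ X]
    {V : ∀ x : X, TangentSpace (cornerModel m) x} :
    ContMDiffAt (cornerModel m) ((cornerModel m).prod 𝓘(ℝ, EuclideanSpace ℝ (Fin m))) ∞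
      (fun y => Bundle.TotalSpace.mk' (EuclideanSpace ℝ (Fin m)) y (V y)) x ↔
    ContMDiffAt (cornerModel m) 𝓘(ℝ, EuclideanSpace ℝ (Fin m)) ∞
      (fun y => dcoord (chartAt (EuclideanQuadrant m) x) y (V y)) x := by
  rw [Bundle.contMDiffAt_section]
  refine Filter.EventuallyEq.contMDiffAt_iff ?_
  filter_upwards [(chartAt (EuclideanQuadrant m) x).open_source.mem_nhds (mem_chart_source _ x)]
    with y hy
  have h1 := TangentBundle.continuousLinearMapAt_trivializationAt (I := cornerModel m) hy
  have h2 : y ∈ (trivializationAt (EuclideanSpace ℝ (Fin m))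
    (TangentSpace (cornerModel m) : X → Type _) x).baseSet := by simpa using hy
  have h3 := congrArg (fun L => L (V y)) h1
  simp only [Bundle.Trivialization.continuousLinearMapAt_apply,
    Bundle.Trivialization.linearMapAt_apply, h2, if_true] at h3
  exact h3

/-- The differential of a function with values in a vector space. -/
noncomputable def differential (m : ℕ) {X : Type*} [TopologicalSpace X]
    [ChartedSpace (EuclideanQuadrant m) X] {F₁ : Type*} [NormedAddCommGroup F₁] [NormedSpace ℝ F₁]
    (f : X → F₁) (x : X) : TangentSpace (cornerModel m) x →L[ℝ] F₁ :=
  mfderiv (cornerModel m) 𝓘(ℝ, F₁) f x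

/-- A vector at a point is tangent to all faces off `F`, and points into the manifold on `F`. -/
def PointsInto (m : ℕ) {X : Type*} [TopologicalSpace X] [ChartedSpace (EuclideanQuadrant m) X]
    (F : Set X) (q : X) (v : TangentSpace (cornerModel m) q) : Prop :=
  (q ∉ F → IsFaceTangent m v) ∧ (q ∈ F → ∀ ρ : X → ℝ, ContMDiffAt (cornerModel m) 𝓘(ℝ, ℝ) ∞ ρ q →
    (∀ᶠ u in 𝓝 q, 0 ≤ ρ u) → (∀ᶠ u in 𝓝 q, u ∈ F → ρ u = 0) →
    differential m ρ q ≠ 0 → 0 < differential m ρ q v)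

/-- Convexity permits gluing by a partition of unity. -/
theorem convex_pointsInto (F : Set X) (q : X) : Convex ℝ {v | PointsInto m F q v} := by
  intro v hv w hw a b ha hb hab
  refine ⟨fun hq ρ h1 h2 h3 => ?_, fun hq ρ h1 h2 h3 h4 => ?_⟩
  · rw [map_add, map_smul, map_smul, hv.1 hq ρ h1 h2 h3, hw.1 hq ρ h1 h2 h3]
    simp
  · have h5 : 0 < differential m ρ q v := hv.2 hq ρ h1 h2 h3 h4
    have h6 : 0 < differential m ρ q w := hw.2 hq ρ h1 h2 h3 h4
    rw [map_add, map_smul, map_smul, smul_eq_mul, smul_eq_mul]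
    rcases ha.eq_or_lt with h | h
    · have : b = 1 := by linarith
      rw [← h, this, zero_mul, zero_add, one_mul]
      exact h6
    · have := mul_pos h h5
      have := mul_nonneg hb h6.le
      linarith

/-- A function that vanishes on a face has no derivative along the face. -/
theorem deriv_single_eq_zero {f : EuclideanSpace ℝ (Fin m) → ℝ}
    {D : EuclideanSpace ℝ (Fin m) →L[ℝ] ℝ} {z : EuclideanSpace ℝ (Fin m)} (hz : z ∈ quadrant m)
    (hf : HasFDerivWithinAt f D (quadrant m) z) {i k : Fin m} (hi : z i = 0) (hk : k ≠ i)
    (h0 : ∀ᶠ y in 𝓝[quadrant m] z, y i = 0 → f y = 0) :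
    D (EuclideanSpace.single k 1) = 0 := by
  have hw : ∀ r, z r = 0 → 0 ≤ (EuclideanSpace.single k (1 : ℝ)) r := fun r _ => by
    by_cases h : r = k
    · simp [h]
    · simp [h]
  have h1 := hasDerivWithinAt_line hz hf hw
  have h2 : ∀ᶠ t in 𝓝[≥] (0 : ℝ), f (z + t • EuclideanSpace.single k 1) = 0 := by
    have ht : Tendsto (fun t : ℝ => z + t • EuclideanSpace.single k (1 : ℝ)) (𝓝[≥] 0)
        (𝓝[quadrant m] z) := by
      refine tendsto_nhdsWithin_iff.2 ⟨?_, eventually_add_smul_mem_quadrant hz hw⟩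
      have hc : Continuous fun t : ℝ => z + t • EuclideanSpace.single k (1 : ℝ) := by
        fun_prop
      exact (hc.tendsto' 0 _ (by simp)).mono_left nhdsWithin_le_nhds
    filter_upwards [ht.eventually h0] with t h3
    exact h3 (by simp [hi, hk.symm])
  have h3 : HasDerivWithinAt (fun t : ℝ => f (z + t • EuclideanSpace.single k 1)) 0 (Ici 0) 0 :=
    (hasDerivWithinAt_const (0 : ℝ) (Ici 0) (0 : ℝ)).congr_of_eventuallyEq h2
      (by simpa using h2.self_of_nhdsWithin (by simp))
  exact (uniqueDiffOn_Ici (0 : ℝ) 0 (by simp)).eq_deriv _ h1 h3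

variable [IsManifold (cornerModel m) ∞ X]

/-- A compact manifold with corners carries a vector field that points into the manifold along a
given face set and is tangent to the boundary elsewhere. -/
theorem exists_pointsInto [CompactSpace X] [T2Space X] {F : Set X} (hF : IsFaceSet m F) :
    ∃ V : ∀ x : X, TangentSpace (cornerModel m) x, IsSmoothField m V ∧ ∀ x, PointsInto m F x (V x) := by
  have hloc : ∀ p : X, ∃ U ∈ 𝓝 p, ∃ s : ∀ y : X, TangentSpace (cornerModel m) y,
      ContMDiffOn (cornerModel m) ((cornerModel m).prod 𝓘(ℝ, EuclideanSpace ℝ (Fin m))) ∞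
        (fun y => Bundle.TotalSpace.mk' (EuclideanSpace ℝ (Fin m)) y (s y)) U ∧
      ∀ y ∈ U, PointsInto m F y (s y) := by
    intro p
    by_cases hp : p ∈ F
    · obtain ⟨e, he, hpe, i, hi, hFi⟩ := hF.exists_chart p hp
      obtain ⟨W, hWp, hW, hpW⟩ := mem_nhds_iff.1 hFi
      classical
      -- The i-th coordinate field near p. It changes only the coordinate that cuts out F, so it is
      -- tangent to the boundary off F.
      set v : ∀ y : X, TangentSpace (cornerModel m) y := fun y =>
        if hy : y ∈ e.source then ((bijective_dcoord he hy).2 (EuclideanSpace.single i 1)).choose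
        else 0 with hv
      have hv1 : ∀ y ∈ e.source, dcoord e y (v y) = EuclideanSpace.single i 1 := fun y hy => by
        simp only [hv, hy, dif_pos]
        exact ((bijective_dcoord he hy).2 (EuclideanSpace.single i 1)).choose_spec
      refine ⟨W ∩ e.source, (hW.inter e.open_source).mem_nhds ⟨hpW, hpe⟩, v, fun y hy => ?_,
        fun y hy => ⟨fun hyF => ?_, fun hyF ρ h1 h2 h3 h4 => ?_⟩⟩
      · refine ContMDiffAt.contMDiffWithinAt (contMDiffAt_section_iff.2 ?_)
        refine contMDiffAt_dcoord_of_chart he hy.2 (IsManifold.chart_mem_maximalAtlas y)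
          (mem_chart_source _ y) ?_
        refine (contMDiffAt_const (c := EuclideanSpace.single i (1 : ℝ))).congr_of_eventuallyEq ?_
        filter_upwards [e.open_source.mem_nhds hy.2] with u hu using hv1 u hu
      · rw [isFaceTangent_iff he hy.2, hv1 y hy.2]
        intro k hk
        have : k ≠ i := fun h => hyF ((hWp hy.1).2 (h ▸ hk))
        simp [this]
      · obtain ⟨D, hD, hDv⟩ :=
          hasFDerivWithinAt_comp_uncoord he hy.2 (h1.mdifferentiableAt (by simp))
        have hyi : coord e y i = 0 := (hWp hy.1).1 hyF
        have hDv' : ∀ w, differential m ρ y w = D (dcoord e y w) := hDv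
        rw [hDv', hv1 y hy.2]
        -- As ρ vanishes on F, its differential in coordinates is a multiple of the i-th coordinate
        -- form. The multiple is nonnegative because ρ is, and nonzero because the differential is.
        have h5 : ∀ k, k ≠ i → D (EuclideanSpace.single k 1) = 0 := fun k hk => by
          refine deriv_single_eq_zero (coord_mem e y) hD hyi hk ?_
          have h6 := eventually_comp_uncoord hy.2 (h3.and (hW.mem_nhds hy.1))
          filter_upwards [h6, self_mem_nhdsWithin,
            nhdsWithin_le_nhds (eventually_symm_mem_target hy.2)] with z hz hzq hzt hzi
          exact hz.1 ((hWp hz.2).2 (by rw [coord_uncoord hzq hzt]; exact hzi))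
        have h6 : 0 ≤ D (EuclideanSpace.single i 1) := by
          refine deriv_nonneg_of_nonneg (coord_mem e y) hD (fun r _ => ?_)
            (eventually_comp_uncoord hy.2 h2) ?_
          · by_cases h : r = i
            · simp [h]
            · simp [h]
          · simp [uncoord_coord hy.2, h3.self_of_nhds hyF]
        refine lt_of_le_of_ne h6 fun h7 => h4 ?_
        have hD0 : D = 0 := by
          refine ContinuousLinearMap.coe_injective
            ((EuclideanSpace.basisFun (Fin m) ℝ).toBasis.ext fun k => ?_)
          simp only [OrthonormalBasis.coe_toBasis, EuclideanSpace.basisFun_apply]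
          by_cases hk : k = i
          · rw [hk]; exact h7.symm
          · exact h5 k hk
        ext w
        rw [hDv', hD0]
        rfl
    · refine ⟨Fᶜ, hF.isClosed.isOpen_compl.mem_nhds hp, fun _ => 0, fun y hy => ?_,
        fun y hy => ⟨fun _ ρ _ _ _ => map_zero _, fun h => absurd h hy⟩⟩
      refine ContMDiffAt.contMDiffWithinAt (contMDiffAt_section_iff.2 ?_)
      simp only [map_zero]
      exact contMDiffAt_const
  obtain ⟨s, hs⟩ := exists_contMDiffSection_forall_mem_convex_of_local (cornerModel m) (n := ⊤)
    (F_fiber := EuclideanSpace ℝ (Fin m)) (TangentSpace (cornerModel m) : X → Type _)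
    (fun q => {v | PointsInto m F q v}) (fun q => convex_pointsInto F q) hloc
  refine ⟨s, fun e he x hx => ?_, hs⟩
  exact contMDiffAt_dcoord_of_chart (IsManifold.chart_mem_maximalAtlas x) (mem_chart_source _ x)
    he hx (contMDiffAt_section_iff.1 (s.contMDiff x))

end Fields

/-! ### Averaging a vector field over a compact group -/

section Averaging

variable {m : ℕ} {X : Type*} [TopologicalSpace X] [ChartedSpace (EuclideanQuadrant m) X]

theorem differential_comp {F₁ : Type*} [NormedAddCommGroup F₁] [NormedSpace ℝ F₁] {ρ : X → F₁}
    {f : X → X} {x : X} (hρ : MDifferentiableAt (cornerModel m) 𝓘(ℝ, F₁) ρ (f x))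
    (hf : MDifferentiableAt (cornerModel m) (cornerModel m) f x)
    (v : TangentSpace (cornerModel m) x) :
    differential m (ρ ∘ f) x v =
      differential m ρ (f x) (mfderiv (cornerModel m) (cornerModel m) f x v) := by
  rw [differential, mfderiv_comp x hρ hf]
  rfl

variable {K : Type*} [Group K] [MulAction K X]

/-- The push-forward of a vector field by a group element. -/
noncomputable def pushField (k : K) (V : ∀ x : X, TangentSpace (cornerModel m) x) (x : X) :
    EuclideanSpace ℝ (Fin m) :=
  mfderiv (cornerModel m) (cornerModel m) (fun y => k • y) (k⁻¹ • x) (V (k⁻¹ • x))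

theorem differential_pushField {F₁ : Type*} [NormedAddCommGroup F₁] [NormedSpace ℝ F₁] {ρ : X → F₁}
    (k : K) (V : ∀ x : X, TangentSpace (cornerModel m) x) {x : X}
    (hk : MDifferentiableAt (cornerModel m) (cornerModel m) (fun y : X => k • y) (k⁻¹ • x))
    (hρ : MDifferentiableAt (cornerModel m) 𝓘(ℝ, F₁) ρ x) :
    differential m ρ x (pushField k V x) =
      differential m (fun y => ρ (k • y)) (k⁻¹ • x) (V (k⁻¹ • x)) := by
  -- The push-forward lives in the tangent space at k • k⁻¹ • x, which is the point x only
  -- propositionally; with independent base points the equation can be eliminated.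
  have key : ∀ (y : X) (x : X) (w : TangentSpace (cornerModel m) y), k • y = x →
      MDifferentiableAt (cornerModel m) (cornerModel m) (fun y : X => k • y) y →
      MDifferentiableAt (cornerModel m) 𝓘(ℝ, F₁) ρ x →
      differential m ρ x (show EuclideanSpace ℝ (Fin m) from
        mfderiv (cornerModel m) (cornerModel m) (fun y => k • y) y w) =
      differential m (fun y => ρ (k • y)) y w := by
    rintro y x w rfl hk hρ
    exact (differential_comp hρ hk w).symm
  exact key _ _ _ (smul_inv_smul k x) hk hρ

/-- The derivative of a function along a vector field. -/
noncomputable def derivAlong {F₁ : Type*} [NormedAddCommGroup F₁] [NormedSpace ℝ F₁]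
    (V : ∀ x : X, TangentSpace (cornerModel m) x) (ρ : X → F₁) (x : X) : F₁ :=
  differential m ρ x (V x)

/-- The action of `Γ × G` is smooth, where `Γ` is a discrete group and `G` a Lie group. -/
def IsSmoothAction (m : ℕ) (E Γ G X : Type*) [NormedAddCommGroup E] [NormedSpace ℝ E] [Group Γ]
    [Group G] [TopologicalSpace G] [ChartedSpace E G] [TopologicalSpace X]
    [ChartedSpace (EuclideanQuadrant m) X] [MulAction (Γ × G) X] : Prop :=
  ∀ γ : Γ, ContMDiff (𝓘(ℝ, E).prod (cornerModel m)) (cornerModel m) ∞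
    (fun p : G × X => ((γ, p.1) : Γ × G) • p.2)

variable {E Γ G : Type*} [NormedAddCommGroup E] [NormedSpace ℝ E] [Group Γ] [Group G]
  [TopologicalSpace G] [ChartedSpace E G] [MulAction (Γ × G) X]

theorem IsSmoothAction.contMDiff (h : IsSmoothAction m E Γ G X) (k : Γ × G) :
    ContMDiff (cornerModel m) (cornerModel m) ∞ (fun x : X => k • x) :=
  (h k.1).comp (contMDiff_const.prodMk contMDiff_id)

theorem IsSmoothAction.mdifferentiableAt (h : IsSmoothAction m E Γ G X) (k : Γ × G) (x : X) :
    MDifferentiableAt (cornerModel m) (cornerModel m) (fun x : X => k • x) x :=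
  (h.contMDiff k x).mdifferentiableAt (by simp)

variable [LieGroup 𝓘(ℝ, E) ∞ G]

theorem IsSmoothAction.contMDiff_inv (h : IsSmoothAction m E Γ G X) (γ : Γ) :
    ContMDiff (𝓘(ℝ, E).prod (cornerModel m)) (cornerModel m) ∞
      (fun p : G × X => ((γ, p.1) : Γ × G)⁻¹ • p.2) :=
  (h γ⁻¹).comp (((_root_.contMDiff_inv 𝓘(ℝ, E) ∞).comp contMDiff_fst).prodMk contMDiff_snd)

/-- The coordinates of a transported vector field depend smoothly on the group element and the
point. -/
theorem IsSmoothAction.contMDiffAt_derivAlong (h : IsSmoothAction m E Γ G X)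
    {V : ∀ x : X, TangentSpace (cornerModel m) x} (hV : IsSmoothField m V)
    [IsManifold (cornerModel m) ∞ X]
    {e : OpenPartialHomeomorph X (EuclideanQuadrant m)}
    (he : e ∈ IsManifold.maximalAtlas (cornerModel m) ∞ X) (γ : Γ) (g₀ : G) {x₀ : X}
    (hx₀ : x₀ ∈ e.source) :
    ContMDiffAt (𝓘(ℝ, E).prod (cornerModel m)) 𝓘(ℝ, EuclideanSpace ℝ (Fin m)) ∞
      (fun p : G × X => derivAlong V (fun y => coord e (((γ, p.1) : Γ × G) • y))
        (((γ, p.1) : Γ × G)⁻¹ • p.2)) (g₀, x₀) := by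
  have hG : IsManifold 𝓘(ℝ, E) ∞ G := inferInstance
  set J : G × X → X := fun p => ((γ, p.1) : Γ × G)⁻¹ • p.2 with hJ
  have hJs := h.contMDiff_inv γ
  set y₀ := J (g₀, x₀) with hy₀
  set e₁ := chartAt (EuclideanQuadrant m) y₀
  have he₁ : e₁ ∈ IsManifold.maximalAtlas (cornerModel m) ∞ X := IsManifold.chart_mem_maximalAtlas y₀
  have hy₁ : y₀ ∈ e₁.source := mem_chart_source _ y₀
  have hback : ((γ, g₀) : Γ × G) • y₀ = x₀ := smul_inv_smul _ _
  -- The action in coordinates. The coordinates of the transported field are the derivative of Φ in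
  -- the second variable, applied to the coordinates of V at the inverse image of the point.
  set Φ : G → EuclideanSpace ℝ (Fin m) → EuclideanSpace ℝ (Fin m) :=
    fun g z => coord e (((γ, g) : Γ × G) • uncoord e₁ z) with hΦ
  have h1 : ContMDiffWithinAt (𝓘(ℝ, E).prod 𝓘(ℝ, EuclideanSpace ℝ (Fin m)))
      𝓘(ℝ, EuclideanSpace ℝ (Fin m)) ∞ (uncurry Φ) (univ ×ˢ quadrant m) (g₀, coord e₁ y₀) := by
    have h2 : ContMDiffWithinAt (𝓘(ℝ, E).prod 𝓘(ℝ, EuclideanSpace ℝ (Fin m)))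
        (𝓘(ℝ, E).prod (cornerModel m)) ∞
        (fun p : G × EuclideanSpace ℝ (Fin m) => (p.1, uncoord e₁ p.2)) (univ ×ˢ quadrant m)
        (g₀, coord e₁ y₀) := by
      refine contMDiffWithinAt_fst.prodMk ?_
      exact ContMDiffWithinAt.comp (t := quadrant m) (g := uncoord e₁)
        (f := fun p : G × EuclideanSpace ℝ (Fin m) => p.2) (g₀, coord e₁ y₀)
        (contMDiffWithinAt_uncoord he₁ hy₁) contMDiffWithinAt_snd fun p hp => hp.2
    have h3 := ContMDiffAt.comp_contMDiffWithinAt (g₀, coord e₁ y₀) (h γ _) h2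
    refine ContMDiffAt.comp_contMDiffWithinAt (g := coord e) (g₀, coord e₁ y₀) ?_ h3
    refine contMDiffAt_coord he ?_
    change ((γ, g₀) : Γ × G) • uncoord e₁ (coord e₁ y₀) ∈ e.source
    rw [uncoord_coord hy₁, hback]
    exact hx₀
  have h2 := contMDiffWithinAt_fderivWithin (uniqueDiffOn_quadrant m) (coord_mem e₁ y₀) h1
  have h3 : ContMDiffAt (𝓘(ℝ, E).prod (cornerModel m))
      (𝓘(ℝ, E).prod 𝓘(ℝ, EuclideanSpace ℝ (Fin m))) ∞
      (fun p : G × X => (p.1, coord e₁ (J p))) (g₀, x₀) := by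
    refine contMDiffAt_fst.prodMk ?_
    exact ContMDiffAt.comp (g := coord e₁) (f := J) (g₀, x₀) (contMDiffAt_coord he₁ hy₁) (hJs _)
  have h4 := ContMDiffWithinAt.comp (s := univ) (t := univ ×ˢ quadrant m) (g₀, x₀) h2 h3.contMDiffWithinAt
    fun p _ => ⟨mem_univ _, coord_mem e₁ _⟩
  rw [contMDiffWithinAt_univ] at h4
  have h5 : ContMDiffAt (𝓘(ℝ, E).prod (cornerModel m)) 𝓘(ℝ, EuclideanSpace ℝ (Fin m)) ∞
      (fun p : G × X => dcoord e₁ (J p) (V (J p))) (g₀, x₀) :=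
    ContMDiffAt.comp (g₀, x₀) (hV e₁ he₁ y₀ hy₁) (hJs _)
  refine (h4.clm_apply h5).congr_of_eventuallyEq ?_
  have h6 : ∀ᶠ p in 𝓝 (g₀, x₀), J p ∈ e₁.source :=
    (hJs (g₀, x₀)).continuousAt.eventually (e₁.open_source.mem_nhds hy₁)
  have h7 : ∀ᶠ p : G × X in 𝓝 (g₀, x₀), p.2 ∈ e.source :=
    continuous_snd.continuousAt.eventually (e.open_source.mem_nhds hx₀)
  filter_upwards [h6, h7] with p hp hp'
  refine mfderiv_eq_fderivWithin he₁ hp ?_ _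
  have h8 : ((γ, p.1) : Γ × G) • J p = p.2 := smul_inv_smul _ _
  refine MDifferentiableAt.comp (J p) (g := coord e) ?_ (h.mdifferentiableAt _ _)
  rw [h8]
  exact (contMDiffAt_coord he hp').mdifferentiableAt (by simp)

section Average

variable [IsManifold (cornerModel m) ∞ X]

/-- The invertible map `dcoord` at the fixed point x turns the push-forward into the expression of
`IsSmoothAction.contMDiffAt_derivAlong`. -/
theorem IsSmoothAction.continuous_pushField (h : IsSmoothAction m E Γ G X)
    {V : ∀ x : X, TangentSpace (cornerModel m) x} (hV : IsSmoothField m V) (γ : Γ) (x : X) :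
    Continuous fun g : G => pushField ((γ, g) : Γ × G) V x := by
  have he := IsManifold.chart_mem_maximalAtlas (I := cornerModel m) (n := ∞) x
  have hx := mem_chart_source (EuclideanQuadrant m) x
  let A : EuclideanSpace ℝ (Fin m) →L[ℝ] EuclideanSpace ℝ (Fin m) :=
    dcoord (chartAt (EuclideanQuadrant m) x) x
  have hA : Bijective A := bijective_dcoord he hx
  let A' := (LinearEquiv.ofBijective A.toLinearMap hA).toContinuousLinearEquiv
  have h1 : Continuous fun g : G => A' (pushField ((γ, g) : Γ × G) V x) := by
    have h2 : Continuous fun g : G => derivAlong V (fun y => coord (chartAt (EuclideanQuadrant m) x)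
        (((γ, g) : Γ × G) • y)) (((γ, g) : Γ × G)⁻¹ • x) := by
      refine continuous_iff_continuousAt.2 fun g₀ => ?_
      have h3 : ContinuousAt (fun g : G => (g, x)) g₀ := by fun_prop
      exact ContinuousAt.comp (f := fun g : G => (g, x))
        (h.contMDiffAt_derivAlong hV he γ g₀ hx).continuousAt h3
    refine h2.congr fun g => ?_
    exact (differential_pushField ((γ, g) : Γ × G) V (h.mdifferentiableAt _ _)
      ((contMDiffAt_coord he hx).mdifferentiableAt (by simp))).symm
  exact (A'.symm.continuous.comp h1).congr fun g => A'.symm_apply_apply _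

variable [Fintype Γ] [CompactSpace G] [MeasurableSpace G] [BorelSpace G] (μ : Measure G)
  [IsFiniteMeasure μ]

/-- The average of a vector field. -/
noncomputable def averageField (Γ : Type*) [Group Γ] [Fintype Γ] [MulAction (Γ × G) X]
    (V : ∀ x : X, TangentSpace (cornerModel m) x) (x : X) :
    TangentSpace (cornerModel m) x :=
  (∑ γ : Γ, ∫ g : G, pushField ((γ, g) : Γ × G) V x ∂μ : EuclideanSpace ℝ (Fin m))

/-- The properties of the average are tested by differentiating functions at x. This is a continuous
linear operation on vectors, so it commutes with sum and integral. -/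
theorem IsSmoothAction.derivAlong_averageField (h : IsSmoothAction m E Γ G X)
    {V : ∀ x : X, TangentSpace (cornerModel m) x} (hV : IsSmoothField m V)
    {F₁ : Type*} [NormedAddCommGroup F₁] [NormedSpace ℝ F₁] [CompleteSpace F₁] {ρ : X → F₁} {x : X}
    (hρ : ContMDiffAt (cornerModel m) 𝓘(ℝ, F₁) ∞ ρ x) :
    derivAlong (averageField μ Γ V) ρ x = ∑ γ : Γ, ∫ g : G,
      derivAlong V (fun y => ρ (((γ, g) : Γ × G) • y)) (((γ, g) : Γ × G)⁻¹ • x) ∂μ := by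
  let L : EuclideanSpace ℝ (Fin m) →L[ℝ] F₁ := differential m ρ x
  have h1 : derivAlong (averageField μ Γ V) ρ x =
      L (∑ γ : Γ, ∫ g : G, pushField ((γ, g) : Γ × G) V x ∂μ) := rfl
  rw [h1, map_sum]
  refine Finset.sum_congr rfl fun γ _ => ?_
  rw [← L.integral_comp_comm ((h.continuous_pushField hV γ x).integrable_of_compactSpace μ)]
  refine integral_congr_ae (Eventually.of_forall fun g => ?_)
  exact differential_pushField ((γ, g) : Γ × G) V (h.mdifferentiableAt _ _)
    (hρ.mdifferentiableAt (by simp))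

/-- In coordinates the average is a finite sum of integrals over the compact manifold G of jointly
smooth families. -/
theorem IsSmoothAction.isSmoothField_averageField (h : IsSmoothAction m E Γ G X)
    {V : ∀ x : X, TangentSpace (cornerModel m) x} (hV : IsSmoothField m V) :
    IsSmoothField m (averageField μ Γ V) := by
  intro e he x hx
  obtain ⟨δ, hδ, hball⟩ := Metric.eventually_nhds_iff_ball.1 (eventually_symm_mem_target hx)
  have hsrc : ∀ z ∈ Metric.ball (coord e x) δ, uncoord e z ∈ e.source := fun z hz =>
    e.map_target (hball z hz)
  set t := quadrant m ∩ Metric.ball (coord e x) δ with ht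
  have hconv : Convex ℝ t := (convex_quadrant m).inter (convex_ball _ _)
  have huniq : UniqueDiffOn ℝ t := (uniqueDiffOn_quadrant m).inter Metric.isOpen_ball
  rw [contMDiffAt_iff_comp_uncoord he hx]
  have h1 : ∀ γ : Γ, ContDiffOn ℝ ∞ (fun z => ∫ g : G, derivAlong V
      (fun y => coord e (((γ, g) : Γ × G) • y)) (((γ, g) : Γ × G)⁻¹ • uncoord e z) ∂μ) t := by
    intro γ
    refine contDiffOn_integral (E' := E) μ hconv huniq ?_
    rintro ⟨g, z⟩ ⟨-, hz⟩
    have hz' : coord e (uncoord e z) = z := coord_uncoord hz.1 (hball z hz.2)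
    refine ContMDiffAt.comp_contMDiffWithinAt (g, z)
      (h.contMDiffAt_derivAlong hV he γ g (hsrc z hz.2))
      (f := fun p : G × EuclideanSpace ℝ (Fin m) => (p.1, uncoord e p.2)) ?_
    refine contMDiffWithinAt_fst.prodMk ?_
    have h3 := contMDiffWithinAt_uncoord he (hsrc z hz.2)
    rw [hz'] at h3
    exact ContMDiffWithinAt.comp (t := quadrant m) (g := uncoord e)
      (f := fun p : G × EuclideanSpace ℝ (Fin m) => p.2) (g, z) h3 contMDiffWithinAt_snd
      fun p hp => hp.2.1
  have h2 := ContDiffOn.sum (s := Finset.univ) fun γ _ => h1 γ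
  have h3 := (h2.congr (f₁ := (fun y => dcoord e y (averageField μ Γ V y)) ∘ uncoord e)
    fun z hz => h.derivAlong_averageField μ hV (contMDiffAt_coord he (hsrc z hz.2))) (coord e x)
    ⟨coord_mem e x, Metric.mem_ball_self hδ⟩
  exact h3.mono_of_mem_nhdsWithin (inter_mem_nhdsWithin _ (Metric.ball_mem_nhds _ hδ))

/-- Since F is invariant, test functions at x pull back to test functions at k⁻¹ • x. Vanishing and
strict positivity survive sums and integrals against a positive measure, so the average need not be
normalized. -/
theorem IsSmoothAction.pointsInto_averageField [μ.IsOpenPosMeasure] [Nonempty G]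
    (h : IsSmoothAction m E Γ G X)
    {V : ∀ x : X, TangentSpace (cornerModel m) x} (hV : IsSmoothField m V) {F : Set X}
    (hF : ∀ (k : Γ × G), ∀ x ∈ F, k • x ∈ F) (hVF : ∀ x, PointsInto m F x (V x)) (x : X) :
    PointsInto m F x (averageField μ Γ V x) := by
  have hnear : ∀ (k : Γ × G) {P : X → Prop}, (∀ᶠ u in 𝓝 x, P u) → ∀ᶠ u in 𝓝 (k⁻¹ • x), P (k • u) := by
    intro k P hP
    refine (h.contMDiff k).continuous.continuousAt.eventually ?_
    change ∀ᶠ y in 𝓝 (k • k⁻¹ • x), P y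
    rwa [smul_inv_smul]
  have hsm : ∀ (k : Γ × G) {ρ : X → ℝ}, ContMDiffAt (cornerModel m) 𝓘(ℝ, ℝ) ∞ ρ x →
      ContMDiffAt (cornerModel m) 𝓘(ℝ, ℝ) ∞ (fun y => ρ (k • y)) (k⁻¹ • x) := by
    intro k ρ hρ
    refine ContMDiffAt.comp (k⁻¹ • x) ?_ (h.contMDiff k _)
    rwa [smul_inv_smul]
  refine ⟨fun hx ρ h1 h2 h3 => ?_, fun hx ρ h1 h2 h3 h4 => ?_⟩
  · have h4 := h.derivAlong_averageField μ hV h1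
    change derivAlong (averageField μ Γ V) ρ x = 0
    rw [h4]
    refine Finset.sum_eq_zero fun γ _ => ?_
    refine integral_eq_zero_of_ae (Eventually.of_forall fun g => ?_)
    have hx' : ((γ, g) : Γ × G)⁻¹ • x ∉ F := fun hc => hx (by
      have := hF (γ, g) _ hc
      rwa [smul_inv_smul] at this)
    exact (hVF _).1 hx' _ (hsm _ h1) (hnear _ h2) (by rwa [smul_inv_smul])
  · have h5 := h.derivAlong_averageField μ hV h1
    refine lt_of_lt_of_eq (Finset.sum_pos (fun γ _ => ?_) ⟨1, Finset.mem_univ _⟩) h5.symm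
    have hpos : ∀ g : G, 0 < derivAlong V (fun y => ρ (((γ, g) : Γ × G) • y))
        (((γ, g) : Γ × G)⁻¹ • x) := by
      intro g
      refine (hVF _).2 (hF _ _ hx) _ (hsm _ h1) (hnear _ h2) ?_ fun h6 => h4 ?_
      · filter_upwards [hnear (γ, g) h3] with u hu huF using hu (hF _ _ huF)
      · ext v
        have h7 := differential_comp (ρ := fun y => ρ (((γ, g) : Γ × G) • y))
          (f := fun y => ((γ, g) : Γ × G)⁻¹ • y) (x := x)
          ((hsm (γ, g) h1).mdifferentiableAt (by simp)) (h.mdifferentiableAt _ _) v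
        rw [h6] at h7
        have h8 : ((fun y => ρ (((γ, g) : Γ × G) • y)) ∘ fun y => ((γ, g) : Γ × G)⁻¹ • y) = ρ := by
          ext y
          exact congrArg ρ (smul_inv_smul _ y)
        rw [h8] at h7
        exact h7
    have hcont : Continuous fun g : G => derivAlong V (fun y => ρ (((γ, g) : Γ × G) • y))
        (((γ, g) : Γ × G)⁻¹ • x) := by
      let L : EuclideanSpace ℝ (Fin m) →L[ℝ] ℝ := differential m ρ x
      exact (L.continuous.comp (h.continuous_pushField hV γ x)).congr fun g =>
        differential_pushField ((γ, g) : Γ × G) V (h.mdifferentiableAt _ _)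
          (h1.mdifferentiableAt (by simp))
    obtain ⟨g₁⟩ := ‹Nonempty G›
    exact hcont.integral_pos_of_hasCompactSupport_nonneg_nonzero
      (HasCompactSupport.of_compactSpace _) (fun g => (hpos g).le) (hpos g₁).ne'

/-- Translation by k amounts to a substitution in the sum over Γ and, by left invariance of μ, in
the integral over G. -/
theorem IsSmoothAction.mfderiv_averageField [μ.IsMulLeftInvariant] [MeasurableMul G]
    (h : IsSmoothAction m E Γ G X)
    {V : ∀ x : X, TangentSpace (cornerModel m) x} (hV : IsSmoothField m V) (k : Γ × G) (x : X) :
    mfderiv (cornerModel m) (cornerModel m) (fun y => k • y) x (averageField μ Γ V x) =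
      averageField μ Γ V (k • x) := by
  have he := IsManifold.chart_mem_maximalAtlas (I := cornerModel m) (n := ∞) (k • x)
  have hx := mem_chart_source (EuclideanQuadrant m) (k • x)
  set e := chartAt (EuclideanQuadrant m) (k • x)
  apply (bijective_dcoord he hx).1
  have h1 := contMDiffAt_coord he hx
  have h2 := differential_comp (h1.mdifferentiableAt (by simp)) (h.mdifferentiableAt k x)
    (averageField μ Γ V x)
  have h3 := h.derivAlong_averageField μ hV
    (h1.comp x (h.contMDiff k x) : ContMDiffAt _ _ ∞ (fun y => coord e (k • y)) x)
  have h4 := h.derivAlong_averageField μ hV h1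
  refine h2.symm.trans (h3.trans (Eq.trans ?_ h4.symm))
  refine Fintype.sum_equiv (Equiv.mulLeft k.1) _ _ fun γ => ?_
  refine Eq.trans ?_ (integral_mul_left_eq_self (fun g => derivAlong V
    (fun y => coord e (((k.1 * γ, g) : Γ × G) • y)) (((k.1 * γ, g) : Γ × G)⁻¹ • k • x)) k.2)
  refine integral_congr_ae (Eventually.of_forall fun g => ?_)
  have h5 : ((k.1 * γ, k.2 * g) : Γ × G) = k * (γ, g) := rfl
  have h6 : (k * (γ, g))⁻¹ • k • x = ((γ, g) : Γ × G)⁻¹ • x := by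
    rw [mul_inv_rev, mul_smul, inv_smul_smul]
  change derivAlong V (fun y => coord e (k • ((γ, g) : Γ × G) • y)) (((γ, g) : Γ × G)⁻¹ • x) =
    derivAlong V (fun y => coord e (((k.1 * γ, k.2 * g) : Γ × G) • y))
      (((k.1 * γ, k.2 * g) : Γ × G)⁻¹ • k • x)
  rw [h5, h6]
  simp only [mul_smul]

end Average

/-- A compact manifold with corners with an action of a compact group carries an invariant vector
field that points into the manifold along a given invariant face set. -/
theorem IsSmoothAction.exists_invariant_field [Finite Γ] [CompactSpace G] [T2Space G]
    [IsManifold (cornerModel m) ∞ X] [CompactSpace X] [T2Space X] (h : IsSmoothAction m E Γ G X)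
    {F : Set X} (hF : IsFaceSet m F) (hFk : ∀ (k : Γ × G), ∀ x ∈ F, k • x ∈ F) :
    ∃ V : ∀ x : X, TangentSpace (cornerModel m) x, IsSmoothField m V ∧
      (∀ x, PointsInto m F x (V x)) ∧ ∀ (k : Γ × G) (x : X),
        mfderiv (cornerModel m) (cornerModel m) (fun y => k • y) x (V x) = V (k • x) := by
  obtain ⟨V, hV, hVF⟩ := exists_pointsInto hF
  have := Fintype.ofFinite Γ
  have : IsTopologicalGroup G := topologicalGroup_of_lieGroup 𝓘(ℝ, E) ∞
  borelize G
  exact ⟨averageField Measure.haar Γ V, h.isSmoothField_averageField _ hV,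
    h.pointsInto_averageField _ hV hFk hVF, h.mfderiv_averageField _ hV⟩

end Averaging

/-! ### Charts in which the field is a coordinate field -/

section Straight

variable {m : ℕ} {X : Type*} [TopologicalSpace X]

/-- A transition between two charts is smooth if it is so in coordinates. -/
theorem contDiffOn_transition {c c' : OpenPartialHomeomorph X (EuclideanQuadrant m)}
    (h : ∀ x ∈ c.source, x ∈ c'.source →
      ContDiffWithinAt ℝ ∞ (coord c' ∘ uncoord c) (quadrant m) (coord c x)) :
    ContDiffOn ℝ ∞ (cornerModel m ∘ (c.symm.trans c') ∘ (cornerModel m).symm)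
      ((cornerModel m).symm ⁻¹' (c.symm.trans c').source ∩ range (cornerModel m)) := by
  rintro z ⟨hz, hzr⟩
  rw [range_cornerModel] at hzr ⊢
  rw [mem_preimage, OpenPartialHomeomorph.trans_source] at hz
  have h1 := h (uncoord c z) (c.map_target hz.1) hz.2
  rw [coord_uncoord hzr hz.1] at h1
  exact h1.mono inter_subset_right

variable [ChartedSpace (EuclideanQuadrant m) X]

/-- A chart with smooth coordinates and smooth inverse belongs to the maximal atlas. -/
theorem mem_maximalAtlas_of_coord [IsManifold (cornerModel m) ∞ X]
    {c : OpenPartialHomeomorph X (EuclideanQuadrant m)}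
    (h : ∀ x ∈ c.source,
      ContMDiffAt (cornerModel m) 𝓘(ℝ, EuclideanSpace ℝ (Fin m)) ∞ (coord c) x)
    (h' : ∀ x ∈ c.source, ContMDiffWithinAt 𝓘(ℝ, EuclideanSpace ℝ (Fin m)) (cornerModel m) ∞
      (uncoord c) (quadrant m) (coord c x)) :
    c ∈ IsManifold.maximalAtlas (cornerModel m) ∞ X := by
  have h1 : ∀ e ∈ atlas (EuclideanQuadrant m) X, ∀ x ∈ c.source, x ∈ e.source →
      ContDiffWithinAt ℝ ∞ (coord e ∘ uncoord c) (quadrant m) (coord c x) := by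
    intro e he x hx hxe
    have he' := IsManifold.subset_maximalAtlas (I := cornerModel m) (n := ∞) he
    rw [← contMDiffWithinAt_iff_contDiffWithinAt]
    refine ContMDiffAt.comp_contMDiffWithinAt (g := coord e) _ ?_ (h' x hx)
    rw [uncoord_coord hx]
    exact contMDiffAt_coord he' hxe
  have h2 : ∀ e ∈ atlas (EuclideanQuadrant m) X, ∀ x ∈ e.source, x ∈ c.source →
      ContDiffWithinAt ℝ ∞ (coord c ∘ uncoord e) (quadrant m) (coord e x) := by
    intro e he x hxe hx
    have he' := IsManifold.subset_maximalAtlas (I := cornerModel m) (n := ∞) he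
    exact (contMDiffAt_iff_comp_uncoord he' hxe).1 (h x hx)
  intro e he
  exact ⟨⟨contDiffOn_transition (h1 e he), contDiffOn_transition (h2 e he)⟩,
    ⟨contDiffOn_transition (h2 e he), contDiffOn_transition (h1 e he)⟩⟩

/-- The restriction to the quadrant of a local homeomorphism that preserves it. -/
noncomputable def quadrantRestr
    (ψ : OpenPartialHomeomorph (EuclideanSpace ℝ (Fin m)) (EuclideanSpace ℝ (Fin m)))
    (h : ∀ z ∈ ψ.source, ψ z ∈ quadrant m ↔ z ∈ quadrant m) :
    OpenPartialHomeomorph (EuclideanQuadrant m) (EuclideanQuadrant m) where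
  toFun y := (cornerModel m).symm (ψ y.val)
  invFun y := (cornerModel m).symm (ψ.symm y.val)
  source := Subtype.val ⁻¹' ψ.source
  target := Subtype.val ⁻¹' ψ.target
  map_source' y hy := by
    rw [mem_preimage, val_symm ((h _ hy).2 y.2)]
    exact ψ.map_source hy
  map_target' y hy := by
    have h1 : ψ.symm y.val ∈ quadrant m := by
      rw [← h _ (ψ.map_target hy), ψ.right_inv hy]; exact y.2
    rw [mem_preimage, val_symm h1]
    exact ψ.map_target hy
  left_inv' y hy := by
    rw [val_symm ((h _ hy).2 y.2), ψ.left_inv hy, symm_val]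
  right_inv' y hy := by
    have h1 : ψ.symm y.val ∈ quadrant m := by
      rw [← h _ (ψ.map_target hy), ψ.right_inv hy]; exact y.2
    rw [val_symm h1, ψ.right_inv hy, symm_val]
  open_source := ψ.open_source.preimage continuous_subtype_val
  open_target := ψ.open_target.preimage continuous_subtype_val
  continuousOn_toFun := (cornerModel m).continuous_symm.comp_continuousOn
    (ψ.continuousOn.comp continuous_subtype_val.continuousOn fun _ hy => hy)
  continuousOn_invFun := (cornerModel m).continuous_symm.comp_continuousOn
    (ψ.continuousOn_symm.comp continuous_subtype_val.continuousOn fun _ hy => hy)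

/-- A chart in which the vector field `V` is a coordinate field and the set `F` is the zero set of
the corresponding coordinate. -/
structure IsStraight (F : Set X) (V : ∀ x : X, TangentSpace (cornerModel m) x)
    (e : OpenPartialHomeomorph X (EuclideanQuadrant m)) (i : Fin m) : Prop where
  mem : e ∈ IsManifold.maximalAtlas (cornerModel m) ∞ X
  field : ∀ x ∈ e.source, dcoord e x (V x) = EuclideanSpace.single i 1
  face : ∀ x ∈ e.source, (x ∈ F ↔ coord e x i = 0)
  lt_one : ∀ x ∈ e.source, coord e x i < 1

variable {F : Set X}
  {V : ∀ x : X, TangentSpace (cornerModel m) x}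

/-- The straight chart is a given chart followed by the inverse of the flow box of V in that chart.
-/
theorem exists_isStraight [IsManifold (cornerModel m) ∞ X] (hF : IsFaceSet m F) (hV : IsSmoothField m V)
    (hVF : ∀ x, PointsInto m F x (V x)) {p : X} (hp : p ∈ F) :
    ∃ e i, p ∈ e.source ∧ IsStraight F V e i := by
  obtain ⟨e, he, hpe, i, hi, hFi⟩ := hF.exists_chart p hp
  set a := coord e p with ha
  obtain ⟨δ, hδ, hball⟩ := Metric.eventually_nhds_iff_ball.1
    ((eventually_symm_mem_target hpe).and ((tendsto_uncoord hpe).eventually hFi))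
  set N := Metric.ball a δ with hN
  have hco : ∀ z ∈ quadrant m ∩ N, coord e (uncoord e z) = z := fun z hz =>
    coord_uncoord hz.1 (hball z hz.2).1
  have hsrc : ∀ z ∈ N, uncoord e z ∈ e.source := fun z hz => e.map_target (hball z hz).1
  set v : EuclideanSpace ℝ (Fin m) → EuclideanSpace ℝ (Fin m) :=
    fun z => dcoord e (uncoord e z) (V (uncoord e z)) with hv
  have hvx : ∀ x ∈ e.source, v (coord e x) = dcoord e x (V x) := fun x hx =>
    congrArg (fun y => dcoord e y (V y)) (uncoord_coord hx)
  have hvs : ContDiffOn ℝ ∞ v (quadrant m ∩ N) := by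
    intro z hz
    have h1 := (contMDiffAt_iff_comp_uncoord he (hsrc z hz.2)).1 (hV e he _ (hsrc z hz.2))
    rw [hco z hz] at h1
    exact h1.mono inter_subset_left
  have htan : ∀ z ∈ quadrant m ∩ N, ∀ k ≠ i, z k = 0 → v z k = 0 := by
    have h1 : ∀ z ∈ quadrant m ∩ N, z i ≠ 0 → ∀ k, z k = 0 → v z k = 0 := by
      intro z hz hzi k hk
      have h2 : uncoord e z ∉ F := fun h => hzi (by
        have := (hball z hz.2).2.1 h
        rwa [hco z hz] at this)
      exact (isFaceTangent_iff he (hsrc z hz.2) _).1 ((hVF _).1 h2) k (by rwa [hco z hz])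
    intro z hz k hk hzk
    -- At points of F the condition `PointsInto` says nothing about the other faces. Tangency to
    -- them is the limit, along z + t e_i with t ↓ 0, of tangency off F.
    by_cases hzi : z i = 0
    · have hw : ∀ r, z r = 0 → 0 ≤ (EuclideanSpace.single i (1 : ℝ)) r := fun r _ => by
        by_cases h : r = i
        · simp [h]
        · simp [h]
      have ht : Tendsto (fun t : ℝ => z + t • EuclideanSpace.single i (1 : ℝ)) (𝓝[>] 0)
          (𝓝[quadrant m ∩ N] z) := by
        have hc : Continuous fun t : ℝ => z + t • EuclideanSpace.single i (1 : ℝ) := by fun_prop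
        have ht0 : Tendsto (fun t : ℝ => z + t • EuclideanSpace.single i (1 : ℝ)) (𝓝[>] 0) (𝓝 z) :=
          (hc.tendsto' 0 _ (by simp)).mono_left nhdsWithin_le_nhds
        refine tendsto_nhdsWithin_iff.2 ⟨ht0, ?_⟩
        filter_upwards [(eventually_add_smul_mem_quadrant hz.1 hw).filter_mono
          (nhdsWithin_mono _ Ioi_subset_Ici_self), ht0.eventually (Metric.isOpen_ball.mem_nhds hz.2)]
          with t h2 h3 using ⟨h2, h3⟩
      have h2 : Tendsto (fun t : ℝ => v (z + t • EuclideanSpace.single i (1 : ℝ)) k) (𝓝[>] 0)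
          (𝓝 (v z k)) :=
        ((EuclideanSpace.proj (𝕜 := ℝ) k).continuous.tendsto _).comp
          ((hvs.continuousOn z hz).tendsto.comp ht)
      have h3 : ∀ᶠ t in 𝓝[>] (0 : ℝ), v (z + t • EuclideanSpace.single i (1 : ℝ)) k = 0 := by
        filter_upwards [ht.eventually self_mem_nhdsWithin, self_mem_nhdsWithin] with t h4 h5
        refine h1 _ h4 ?_ k ?_
        · have : t ≠ 0 := (mem_Ioi.1 h5).ne'
          simpa [hzi] using this
        · simp [hzk, hk]
      exact tendsto_nhds_unique h2 (tendsto_const_nhds.congr' (h3.mono fun t ht => ht.symm))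
    · exact h1 z hz hzi k hzk
  have hpos : 0 < v a i := by
    have h1 := (hVF p).2 hp (fun y => coord e y i) (contMDiffAt_coord_apply he hpe i)
      (Eventually.of_forall fun y => coord_mem e y i) (hFi.mono fun u hu huF => hu.1 huF) ?_
    · have h2 : differential m (fun y => coord e y i) p (V p) = dcoord e p (V p) i :=
        mfderiv_coord_apply he hpe i (V p)
      rw [h2] at h1
      rw [ha, hvx p hpe]
      exact h1
    · obtain ⟨w, hw⟩ := (bijective_dcoord he hpe).2 (EuclideanSpace.single i 1)
      intro h
      have h2 : differential m (fun y => coord e y i) p w = dcoord e p w i :=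
        mfderiv_coord_apply he hpe i w
      rw [h, hw] at h2
      simp at h2
  obtain ⟨φ, hφa, hφaa, hφN, hφQ, hφF, hφs, hφs', hφv⟩ := exists_flowBox (coord_mem e p) hi
    (Metric.ball_mem_nhds a hδ) hvs htan hpos
  have hψQ : ∀ z ∈ φ.symm.source, φ.symm z ∈ quadrant m ↔ z ∈ quadrant m := fun z hz => by
    rw [← hφQ _ (φ.map_target hz), φ.right_inv hz]
  set c := e.trans (quadrantRestr φ.symm hψQ) with hc
  have hcs : ∀ x, x ∈ c.source ↔ x ∈ e.source ∧ coord e x ∈ φ.target := fun x => by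
    rw [hc, OpenPartialHomeomorph.trans_source]; rfl
  have hcc : ∀ x, coord e x ∈ φ.target → coord c x = φ.symm (coord e x) := fun x hx =>
    val_symm ((hψQ _ hx).2 (coord_mem e x))
  have hcu : ∀ z ∈ quadrant m, z ∈ φ.source → uncoord c z = uncoord e (φ z) := fun z hz _ => by
    have : ((cornerModel m).symm z).val = z := val_symm hz
    change e.symm ((cornerModel m).symm (φ ((cornerModel m).symm z).val)) = _
    rw [this]; rfl
  have hφc : ∀ x ∈ c.source, coord c x ∈ φ.source ∧ φ (coord c x) = coord e x := fun x hx => by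
    have hx' := ((hcs x).1 hx).2
    rw [hcc x hx']
    exact ⟨φ.map_target hx', φ.right_inv hx'⟩
  have hcm : c ∈ IsManifold.maximalAtlas (cornerModel m) ∞ X := by
    refine mem_maximalAtlas_of_coord (fun x hx => ?_) (fun x hx => ?_)
    · obtain ⟨hxe, hxt⟩ := (hcs x).1 hx
      have h1 : ContDiffWithinAt ℝ ∞ φ.symm (quadrant m) (coord e x) :=
        (hφs' _ ⟨hxt, coord_mem e x⟩).mono_of_mem_nhdsWithin
          (inter_mem (nhdsWithin_le_nhds (φ.open_target.mem_nhds hxt)) self_mem_nhdsWithin)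
      have h2 := ContMDiffWithinAt.comp (s := univ) x h1.contMDiffWithinAt
        (contMDiffAt_coord he hxe).contMDiffWithinAt fun y _ => coord_mem e y
      rw [contMDiffWithinAt_univ] at h2
      refine h2.congr_of_eventuallyEq ?_
      filter_upwards [(continuousAt_coord hxe).eventually (φ.open_target.mem_nhds hxt)] with y hy
        using hcc y hy
    · obtain ⟨hxe, hxt⟩ := (hcs x).1 hx
      obtain ⟨h0, h0'⟩ := hφc x hx
      have h1 : ContDiffWithinAt ℝ ∞ φ (quadrant m) (coord c x) :=
        (hφs _ ⟨h0, coord_mem c x⟩).mono_of_mem_nhdsWithin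
          (inter_mem (nhdsWithin_le_nhds (φ.open_source.mem_nhds h0)) self_mem_nhdsWithin)
      have h2 : ContMDiffWithinAt 𝓘(ℝ, EuclideanSpace ℝ (Fin m)) (cornerModel m) ∞
          (uncoord e) (quadrant m) (φ (coord c x)) := by
        rw [h0']; exact contMDiffWithinAt_uncoord he hxe
      have h1' := h1.mono (inter_subset_left (t := φ.source))
      have h3 := ContMDiffWithinAt.comp (coord c x) h2 h1'.contMDiffWithinAt
        fun z hz => (hφQ z hz.2).2 hz.1
      refine ContMDiffWithinAt.mono_of_mem_nhdsWithin ?_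
        (inter_mem_nhdsWithin _ (φ.open_source.mem_nhds h0))
      exact h3.congr (fun z hz => hcu z hz.1 hz.2) (hcu _ (coord_mem c x) h0)
  have hcfield : ∀ x ∈ c.source, dcoord c x (V x) = EuclideanSpace.single i 1 := by
    intro x hx
    obtain ⟨hxe, hxt⟩ := (hcs x).1 hx
    obtain ⟨h0, h0'⟩ := hφc x hx
    obtain ⟨D, hD, hDv⟩ := hasFDerivWithinAt_comp_uncoord he hxe
      ((contMDiffAt_coord hcm hx).mdifferentiableAt (by simp))
    have hb : coord c x ∈ φ.source ∩ quadrant m := ⟨h0, coord_mem c x⟩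
    have h1 := ((hφs _ hb).differentiableWithinAt (by simp)).hasFDerivWithinAt
    rw [← h0'] at hD
    have h2 := hD.comp (coord c x) h1 fun z hz => (hφQ z hz.1).2 hz.2
    have huniq : UniqueDiffWithinAt ℝ (φ.source ∩ quadrant m) (coord c x) := by
      rw [inter_comm]
      exact (uniqueDiffOn_quadrant m).inter φ.open_source _ ⟨hb.2, hb.1⟩
    -- The new coordinates undo φ, so their derivative inverts that of φ, which sends e_i to the
    -- coordinates of V.
    have h3 : HasFDerivWithinAt ((coord c ∘ uncoord e) ∘ φ)
        (ContinuousLinearMap.id ℝ (EuclideanSpace ℝ (Fin m))) (φ.source ∩ quadrant m)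
        (coord c x) := by
      have key : ∀ z ∈ φ.source ∩ quadrant m, ((coord c ∘ uncoord e) ∘ φ) z = z := by
        intro z hz
        have hzQ := (hφQ z hz.1).2 hz.2
        have h4 := hco _ ⟨hzQ, hφN (φ.map_source hz.1)⟩
        have h5 : coord e (uncoord e (φ z)) ∈ φ.target := by rw [h4]; exact φ.map_source hz.1
        change coord c (uncoord e (φ z)) = z
        rw [hcc _ h5, h4, φ.left_inv hz.1]
      exact (hasFDerivWithinAt_id _ _).congr key (key _ hb)
    have h4 := congrArg (fun L => L (EuclideanSpace.single i 1)) (huniq.eq h2 h3)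
    simp only [ContinuousLinearMap.comp_apply, ContinuousLinearMap.id_apply] at h4
    rw [hφv _ hb, h0', hvx x hxe, ← hDv] at h4
    exact h4
  have hpc : p ∈ c.source := (hcs p).2 ⟨hpe, by
    have := φ.map_source hφa
    rwa [hφaa] at this⟩
  have hface : ∀ x ∈ c.source, (x ∈ F ↔ coord c x i = 0) := fun x hx => by
    obtain ⟨hxe, hxt⟩ := (hcs x).1 hx
    obtain ⟨h0, h0'⟩ := hφc x hx
    have h1 := (hball _ (hφN hxt)).2
    rw [uncoord_coord hxe] at h1
    rw [h1, ← h0', hφF _ h0]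
  -- Shrinking to t < 1 keeps 1 - t positive in the doubled chart.
  have hopen : IsOpen (c.source ∩ (fun x => coord c x i) ⁻¹' Iio 1) := by
    refine ContinuousOn.isOpen_inter_preimage (fun x hx => ?_) c.open_source isOpen_Iio
    exact ((EuclideanSpace.proj (𝕜 := ℝ) i).continuous.continuousAt.comp
      (continuousAt_coord hx)).continuousWithinAt
  have hres : (c.restr (c.source ∩ (fun x => coord c x i) ⁻¹' Iio 1)).source =
      c.source ∩ (fun x => coord c x i) ⁻¹' Iio 1 := by
    rw [OpenPartialHomeomorph.restr_source, hopen.interior_eq, ← inter_assoc, inter_self]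
  refine ⟨c.restr (c.source ∩ (fun x => coord c x i) ⁻¹' Iio 1), i, ?_, ?_, ?_, ?_, ?_⟩
  · rw [hres]
    refine ⟨hpc, ?_⟩
    rw [mem_preimage, (hface p hpc).1 hp]
    exact zero_lt_one' ℝ
  · exact restr_mem_maximalAtlas (contDiffGroupoid ∞ (cornerModel m)) hcm hopen
  · intro x hx
    rw [hres] at hx
    exact hcfield x hx.1
  · intro x hx
    rw [hres] at hx
    exact hface x hx.1
  · intro x hx
    rw [hres] at hx
    exact hx.2

/-- Replace one coordinate. -/
noncomputable def setCoord (i : Fin m) (s : ℝ) (z : EuclideanSpace ℝ (Fin m)) : EuclideanSpace ℝ (Fin m) :=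
  z + (s - z i) • EuclideanSpace.single i 1

@[simp] theorem setCoord_same (i : Fin m) (s : ℝ) (z : EuclideanSpace ℝ (Fin m)) :
    setCoord i s z i = s := by simp [setCoord]

@[simp] theorem setCoord_of_ne {i k : Fin m} (h : k ≠ i) (s : ℝ) (z : EuclideanSpace ℝ (Fin m)) :
    setCoord i s z k = z k := by simp [setCoord, h]

theorem setCoord_mem {i : Fin m} {s : ℝ} (hs : 0 ≤ s) {z : EuclideanSpace ℝ (Fin m)}
    (hz : z ∈ quadrant m) : setCoord i s z ∈ quadrant m := fun k => by
  by_cases h : k = i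
  · rw [h, setCoord_same]; exact hs
  · rw [setCoord_of_ne h]; exact hz k

theorem setCoord_self (i : Fin m) (z : EuclideanSpace ℝ (Fin m)) : setCoord i (z i) z = z := by
  simp [setCoord]

theorem setCoord_setCoord (i : Fin m) (s t : ℝ) (z : EuclideanSpace ℝ (Fin m)) :
    setCoord i s (setCoord i t z) = setCoord i s z := by
  ext k
  by_cases h : k = i
  · rw [h, setCoord_same, setCoord_same]
  · rw [setCoord_of_ne h, setCoord_of_ne h, setCoord_of_ne h]

theorem norm_setCoord_sub_le {i : Fin m} {s : ℝ} {z a : EuclideanSpace ℝ (Fin m)}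
    (h : |s - a i| ≤ |z i - a i|) : ‖setCoord i s z - a‖ ≤ ‖z - a‖ := by
  rw [EuclideanSpace.norm_eq, EuclideanSpace.norm_eq]
  refine Real.sqrt_le_sqrt (Finset.sum_le_sum fun k _ => ?_)
  refine pow_le_pow_left₀ (norm_nonneg _) ?_ 2
  by_cases hk : k = i
  · subst hk
    simpa using h
  · simp [hk]

theorem contDiff_setCoord (i : Fin m) (s : ℝ) :
    ContDiff ℝ ∞ (setCoord i s : EuclideanSpace ℝ (Fin m) → EuclideanSpace ℝ (Fin m)) := by
  have h : ContDiff ℝ ∞ fun z : EuclideanSpace ℝ (Fin m) => z i :=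
    (EuclideanSpace.proj (𝕜 := ℝ) i).contDiff
  exact contDiff_id.add ((contDiff_const.sub h).smul contDiff_const)

/-- Preservation of V means, in straight charts, that the derivative sends e_i to e_i'. -/
theorem deriv_of_isStraight {e e' : OpenPartialHomeomorph X (EuclideanQuadrant m)} {i i' : Fin m}
    (h : IsStraight F V e i) (h' : IsStraight F V e' i') {f : X → X} {x : X} (hx : x ∈ e.source)
    (hfx : f x ∈ e'.source) (hf : ContMDiffAt (cornerModel m) (cornerModel m) ∞ f x)
    (hfV : mfderiv (cornerModel m) (cornerModel m) f x (V x) = V (f x)) :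
    ∃ D : EuclideanSpace ℝ (Fin m) →L[ℝ] EuclideanSpace ℝ (Fin m),
      HasFDerivWithinAt (fun z => coord e' (f (uncoord e z))) D (quadrant m) (coord e x) ∧
      D (EuclideanSpace.single i 1) = EuclideanSpace.single i' 1 := by
  have h1 := (contMDiffAt_coord h'.mem hfx).mdifferentiableAt (n := ∞) (by simp)
  have h2 := hf.mdifferentiableAt (n := ∞) (by simp)
  obtain ⟨D, hD, hDv⟩ := hasFDerivWithinAt_comp_uncoord h.mem hx (h1.comp x h2)
  refine ⟨D, hD, ?_⟩
  rw [← h.field x hx, ← hDv]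
  have h3 := differential_comp h1 h2 (V x)
  rw [hfV] at h3
  exact h3.trans (h'.field _ hfx)

/-- In straight charts, a map that preserves the field and the face set is a product. -/
theorem coord_eq_of_isStraight {e e' : OpenPartialHomeomorph X (EuclideanQuadrant m)} {i i' : Fin m}
    (h : IsStraight F V e i) (h' : IsStraight F V e' i') {f : X → X}
    {a : EuclideanSpace ℝ (Fin m)} (ha : a i = 0) {δ : ℝ}
    (hball : ∀ z ∈ Metric.ball a δ, z ∈ quadrant m → (cornerModel m).symm z ∈ e.target ∧
      f (uncoord e z) ∈ e'.source ∧
      ContMDiffAt (cornerModel m) (cornerModel m) ∞ f (uncoord e z))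
    (hfV : ∀ x, mfderiv (cornerModel m) (cornerModel m) f x (V x) = V (f x))
    {z : EuclideanSpace ℝ (Fin m)} (hz : z ∈ Metric.ball a δ) (hzq : z ∈ quadrant m) :
    coord e' (f (uncoord e z)) =
      coord e' (f (uncoord e (setCoord i 0 z))) + z i • EuclideanSpace.single i' 1 := by
  set H : EuclideanSpace ℝ (Fin m) → EuclideanSpace ℝ (Fin m) :=
    fun z => coord e' (f (uncoord e z)) with hH
  have hzi : 0 ≤ z i := hzq i
  have hmem : ∀ t ∈ Icc 0 (z i), setCoord i t z ∈ Metric.ball a δ ∧ setCoord i t z ∈ quadrant m := by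
    intro t ht
    refine ⟨?_, setCoord_mem ht.1 hzq⟩
    rw [mem_ball_iff_norm] at hz ⊢
    refine (norm_setCoord_sub_le ?_).trans_lt hz
    rw [ha, sub_zero, sub_zero, abs_of_nonneg ht.1, abs_of_nonneg hzi]
    exact ht.2
  -- Along the i-th coordinate line the image has constant velocity e_i', so subtracting t e_i'
  -- leaves a constant.
  have hd : ∀ t ∈ Icc 0 (z i), HasDerivWithinAt
      (fun t : ℝ => H (setCoord i t z) - t • EuclideanSpace.single i' (1 : ℝ)) 0 (Icc 0 (z i)) t := by
    intro t ht
    obtain ⟨h1, h2⟩ := hmem t ht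
    obtain ⟨h3, h4, h5⟩ := hball _ h1 h2
    obtain ⟨D, hD, hDi⟩ := deriv_of_isStraight h h' (e.map_target h3) h4 h5 (hfV _)
    have h6 : coord e (e.symm ((cornerModel m).symm (setCoord i t z))) = setCoord i t z :=
      coord_uncoord h2 h3
    rw [h6] at hD
    have h7 : HasDerivWithinAt (fun t : ℝ => setCoord i t z) (EuclideanSpace.single i (1 : ℝ))
        (Icc 0 (z i)) t := by
      have h8 := (((hasDerivAt_id t).sub_const (z i)).smul_const
        (EuclideanSpace.single i (1 : ℝ))).const_add z
      simpa [setCoord] using h8.hasDerivWithinAt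
    have h8 := hD.comp_hasDerivWithinAt t h7 fun s hs => (hmem s hs).2
    rw [hDi] at h8
    have h9 := h8.sub ((hasDerivWithinAt_id t (Icc 0 (z i))).smul_const
      (EuclideanSpace.single i' (1 : ℝ)))
    rw [one_smul, sub_self] at h9
    exact h9
  have h1 := constant_of_derivWithin_zero (fun t ht => (hd t ht).differentiableWithinAt)
    (fun t ht => (hd t (Ico_subset_Icc_self ht)).derivWithin
      (uniqueDiffOn_Icc (lt_of_le_of_lt ht.1 ht.2) t (Ico_subset_Icc_self ht))) (z i)
    (right_mem_Icc.2 hzi)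
  simp only [setCoord_self, zero_smul, sub_zero] at h1
  exact sub_eq_iff_eq_add.1 h1

end Straight

/-! ### Topology of the double -/

section DoubleTopology

namespace Double

variable {X : Type*} {F : Set X}

theorem exists_incl (d : Double X F) : ∃ b x, d = incl F b x := by
  induction d using Quotient.inductionOn with
  | h p => exact ⟨p.2, p.1, rfl⟩

@[simp] theorem fold_incl (b : Bool) (x : X) : fold F (incl F b x) = x := rfl

theorem incl_eq_incl_iff {b b' : Bool} {x y : X} :
    incl F b x = incl F b' y ↔ x = y ∧ (b = b' ∨ x ∈ F) := Quotient.eq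

theorem incl_injective (b : Bool) : Injective (incl F b) := fun _ _ h => (incl_eq_incl_iff.1 h).1

theorem incl_eq_of_mem {x : X} (hx : x ∈ F) (b b' : Bool) : incl F b x = incl F b' x :=
  incl_eq_incl_iff.2 ⟨rfl, Or.inr hx⟩

/-- The map of doubles given by maps of the labels and of the space. -/
def map (σ : Bool → Bool) (f : X → X) (hf : ∀ x ∈ F, f x ∈ F) : Double X F → Double X F :=
  Quotient.map (fun p : X × Bool => (f p.1, σ p.2)) fun _ _ h =>
    ⟨congrArg f h.1, h.2.imp (congrArg σ) (hf _)⟩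

@[simp] theorem map_incl (σ : Bool → Bool) (f : X → X) (hf : ∀ x ∈ F, f x ∈ F) (b : Bool) (x : X) :
    map σ f hf (incl F b x) = incl F (σ b) (f x) := rfl

@[simp] theorem fold_map (σ : Bool → Bool) (f : X → X) (hf : ∀ x ∈ F, f x ∈ F) (d : Double X F) :
    fold F (map σ f hf d) = f (fold F d) := by
  obtain ⟨b, x, rfl⟩ := exists_incl d
  rfl

variable [TopologicalSpace X]

theorem isQuotientMap_mk : IsQuotientMap (fun p : X × Bool => incl F p.2 p.1) := isQuotientMap_quot_mk

theorem continuous_incl (b : Bool) : Continuous (incl F b) :=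
  isQuotientMap_mk.continuous.comp (by fun_prop : Continuous fun x : X => (x, b))

theorem continuous_iff {Y : Type*} [TopologicalSpace Y] {f : Double X F → Y} :
    Continuous f ↔ ∀ b, Continuous (fun x => f (incl F b x)) := by
  rw [isQuotientMap_mk.continuous_iff]
  refine ⟨fun h b => h.comp (by fun_prop : Continuous fun x : X => (x, b)), fun h => ?_⟩
  exact continuous_prod_of_discrete_right.2 h

theorem continuous_fold : Continuous (fold F) := continuous_iff.2 fun _ => continuous_id

theorem isOpen_image_incl (b : Bool) {U : Set X} (hU : IsOpen U) (hUF : Disjoint U F) :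
    IsOpen (incl F b '' U) := by
  rw [← isQuotientMap_mk.isOpen_preimage]
  have : (fun p : X × Bool => incl F p.2 p.1) ⁻¹' (incl F b '' U) = U ×ˢ {b} := by
    ext ⟨x, b'⟩
    simp only [mem_preimage, mem_image, mem_prod, mem_singleton_iff]
    constructor
    · rintro ⟨y, hy, h⟩
      obtain ⟨rfl, h'⟩ := incl_eq_incl_iff.1 h
      exact ⟨hy, (h'.resolve_right (Set.disjoint_left.1 hUF hy)).symm⟩
    · rintro ⟨hx, rfl⟩
      exact ⟨x, hx, rfl⟩
  rw [this]
  exact hU.prod (isOpen_discrete _)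

instance [CompactSpace X] : CompactSpace (Double X F) :=
  isCompact_univ_iff.1 (by
    rw [← isQuotientMap_mk.surjective.range_eq]
    exact isCompact_range isQuotientMap_mk.continuous)

/-- Points over different points of X are separated in X. Distinct points over the same x lie off F,
where the two copies are disjoint open sets. -/
theorem t2Space [T2Space X] (hF : IsClosed F) : T2Space (Double X F) := by
  refine ⟨fun d d' hne => ?_⟩
  by_cases h : fold F d = fold F d'
  · obtain ⟨b, x, rfl⟩ := exists_incl d
    obtain ⟨b', y, rfl⟩ := exists_incl d'
    have hxy : x = y := h
    subst hxy
    have hx : x ∉ F := fun hx => hne (incl_eq_of_mem hx b b')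
    have hb : b ≠ b' := fun hb => hne (by rw [hb])
    refine ⟨_, _, isOpen_image_incl b hF.isOpen_compl disjoint_compl_left,
      isOpen_image_incl b' hF.isOpen_compl disjoint_compl_left, ⟨x, hx, rfl⟩, ⟨x, hx, rfl⟩, ?_⟩
    rw [Set.disjoint_left]
    rintro _ ⟨y, hy, rfl⟩ ⟨z, hz, hzy⟩
    obtain ⟨rfl, h'⟩ := incl_eq_incl_iff.1 hzy
    exact h'.elim (fun h => hb h.symm) hz
  · obtain ⟨U, U', hU, hU', hd, hd', hUU⟩ := t2_separation h
    exact ⟨_, _, hU.preimage continuous_fold, hU'.preimage continuous_fold, hd, hd',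
      hUU.preimage _⟩

theorem isEmbedding_incl [CompactSpace X] [T2Space X] (hF : IsClosed F) (b : Bool) :
    IsEmbedding (incl F b) := by
  have := t2Space hF
  exact ((continuous_incl b).isClosedEmbedding (incl_injective b)).isEmbedding

end Double

end DoubleTopology

/-! ### Charts of the double -/

section DoubleCharts

variable {m : ℕ} {X : Type*} [TopologicalSpace X] {F : Set X}

/-- The chart on one copy of `X`, off the set `F`. -/
noncomputable def copyChart (hF : IsClosed F) (b : Bool)
    (e : OpenPartialHomeomorph X (EuclideanQuadrant m)) :
    OpenPartialHomeomorph (Double X F) (EuclideanQuadrant m) where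
  toFun d := e (Double.fold F d)
  invFun y := Double.incl F b (e.symm y)
  source := Double.incl F b '' (e.source \ F)
  target := e.target ∩ e.symm ⁻¹' Fᶜ
  map_source' := by
    rintro _ ⟨x, hx, rfl⟩
    refine ⟨e.map_source hx.1, ?_⟩
    rw [mem_preimage, Double.fold_incl, e.left_inv hx.1]
    exact hx.2
  map_target' y hy := ⟨_, ⟨e.map_target hy.1, hy.2⟩, rfl⟩
  left_inv' := by
    rintro _ ⟨x, hx, rfl⟩
    rw [Double.fold_incl, e.left_inv hx.1]
  right_inv' y hy := by rw [Double.fold_incl, e.right_inv hy.1]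
  open_source := Double.isOpen_image_incl b (e.open_source.sdiff hF)
    (Set.disjoint_left.2 fun _ hx => hx.2)
  open_target := e.isOpen_inter_preimage_symm hF.isOpen_compl
  continuousOn_toFun := by
    refine e.continuousOn.comp Double.continuous_fold.continuousOn ?_
    rintro _ ⟨x, hx, rfl⟩
    exact hx.1
  continuousOn_invFun := (Double.continuous_incl b).comp_continuousOn
    (e.continuousOn_symm.mono inter_subset_left)

/-- The sign of a label. -/
def labelSign (b : Bool) : ℝ := if b then 1 else -1

open Classical in
/-- The coordinates on the double near `F`: the coordinate `t ≥ 0` that defines `F` is replaced by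
`1 + t` on one copy and by `1 - t` on the other one. -/
noncomputable def doubleCoord (F : Set X) (e : OpenPartialHomeomorph X (EuclideanQuadrant m))
    (i : Fin m) : Double X F → EuclideanSpace ℝ (Fin m) :=
  Quotient.lift (fun p : X × Bool => if p.1 ∈ F then setCoord i 1 (coord e p.1) else
    setCoord i (1 + labelSign p.2 * coord e p.1 i) (coord e p.1)) (by
      rintro ⟨x, b⟩ ⟨y, b'⟩ ⟨h, h'⟩
      dsimp only at h h' ⊢
      subst h
      by_cases hx : x ∈ F
      · simp [hx]
      · rw [h'.resolve_right hx])

/-- Undo the replacement of coordinates on the double. -/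
noncomputable def foldCoord (i : Fin m) (w : EuclideanSpace ℝ (Fin m)) :
    EuclideanSpace ℝ (Fin m) := setCoord i |w i - 1| w

theorem continuous_foldCoord (i : Fin m) :
    Continuous (foldCoord i : EuclideanSpace ℝ (Fin m) → EuclideanSpace ℝ (Fin m)) := by
  unfold foldCoord setCoord
  fun_prop

theorem foldCoord_mem {i : Fin m} {w : EuclideanSpace ℝ (Fin m)} (hw : w ∈ quadrant m) :
    foldCoord i w ∈ quadrant m := setCoord_mem (abs_nonneg _) hw

theorem foldCoord_setCoord {i : Fin m} (b : Bool) {z : EuclideanSpace ℝ (Fin m)} (hz : 0 ≤ z i) :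
    foldCoord i (setCoord i (1 + labelSign b * z i) z) = z := by
  rw [foldCoord, setCoord_setCoord, setCoord_same, add_sub_cancel_left]
  have : |labelSign b * z i| = z i := by
    cases b
    · simp [labelSign, abs_of_nonneg hz]
    · simp [labelSign, abs_of_nonneg hz]
  rw [this, setCoord_self]

variable {e : OpenPartialHomeomorph X (EuclideanQuadrant m)} {i : Fin m}

theorem uncoord_mem_source {z : EuclideanSpace ℝ (Fin m)} (hz : (cornerModel m).symm z ∈ e.target) :
    uncoord e z ∈ e.source := e.map_target hz

theorem doubleCoord_incl (hface : ∀ x ∈ e.source, (x ∈ F ↔ coord e x i = 0)) (b : Bool) {x : X}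
    (hx : x ∈ e.source) : doubleCoord F e i (Double.incl F b x) =
      setCoord i (1 + labelSign b * coord e x i) (coord e x) := by
  by_cases h : x ∈ F
  · have h1 : coord e x i = 0 := (hface x hx).1 h
    rw [h1, mul_zero, add_zero]
    exact if_pos h
  · exact if_neg h

/-- The reason for the condition t < 1 on straight charts: the model is a quadrant, so the doubled
coordinate is centred at 1 and has to remain nonnegative on both copies. -/
theorem one_add_labelSign_mul_pos (b : Bool) {t : ℝ} (h0 : 0 ≤ t) (h1 : t < 1) :
    0 < 1 + labelSign b * t := by
  cases b
  · simp only [labelSign]; norm_num; linarith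
  · simp only [labelSign]; norm_num; linarith

theorem doubleCoord_mem (hface : ∀ x ∈ e.source, (x ∈ F ↔ coord e x i = 0))
    (hlt : ∀ x ∈ e.source, coord e x i < 1) {d : Double X F} (hd : Double.fold F d ∈ e.source) :
    doubleCoord F e i d ∈ quadrant m := by
  obtain ⟨b, x, rfl⟩ := Double.exists_incl d
  rw [doubleCoord_incl hface b (x := x) hd]
  exact setCoord_mem (one_add_labelSign_mul_pos b (coord_mem e x i) (hlt x hd)).le (coord_mem e x)

theorem foldCoord_doubleCoord (hface : ∀ x ∈ e.source, (x ∈ F ↔ coord e x i = 0))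
    {d : Double X F} (hd : Double.fold F d ∈ e.source) :
    foldCoord i (doubleCoord F e i d) = coord e (Double.fold F d) := by
  obtain ⟨b, x, rfl⟩ := Double.exists_incl d
  rw [doubleCoord_incl hface b (x := x) hd, foldCoord_setCoord b (coord_mem e x i)]
  rfl

/-- The point of the double with given coordinates. -/
noncomputable def doubleUncoord (F : Set X) (e : OpenPartialHomeomorph X (EuclideanQuadrant m))
    (i : Fin m) (w : EuclideanSpace ℝ (Fin m)) : Double X F :=
  Double.incl F (decide (1 ≤ w i)) (uncoord e (foldCoord i w))

/-- Label and absolute value together recover the signed coordinate; this removes absolute values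
from the formulas across F. -/
theorem labelSign_mul_abs (s : ℝ) : labelSign (decide (1 ≤ s)) * |s - 1| = s - 1 := by
  by_cases h : 1 ≤ s
  · simp [labelSign, h]
  · have h' : s - 1 < 0 := by linarith [not_le.1 h]
    simp only [labelSign, h, decide_false, abs_of_neg h']
    norm_num

theorem continuousOn_doubleCoord (hface : ∀ x ∈ e.source, (x ∈ F ↔ coord e x i = 0)) :
    ContinuousOn (doubleCoord F e i) (Double.fold F ⁻¹' e.source) := by
  refine (Double.isQuotientMap_mk.continuousOn_isOpen_iff
    (e.open_source.preimage Double.continuous_fold)).2 ?_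
  have h1 : ContinuousOn (fun p : X × Bool => coord e p.1) (Prod.fst ⁻¹' e.source) := by
    refine ContinuousOn.comp (g := coord e) (t := e.source) (fun x hx => (continuousAt_coord hx).continuousWithinAt)
      continuous_fst.continuousOn fun p hp => hp
  have h2 : Continuous fun p : X × Bool => labelSign p.2 :=
    (continuous_of_discreteTopology (f := labelSign)).comp continuous_snd
  have h3 : ContinuousOn (fun p : X × Bool => coord e p.1 i) (Prod.fst ⁻¹' e.source) :=
    (EuclideanSpace.proj (𝕜 := ℝ) i).continuous.comp_continuousOn h1
  have h4 : ContinuousOn (fun p : X × Bool => setCoord i (1 + labelSign p.2 * coord e p.1 i)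
      (coord e p.1)) (Prod.fst ⁻¹' e.source) := by
    unfold setCoord
    exact h1.add (((continuousOn_const.add (h2.continuousOn.mul h3)).sub h3).smul continuousOn_const)
  exact h4.congr fun p hp => doubleCoord_incl hface p.2 hp

/-- Where w i ≠ 1 the label is locally constant. Where w i = 1 the point lies in F, and the two
continuous branches have the same value. -/
theorem continuousAt_doubleUncoord (hface : ∀ x ∈ e.source, (x ∈ F ↔ coord e x i = 0))
    {w : EuclideanSpace ℝ (Fin m)} (hwq : w ∈ quadrant m)
    (hw : (cornerModel m).symm (foldCoord i w) ∈ e.target) :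
    ContinuousAt (doubleUncoord F e i) w := by
  have h1 : ContinuousAt (fun w => uncoord e (foldCoord i w)) w := by
    refine ContinuousAt.comp (g := e.symm) (e.continuousAt_symm hw) ?_
    exact ((cornerModel m).continuous_symm.comp (continuous_foldCoord i)).continuousAt
  have h2 : ∀ b, ContinuousAt (fun w => Double.incl F b (uncoord e (foldCoord i w))) w := fun b =>
    (Double.continuous_incl b).continuousAt.comp h1
  have hi : Continuous fun w : EuclideanSpace ℝ (Fin m) => w i := by fun_prop
  rcases lt_trichotomy (w i) 1 with h | h | h
  · refine (h2 false).congr ?_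
    filter_upwards [hi.continuousAt.eventually (gt_mem_nhds h)] with y hy
    simp [doubleUncoord, not_le.2 hy]
  · have hF : uncoord e (foldCoord i w) ∈ F := by
      rw [hface _ (uncoord_mem_source hw), coord_uncoord (foldCoord_mem hwq) hw, foldCoord, setCoord_same, h, sub_self, abs_zero]
    intro O hO
    have h3 : ∀ b, ∀ᶠ y in 𝓝 w, Double.incl F b (uncoord e (foldCoord i y)) ∈ O := fun b =>
      h2 b (by
        change O ∈ 𝓝 (Double.incl F b (uncoord e (foldCoord i w)))
        rw [Double.incl_eq_of_mem hF b (decide (1 ≤ w i))]; exact hO)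
    refine mem_map.2 ?_
    filter_upwards [h3 true, h3 false] with y hy1 hy2
    rw [mem_preimage, doubleUncoord]
    cases decide (1 ≤ y i)
    · exact hy2
    · exact hy1
  · refine (h2 true).congr ?_
    filter_upwards [hi.continuousAt.eventually (lt_mem_nhds h)] with y hy
    simp [doubleUncoord, hy.le]

/-- The chart on the double near the set `F`. -/
noncomputable def doubleChart (hface : ∀ x ∈ e.source, (x ∈ F ↔ coord e x i = 0))
    (hlt : ∀ x ∈ e.source, coord e x i < 1) :
    OpenPartialHomeomorph (Double X F) (EuclideanQuadrant m) where
  toFun d := (cornerModel m).symm (doubleCoord F e i d)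
  invFun y := doubleUncoord F e i y.val
  source := Double.fold F ⁻¹' e.source
  target := {y | (cornerModel m).symm (foldCoord i y.val) ∈ e.target}
  map_source' d hd := by
    rw [mem_ofPred_eq, val_symm (doubleCoord_mem hface hlt hd), foldCoord_doubleCoord hface hd, coord,
      symm_val]
    exact e.map_source hd
  map_target' y hy := e.map_target hy
  left_inv' d hd := by
    rw [val_symm (doubleCoord_mem hface hlt hd), doubleUncoord, foldCoord_doubleCoord hface hd,
      uncoord_coord hd]
    obtain ⟨b, x, rfl⟩ := Double.exists_incl d
    rw [doubleCoord_incl hface b (x := x) hd, setCoord_same, Double.fold_incl, Double.incl_eq_incl_iff]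
    refine ⟨rfl, ?_⟩
    have hx : 0 ≤ coord e x i := coord_mem e x i
    cases b
    · by_cases h : coord e x i = 0
      · exact Or.inr ((hface x hd).2 h)
      · have : 0 < coord e x i := lt_of_le_of_ne hx (Ne.symm h)
        left
        simp [labelSign, this]
    · left
      simp [labelSign, hx]
  right_inv' y hy := by
    have h1 : coord e (uncoord e (foldCoord i y.val)) = foldCoord i y.val :=
      coord_uncoord (foldCoord_mem y.2) hy
    rw [doubleUncoord, doubleCoord_incl hface _ (uncoord_mem_source hy), h1, foldCoord, setCoord_setCoord, setCoord_same, labelSign_mul_abs, add_sub_cancel,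
      setCoord_self, symm_val]
  open_source := e.open_source.preimage Double.continuous_fold
  open_target := e.open_target.preimage ((cornerModel m).continuous_symm.comp
    ((continuous_foldCoord i).comp continuous_subtype_val))
  continuousOn_toFun := (cornerModel m).continuous_symm.comp_continuousOn
    (continuousOn_doubleCoord hface)
  continuousOn_invFun y hy := ((continuousAt_doubleUncoord hface y.2 hy).comp
    continuous_subtype_val.continuousAt).continuousWithinAt

variable (hface : ∀ x ∈ e.source, (x ∈ F ↔ coord e x i = 0))
    (hlt : ∀ x ∈ e.source, coord e x i < 1)

theorem coord_doubleChart (b : Bool) {x : X} (hx : x ∈ e.source) :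
    coord (doubleChart hface hlt) (Double.incl F b x) =
      setCoord i (1 + labelSign b * coord e x i) (coord e x) := by
  have hd : Double.fold F (Double.incl F b x) ∈ e.source := hx
  rw [← doubleCoord_incl hface b hx]
  exact val_symm (doubleCoord_mem hface hlt hd)

theorem uncoord_doubleChart {w : EuclideanSpace ℝ (Fin m)} (hw : w ∈ quadrant m) :
    uncoord (doubleChart hface hlt) w =
      Double.incl F (decide (1 ≤ w i)) (uncoord e (foldCoord i w)) := by
  have : ((cornerModel m).symm w).val = w := val_symm hw
  change doubleUncoord F e i ((cornerModel m).symm w).val = _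
  rw [this]
  rfl

end DoubleCharts

/-! ### Smoothness across the glued face -/

section DoubleMap

theorem Double.map_id_id {X : Type*} {F : Set X} (hf : ∀ x ∈ F, id x ∈ F) (d : Double X F) : Double.map id id hf d = d := by
  obtain ⟨b, x, rfl⟩ := Double.exists_incl d
  rfl

variable {m : ℕ} {X : Type*} [TopologicalSpace X] [ChartedSpace (EuclideanQuadrant m) X]
  {F : Set X} {V : ∀ x : X, TangentSpace (cornerModel m) x}
  {EN : Type*} [NormedAddCommGroup EN] [NormedSpace ℝ EN] {HN : Type*} [TopologicalSpace HN]
  {J : ModelWithCorners ℝ EN HN} {N : Type*} [TopologicalSpace N] [ChartedSpace HN N]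

/-- In the charts near the fixed set, the maps of the double induced by maps that preserve the
field are smooth. -/
theorem contMDiffWithinAt_coord_map
    {e e' : OpenPartialHomeomorph X (EuclideanQuadrant m)} {i i' : Fin m}
    (h : IsStraight F V e i) (h' : IsStraight F V e' i') {f : N → X → X}
    (hf : ContMDiff (J.prod (cornerModel m)) (cornerModel m) ∞ fun p : N × X => f p.1 p.2)
    (hfF : ∀ n, ∀ x ∈ F, f n x ∈ F)
    (hfV : ∀ n x, mfderiv (cornerModel m) (cornerModel m) (f n) x (V x) = V (f n x))
    {σ : Bool → Bool} {τ : ℝ} (hσ : ∀ b, labelSign (σ b) = τ * labelSign b)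
    {n₀ : N} {x₀ : X} (hx₀ : x₀ ∈ F) (hx₀e : x₀ ∈ e.source) (hfx₀ : f n₀ x₀ ∈ e'.source) (b : Bool) :
    ContMDiffWithinAt (J.prod 𝓘(ℝ, EuclideanSpace ℝ (Fin m))) 𝓘(ℝ, EuclideanSpace ℝ (Fin m)) ∞
      (fun p : N × EuclideanSpace ℝ (Fin m) => coord (doubleChart h'.face h'.lt_one)
        (Double.map σ (f p.1) (hfF p.1) (uncoord (doubleChart h.face h.lt_one) p.2)))
      (univ ×ˢ quadrant m) (n₀, coord (doubleChart h.face h.lt_one) (Double.incl F b x₀)) := by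
  set a := coord e x₀ with ha
  have hai : a i = 0 := (h.face x₀ hx₀e).1 hx₀
  have hw₀ : coord (doubleChart h.face h.lt_one) (Double.incl F b x₀) = setCoord i 1 a := by
    rw [coord_doubleChart _ _ _ hx₀e, ← ha, hai, mul_zero, add_zero]
  rw [hw₀]
  have hfold : foldCoord i (setCoord i 1 a) = a := by
    rw [foldCoord, setCoord_setCoord, setCoord_same, sub_self, abs_zero, ← hai, setCoord_self]
  have hnear : ∀ᶠ p : N × EuclideanSpace ℝ (Fin m) in 𝓝 (n₀, a),
      (cornerModel m).symm p.2 ∈ e.target ∧ f p.1 (uncoord e p.2) ∈ e'.source := by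
    have h1 : Tendsto (fun p : N × EuclideanSpace ℝ (Fin m) => (p.1, uncoord e p.2)) (𝓝 (n₀, a))
        (𝓝 (n₀, x₀)) := by
      rw [nhds_prod_eq, nhds_prod_eq]
      exact tendsto_fst.prodMk ((tendsto_uncoord hx₀e).comp tendsto_snd)
    have h2 : Tendsto (fun p : N × EuclideanSpace ℝ (Fin m) => p.2) (𝓝 (n₀, a)) (𝓝 a) :=
      continuous_snd.tendsto (n₀, a)
    have h3 : Tendsto (fun p : N × X => f p.1 p.2) (𝓝 (n₀, x₀)) (𝓝 (f n₀ x₀)) :=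
      hf.continuous.tendsto (n₀, x₀)
    exact (h2.eventually (eventually_symm_mem_target hx₀e)).and
      ((h3.comp h1).eventually (e'.open_source.mem_nhds hfx₀))
  rw [nhds_prod_eq] at hnear
  obtain ⟨pn, hpn, pz, hpz, hnz⟩ := eventually_prod_iff.1 hnear
  obtain ⟨δ, hδ, hball⟩ := Metric.eventually_nhds_iff_ball.1 hpz
  have hx1 : uncoord e (setCoord i 0 (setCoord i 1 a)) = x₀ := by
    rw [setCoord_setCoord, ← hai, setCoord_self, uncoord_coord hx₀e]
  -- The inverse of the doubled chart involves |w i - 1|. But the map is a product in straight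
  -- charts, so only its restriction to the face and the signed coordinate 1 + τ(w i - 1) enter;
  -- this expression is smooth at w i = 1.
  have key : ∀ᶠ p : N × EuclideanSpace ℝ (Fin m) in 𝓝[univ ×ˢ quadrant m] (n₀, setCoord i 1 a),
      coord (doubleChart h'.face h'.lt_one)
        (Double.map σ (f p.1) (hfF p.1) (uncoord (doubleChart h.face h.lt_one) p.2)) =
      setCoord i' (1 + τ * (p.2 i - 1)) (coord e' (f p.1 (uncoord e (setCoord i 0 p.2)))) := by
    have h1 : ∀ᶠ p : N × EuclideanSpace ℝ (Fin m) in 𝓝 (n₀, setCoord i 1 a),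
        pn p.1 ∧ foldCoord i p.2 ∈ Metric.ball a δ := by
      refine (continuousAt_fst.eventually hpn).and ?_
      have : ContinuousAt (fun p : N × EuclideanSpace ℝ (Fin m) => foldCoord i p.2)
          (n₀, setCoord i 1 a) := ((continuous_foldCoord i).comp continuous_snd).continuousAt
      refine this.eventually (Metric.isOpen_ball.mem_nhds ?_)
      change foldCoord i (setCoord i 1 a) ∈ _
      rw [hfold]
      exact Metric.mem_ball_self hδ
    filter_upwards [h1.filter_mono nhdsWithin_le_nhds, self_mem_nhdsWithin] with p hp hpq
    obtain ⟨n, w⟩ := p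
    obtain ⟨hpn, hz⟩ := hp
    have hw : w ∈ quadrant m := hpq.2
    dsimp only at hpn hz ⊢
    set z := foldCoord i w with hzdef
    have hzq : z ∈ quadrant m := foldCoord_mem hw
    have hzi : z i = |w i - 1| := by rw [hzdef, foldCoord, setCoord_same]
    have hz0 : setCoord i 0 w = setCoord i 0 z := by rw [hzdef, foldCoord, setCoord_setCoord]
    have hz0b : setCoord i 0 z ∈ Metric.ball a δ := by
      rw [mem_ball_iff_norm] at hz ⊢
      refine (norm_setCoord_sub_le ?_).trans_lt hz
      rw [hai, sub_self, abs_zero]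
      exact abs_nonneg _
    have hz0q : setCoord i 0 z ∈ quadrant m := setCoord_mem le_rfl hzq
    have hy := coord_eq_of_isStraight h h' (f := f n) hai (δ := δ) (fun z hz hzq => by
      obtain ⟨h2, h3⟩ := hnz hpn (hball z hz)
      refine ⟨h2, h3, ?_⟩
      exact (hf (n, uncoord e z)).comp (uncoord e z)
        (contMDiffAt_const.prodMk contMDiffAt_id)) (hfV n) hz hzq
    have h0 : coord e' (f n (uncoord e (setCoord i 0 z))) i' = 0 := by
      obtain ⟨h2, h3⟩ := hnz hpn (hball _ hz0b)
      refine (h'.face _ h3).1 (hfF n _ ?_)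
      rw [h.face _ (uncoord_mem_source h2), coord_uncoord hz0q h2, setCoord_same]
    have hi' : coord e' (f n (uncoord e z)) i' = |w i - 1| := by
      rw [hy, ← hzi]
      simp [h0]
    rw [uncoord_doubleChart _ _ hw, Double.map_incl,
      coord_doubleChart _ _ _ (hnz hpn (hball _ hz)).2, hi', hσ, mul_assoc, labelSign_mul_abs, hy, hz0,
      setCoord, setCoord]
    simp only [PiLp.add_apply, PiLp.smul_apply, PiLp.single_apply, if_true, smul_eq_mul, mul_one]
    rw [add_assoc, ← add_smul]
    congr 2
    ring
  have hsm : ContMDiffWithinAt (J.prod 𝓘(ℝ, EuclideanSpace ℝ (Fin m)))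
      𝓘(ℝ, EuclideanSpace ℝ (Fin m)) ∞
      (fun p : N × EuclideanSpace ℝ (Fin m) => coord e' (f p.1 (uncoord e (setCoord i 0 p.2))))
      (univ ×ˢ quadrant m) (n₀, setCoord i 1 a) := by
    have h1 : ContMDiffWithinAt (J.prod 𝓘(ℝ, EuclideanSpace ℝ (Fin m)))
        𝓘(ℝ, EuclideanSpace ℝ (Fin m)) ∞
        (fun p : N × EuclideanSpace ℝ (Fin m) => setCoord i 0 p.2)
        (univ ×ˢ quadrant m) (n₀, setCoord i 1 a) :=
      (contDiff_setCoord i 0).contMDiff.contMDiffAt.comp_contMDiffWithinAt _ contMDiffWithinAt_snd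
    have h2 : ContMDiffWithinAt 𝓘(ℝ, EuclideanSpace ℝ (Fin m)) (cornerModel m) ∞ (uncoord e)
        (quadrant m) (setCoord i 0 (setCoord i 1 a)) := by
      rw [setCoord_setCoord, ← hai, setCoord_self]
      exact contMDiffWithinAt_uncoord h.mem hx₀e
    have h3 := ContMDiffWithinAt.comp (g := uncoord e) (n₀, setCoord i 1 a) h2 h1
      fun p hp => setCoord_mem le_rfl hp.2
    have h4 := ContMDiffAt.comp_contMDiffWithinAt
      (g := fun p : N × X => f p.1 p.2) (n₀, setCoord i 1 a) (hf _)
      (contMDiffWithinAt_fst.prodMk h3)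
    refine ContMDiffAt.comp_contMDiffWithinAt (g := coord e') (n₀, setCoord i 1 a) ?_ h4
    change ContMDiffAt _ _ _ (coord e') (f n₀ (uncoord e (setCoord i 0 (setCoord i 1 a))))
    rw [hx1]
    exact contMDiffAt_coord h'.mem hfx₀
  refine ContMDiffWithinAt.congr_of_eventuallyEq ?_ key (key.self_of_nhdsWithin ⟨trivial, ?_⟩)
  · have hs : ContDiff ℝ ∞ fun q : EuclideanSpace ℝ (Fin m) × EuclideanSpace ℝ (Fin m) =>
        setCoord i' (1 + τ * (q.1 i - 1)) q.2 := by
      have h1 : ContDiff ℝ ∞ fun q : EuclideanSpace ℝ (Fin m) × EuclideanSpace ℝ (Fin m) => q.1 i :=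
        (EuclideanSpace.proj (𝕜 := ℝ) i).contDiff.comp contDiff_fst
      have h2 : ContDiff ℝ ∞ fun q : EuclideanSpace ℝ (Fin m) × EuclideanSpace ℝ (Fin m) => q.2 i' :=
        (EuclideanSpace.proj (𝕜 := ℝ) i').contDiff.comp contDiff_snd
      exact contDiff_snd.add (((contDiff_const.add (contDiff_const.mul (h1.sub contDiff_const))).sub
        h2).smul contDiff_const)
    exact hs.contMDiff.contMDiffAt.comp_contMDiffWithinAt
      (f := fun p : N × EuclideanSpace ℝ (Fin m) =>
        (p.2, coord e' (f p.1 (uncoord e (setCoord i 0 p.2))))) _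
      (contMDiffWithinAt_snd.prodMk_space hsm)
  · exact setCoord_mem zero_le_one (coord_mem e x₀)

end DoubleMap

/-! ### The smooth structure of the double -/

section DoubleStructure

variable {m : ℕ} {X : Type*} [TopologicalSpace X] [ChartedSpace (EuclideanQuadrant m) X]
  {F : Set X} {V : ∀ x : X, TangentSpace (cornerModel m) x}

/-- The charts that define the smooth structure of the double. -/
inductive IsDoubleChart (hF : IsClosed F) (V : ∀ x : X, TangentSpace (cornerModel m) x) :
    OpenPartialHomeomorph (Double X F) (EuclideanQuadrant m) → Prop
  | copy (b : Bool) (e : OpenPartialHomeomorph X (EuclideanQuadrant m))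
      (he : e ∈ IsManifold.maximalAtlas (cornerModel m) ∞ X) : IsDoubleChart hF V (copyChart hF b e)
  | double (e : OpenPartialHomeomorph X (EuclideanQuadrant m)) (i : Fin m)
      (h : IsStraight F V e i) : IsDoubleChart hF V (doubleChart h.face h.lt_one)

variable {hF : IsClosed F} {c c' : OpenPartialHomeomorph (Double X F) (EuclideanQuadrant m)}

theorem labelSign_mul_self (b : Bool) : labelSign b * labelSign b = 1 := by
  cases b <;> simp [labelSign]

theorem contDiff_setCoord_smul {i : Fin m} (s r t : ℝ) : ContDiff ℝ ∞
    fun z : EuclideanSpace ℝ (Fin m) => setCoord i (r + s * (z i - t)) z := by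
  have h : ContDiff ℝ ∞ fun z : EuclideanSpace ℝ (Fin m) => z i :=
    (EuclideanSpace.proj (𝕜 := ℝ) i).contDiff
  exact contDiff_id.add (((contDiff_const.add (contDiff_const.mul (h.sub contDiff_const))).sub
    h).smul contDiff_const)

theorem eventually_coord_doubleChart_incl {e : OpenPartialHomeomorph X (EuclideanQuadrant m)}
    {i : Fin m} (h : IsStraight F V e i) (b : Bool) {x : X} (hx : x ∈ e.source) :
    (fun y => coord (doubleChart h.face h.lt_one) (Double.incl F b y)) =ᶠ[𝓝 x]
      (fun z => setCoord i (1 + labelSign b * (z i - 0)) z) ∘ coord e := by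
  filter_upwards [e.open_source.mem_nhds hx] with y hy
  rw [coord_doubleChart _ _ _ hy, comp_apply, sub_zero]

theorem IsDoubleChart.contMDiffAt_coord_incl (hc : IsDoubleChart hF V c) {b : Bool} {x : X}
    (hx : Double.incl F b x ∈ c.source) :
    ContMDiffAt (cornerModel m) 𝓘(ℝ, EuclideanSpace ℝ (Fin m)) ∞
      (fun y => coord c (Double.incl F b y)) x := by
  induction hc with
  | copy b' e he =>
    obtain ⟨y, hy, hyx⟩ := hx
    obtain ⟨rfl, -⟩ := Double.incl_eq_incl_iff.1 hyx
    exact contMDiffAt_coord he hy.1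
  | double e i h =>
    refine ContMDiffAt.congr_of_eventuallyEq ?_ (eventually_coord_doubleChart_incl h b hx)
    exact (contDiff_setCoord_smul (labelSign b) 1 0).contMDiff.contMDiffAt.comp x
      (contMDiffAt_coord h.mem hx)

/-- Off F one has w i ≠ 1 in a doubled chart, and there |w i - 1| is smooth. -/
theorem IsDoubleChart.contMDiffWithinAt_fold_uncoord (hc : IsDoubleChart hF V c) {b : Bool} {x : X}
    (hxF : x ∉ F) (hx : Double.incl F b x ∈ c.source) :
    ContMDiffWithinAt 𝓘(ℝ, EuclideanSpace ℝ (Fin m)) (cornerModel m) ∞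
      (fun w => Double.fold F (uncoord c w)) (quadrant m) (coord c (Double.incl F b x)) := by
  induction hc with
  | copy b' e he =>
    obtain ⟨y, hy, hyx⟩ := hx
    obtain ⟨rfl, -⟩ := Double.incl_eq_incl_iff.1 hyx
    exact contMDiffWithinAt_uncoord he hy.1
  | double e i h =>
    have hxe : x ∈ e.source := hx
    have hne : coord e x i ≠ 0 := fun h0 => hxF ((h.face x hxe).2 h0)
    rw [coord_doubleChart _ _ _ hxe]
    set w₀ := setCoord i (1 + labelSign b * coord e x i) (coord e x) with hw₀
    have hw₀i : w₀ i - 1 ≠ 0 := by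
      rw [hw₀, setCoord_same, add_sub_cancel_left]
      refine mul_ne_zero ?_ hne
      cases b <;> simp [labelSign]
    have hf₀ : foldCoord i w₀ = coord e x := foldCoord_setCoord b (coord_mem e x i)
    have h1 : ContDiffAt ℝ ∞ (foldCoord i) w₀ := by
      have h2 : ContDiff ℝ ∞ fun z : EuclideanSpace ℝ (Fin m) => z i :=
        (EuclideanSpace.proj (𝕜 := ℝ) i).contDiff
      have h3 : ContDiffAt ℝ ∞ (fun z : EuclideanSpace ℝ (Fin m) => |z i - 1|) w₀ :=
        ContDiffAt.comp (g := fun t : ℝ => |t|) (f := fun z : EuclideanSpace ℝ (Fin m) => z i - 1) w₀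
          (contDiffAt_abs hw₀i) (h2.sub contDiff_const).contDiffAt
      exact contDiffAt_id.add ((h3.sub h2.contDiffAt).smul contDiffAt_const)
    have h2 : ContMDiffWithinAt 𝓘(ℝ, EuclideanSpace ℝ (Fin m)) (cornerModel m) ∞ (uncoord e)
        (quadrant m) (foldCoord i w₀) := by
      rw [hf₀]
      exact contMDiffWithinAt_uncoord h.mem hxe
    have h3 := ContMDiffWithinAt.comp (g := uncoord e) w₀ h2
      h1.contDiffWithinAt.contMDiffWithinAt fun w hw => foldCoord_mem hw
    have h4 : ∀ w ∈ quadrant m, Double.fold F (uncoord (doubleChart h.face h.lt_one) w) =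
        uncoord e (foldCoord i w) := fun w hw => by rw [uncoord_doubleChart _ _ hw, Double.fold_incl]
    exact h3.congr h4 (h4 _ (setCoord_mem
      (one_add_labelSign_mul_pos b (coord_mem e x i) (h.lt_one x hxe)).le (coord_mem e x)))

theorem Double.eventually_eq_incl_fold (hF : IsClosed F) (b : Bool) {x : X} (hx : x ∉ F) :
    ∀ᶠ d in 𝓝 (Double.incl F b x), d = Double.incl F b (Double.fold F d) := by
  filter_upwards [(Double.isOpen_image_incl b hF.isOpen_compl disjoint_compl_left).mem_nhds
    ⟨x, hx, rfl⟩] with d hd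
  obtain ⟨y, -, rfl⟩ := hd
  rfl

/-- At a point of F both charts are doubled straight charts, and the transition is the identity of
X, which preserves the field. Off F the transition factors through X. -/
theorem IsDoubleChart.contDiffWithinAt_transition (hc : IsDoubleChart hF V c)
    (hc' : IsDoubleChart hF V c') {d : Double X F} (hd : d ∈ c.source) (hd' : d ∈ c'.source) :
    ContDiffWithinAt ℝ ∞ (coord c' ∘ uncoord c) (quadrant m) (coord c d) := by
  obtain ⟨b, x, rfl⟩ := Double.exists_incl d
  rw [← contMDiffWithinAt_iff_contDiffWithinAt]
  by_cases hx : x ∈ F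
  · induction hc with
    | copy b₁ e he =>
      obtain ⟨y, hy, hyx⟩ := hd
      exact absurd (by rwa [← (Double.incl_eq_incl_iff.1 hyx).1] at hx) hy.2
    | double e i h =>
      induction hc' with
      | copy b₁ e he =>
        obtain ⟨y, hy, hyx⟩ := hd'
        exact absurd (by rwa [← (Double.incl_eq_incl_iff.1 hyx).1] at hx) hy.2
      | double e' i' h' =>
        -- A single map needs no parameter; ℝ is a dummy.
        have h1 := contMDiffWithinAt_coord_map (J := 𝓘(ℝ, ℝ)) (N := ℝ) h h' (f := fun _ => id)
          contMDiff_snd (fun _ _ hx => hx) (fun _ x => by rw [mfderiv_id]; rfl)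
          (σ := id) (τ := 1) (fun b => (one_mul _).symm) (n₀ := 0) hx hd hd' b
        have h2 := ContMDiffWithinAt.comp
          (f := fun w : EuclideanSpace ℝ (Fin m) => ((0 : ℝ), w)) (s := quadrant m)
          (coord (doubleChart h.face h.lt_one) (Double.incl F b x)) h1
          (contMDiffWithinAt_const.prodMk contMDiffWithinAt_id) fun w hw => ⟨trivial, hw⟩
        refine h2.congr_of_mem (fun w hw => ?_) (coord_mem _ _)
        simp only [comp_apply, Double.map_id_id]
  · have h1 : ContMDiffAt (cornerModel m) 𝓘(ℝ, EuclideanSpace ℝ (Fin m)) ∞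
        (fun y => coord c' (Double.incl F b y))
        (Double.fold F (uncoord c (coord c (Double.incl F b x)))) := by
      rw [uncoord_coord hd]
      exact hc'.contMDiffAt_coord_incl hd'
    have h2 := ContMDiffAt.comp_contMDiffWithinAt
      (f := fun w => Double.fold F (uncoord c w)) _ h1 (hc.contMDiffWithinAt_fold_uncoord hx hd)
    refine h2.congr_of_eventuallyEq_of_mem ?_ (coord_mem _ _)
    refine Eventually.filter_mono nhdsWithin_le_nhds ?_
    filter_upwards [(tendsto_uncoord hd).eventually (Double.eventually_eq_incl_fold hF b hx)]
      with w hw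
    exact congrArg (coord c') hw

/-- The smooth structure of a double, for a field that points into `X` along `F`. -/
structure IsDoubleStructure (hF : IsClosed F) (V : ∀ x : X, TangentSpace (cornerModel m) x)
    [ChartedSpace (EuclideanQuadrant m) (Double X F)] : Prop where
  isManifold : IsManifold (cornerModel m) ∞ (Double X F)
  mem_maximalAtlas : ∀ c, IsDoubleChart hF V c → c ∈ IsManifold.maximalAtlas (cornerModel m) ∞ (Double X F)
  exists_isStraight : ∀ p ∈ F, ∃ e i, p ∈ e.source ∧ IsStraight F V e i

theorem exists_isDoubleStructure [IsManifold (cornerModel m) ∞ X] (hF : IsFaceSet m F)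
    (hV : IsSmoothField m V) (hVF : ∀ x, PointsInto m F x (V x)) :
    ∃ _ : ChartedSpace (EuclideanQuadrant m) (Double X F), IsDoubleStructure hF.isClosed V := by
  have h1 : ∀ d : Double X F, ∃ c, IsDoubleChart hF.isClosed V c ∧ d ∈ c.source := by
    intro d
    obtain ⟨b, x, rfl⟩ := Double.exists_incl d
    by_cases hx : x ∈ F
    · obtain ⟨e, i, hxe, h⟩ := CornerDoubling.exists_isStraight hF hV hVF hx
      exact ⟨_, .double e i h, hxe⟩
    · exact ⟨_, .copy b (chartAt _ x) (IsManifold.chart_mem_maximalAtlas x),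
        ⟨x, ⟨mem_chart_source _ x, hx⟩, rfl⟩⟩
  choose ch hch hmem using h1
  let _ : ChartedSpace (EuclideanQuadrant m) (Double X F) :=
    { atlas := {c | IsDoubleChart hF.isClosed V c}
      chartAt := ch
      mem_chart_source := hmem
      chart_mem_atlas := hch }
  have h2 : IsManifold (cornerModel m) ∞ (Double X F) :=
    isManifold_of_contDiffOn (cornerModel m) ∞ (Double X F) fun c c' hc hc' =>
      contDiffOn_transition fun d hd hd' => IsDoubleChart.contDiffWithinAt_transition hc hc' hd hd'
  exact ⟨inferInstance, h2, fun c hc => IsManifold.subset_maximalAtlas hc,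
    fun p hp => CornerDoubling.exists_isStraight hF hV hVF hp⟩

end DoubleStructure

/-! ### The copies are smoothly embedded -/

section DoubleIncl

/-- A map into a manifold with corners that is smooth in coordinates is smooth. -/
theorem contMDiffAt_of_coord {m : ℕ} {X : Type*} [TopologicalSpace X]
    [ChartedSpace (EuclideanQuadrant m) X] {EN : Type*} [NormedAddCommGroup EN] [NormedSpace ℝ EN] {HN : Type*}
    [TopologicalSpace HN] {J : ModelWithCorners ℝ EN HN} {N : Type*} [TopologicalSpace N]
    [ChartedSpace HN N] {c : OpenPartialHomeomorph X (EuclideanQuadrant m)}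
    (hc : c ∈ IsManifold.maximalAtlas (cornerModel m) ∞ X) {f : N → X} {n : N}
    (hn : ∀ᶠ y in 𝓝 n, f y ∈ c.source)
    (h : ContMDiffAt J 𝓘(ℝ, EuclideanSpace ℝ (Fin m)) ∞ (fun y => coord c (f y)) n) :
    ContMDiffAt J (cornerModel m) ∞ f n := by
  have h1 := ContMDiffWithinAt.comp (g := uncoord c) (s := univ) n
    (contMDiffWithinAt_uncoord hc hn.self_of_nhds) h.contMDiffWithinAt fun y _ => coord_mem c _
  rw [contMDiffWithinAt_univ] at h1
  refine h1.congr_of_eventuallyEq ?_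
  filter_upwards [hn] with y hy using (uncoord_coord hy).symm

variable {m : ℕ} {X : Type*} [TopologicalSpace X] [ChartedSpace (EuclideanQuadrant m) X]
  [IsManifold (cornerModel m) ∞ X]
  {F : Set X} {V : ∀ x : X, TangentSpace (cornerModel m) x} {hF : IsClosed F}
  [ChartedSpace (EuclideanQuadrant m) (Double X F)]

theorem IsDoubleStructure.exists_isDoubleChart (h : IsDoubleStructure hF V) (d : Double X F) :
    ∃ c, IsDoubleChart hF V c ∧ d ∈ c.source := by
  obtain ⟨b, x, rfl⟩ := Double.exists_incl d
  by_cases hx : x ∈ F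
  · obtain ⟨e, i, hxe, h⟩ := h.exists_isStraight x hx
    exact ⟨_, .double e i h, hxe⟩
  · exact ⟨_, .copy b (chartAt _ x) (IsManifold.chart_mem_maximalAtlas x),
      ⟨x, ⟨mem_chart_source _ x, hx⟩, rfl⟩⟩

theorem IsDoubleStructure.contMDiff_incl (h : IsDoubleStructure hF V) (b : Bool) :
    ContMDiff (cornerModel m) (cornerModel m) ∞ (Double.incl F b) := fun x => by
  have := h.isManifold
  obtain ⟨c, hc, hx⟩ := h.exists_isDoubleChart (Double.incl F b x)
  exact contMDiffAt_of_coord (h.mem_maximalAtlas c hc) ((Double.continuous_incl b).continuousAt.eventually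
    (c.open_source.mem_nhds hx)) (hc.contMDiffAt_coord_incl hx)

theorem IsDoubleStructure.contMDiffAt_fold (h : IsDoubleStructure hF V) {b : Bool} {x : X}
    (hx : x ∉ F) : ContMDiffAt (cornerModel m) (cornerModel m) ∞ (Double.fold F)
      (Double.incl F b x) := by
  have := h.isManifold
  obtain ⟨c, hc, hxc⟩ := h.exists_isDoubleChart (Double.incl F b x)
  have h1 := ContMDiffWithinAt.comp (f := coord c) (s := univ) (Double.incl F b x)
    (hc.contMDiffWithinAt_fold_uncoord hx hxc)
    (contMDiffAt_coord (h.mem_maximalAtlas c hc) hxc).contMDiffWithinAt fun y _ => coord_mem c _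
  rw [contMDiffWithinAt_univ] at h1
  refine h1.congr_of_eventuallyEq ?_
  filter_upwards [c.open_source.mem_nhds hxc] with y hy
  simp only [comp_apply, uncoord_coord hy]

/-- It suffices to have a map on the double whose composite with the inclusion is a chart of X near
x. Off F folding provides it; near F the affine change of the i-th coordinate is undone. -/
theorem IsDoubleStructure.injective_mfderiv_incl (h : IsDoubleStructure hF V) (b : Bool) (x : X) :
    Injective (mfderiv (cornerModel m) (cornerModel m) (Double.incl F b) x) := by
  have h₀ := (h.contMDiff_incl b x).mdifferentiableAt (by simp)
  suffices H : ∃ g : Double X F → EuclideanSpace ℝ (Fin m),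
      MDifferentiableAt (cornerModel m) 𝓘(ℝ, EuclideanSpace ℝ (Fin m)) g (Double.incl F b x) ∧
      Injective (mfderiv (cornerModel m) 𝓘(ℝ, EuclideanSpace ℝ (Fin m))
        (fun y => g (Double.incl F b y)) x) by
    obtain ⟨g, hg, hgi⟩ := H
    have h1 := mfderiv_comp x hg h₀
    intro v w hvw
    apply hgi
    have h2 : mfderiv (cornerModel m) 𝓘(ℝ, EuclideanSpace ℝ (Fin m)) (g ∘ Double.incl F b) x v =
        mfderiv (cornerModel m) 𝓘(ℝ, EuclideanSpace ℝ (Fin m)) (g ∘ Double.incl F b) x w := by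
      rw [h1, ContinuousLinearMap.comp_apply, ContinuousLinearMap.comp_apply, hvw]
    exact h2
  have := h.isManifold
  by_cases hx : x ∈ F
  · obtain ⟨e, i, hxe, hs⟩ := h.exists_isStraight x hx
    have h1 := (contDiff_setCoord_smul (i := i) (labelSign b) 0 1).contMDiff.contMDiffAt.comp _
      (contMDiffAt_coord (h.mem_maximalAtlas _ (.double e i hs)) (x := Double.incl F b x) hxe)
    refine ⟨_, h1.mdifferentiableAt (by simp), ?_⟩
    have heq : (fun y => ((fun z => setCoord i (0 + labelSign b * (z i - 1)) z) ∘
        coord (doubleChart hs.face hs.lt_one)) (Double.incl F b y)) =ᶠ[𝓝 x] coord e := by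
      filter_upwards [e.open_source.mem_nhds hxe] with y hy
      simp only [comp_apply]
      rw [coord_doubleChart _ _ _ hy, setCoord_setCoord, setCoord_same, add_sub_cancel_left,
        ← mul_assoc, labelSign_mul_self, one_mul, zero_add, setCoord_self]
    rw [heq.mfderiv_eq]
    exact (bijective_dcoord hs.mem hxe).1
  · have hxs := mem_chart_source (EuclideanQuadrant m) x
    have hm := IsManifold.chart_mem_maximalAtlas (I := cornerModel m) (n := ∞) x
    refine ⟨fun d => coord (chartAt (EuclideanQuadrant m) x) (Double.fold F d), ?_, ?_⟩
    · exact ((contMDiffAt_coord hm hxs).comp (Double.incl F b x)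
        (h.contMDiffAt_fold (b := b) hx)).mdifferentiableAt (n := ∞) (by simp)
    · exact (bijective_dcoord hm hxs).1

theorem IsDoubleStructure.isSmoothCornerEmbedding [CompactSpace X] [T2Space X]
    (h : IsDoubleStructure hF V) (b : Bool) : IsSmoothCornerEmbedding m (Double.incl F b) :=
  ⟨h.contMDiff_incl b, Double.isEmbedding_incl hF b, h.injective_mfderiv_incl b⟩

end DoubleIncl

/-! ### Faces of the double -/

section DoubleFaces

variable {m : ℕ} {X : Type*} [TopologicalSpace X] [ChartedSpace (EuclideanQuadrant m) X]
  [IsManifold (cornerModel m) ∞ X] {l : ℕ} {F : Fin (l + 1) → Set X}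
  {V : ∀ x : X, TangentSpace (cornerModel m) x} {hF : IsClosed (F 0)}

theorem IsDoubleStructure.mem_codimOnePart_iff {F : Set X} {hF : IsClosed F}
    [ChartedSpace (EuclideanQuadrant m) (Double X F)] (h : IsDoubleStructure hF V) {b : Bool}
    {x : X} (hx : x ∉ F) : Double.incl F b x ∈ codimOnePart m (Double X F) ↔ x ∈ codimOnePart m X := by
  have := h.isManifold
  have he := IsManifold.chart_mem_maximalAtlas (I := cornerModel m) (n := ∞) x
  have hxe := mem_chart_source (EuclideanQuadrant m) x
  rw [CornerDoubling.mem_codimOnePart_iff he hxe, CornerDoubling.mem_codimOnePart_iff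
    (h.mem_maximalAtlas _ (.copy b _ he)) ⟨x, ⟨hxe, hx⟩, rfl⟩]
  rfl

/-- Different members of a face system use different coordinates, so doubling, which alters only the
i-th one, keeps the equation of F k.succ. -/
theorem IsStraight.exists_index {e : OpenPartialHomeomorph X (EuclideanQuadrant m)} {i : Fin m}
    (hs : IsStraight (F 0) V e i) (hsys : IsFaceSystem m F) {p : X} (hpe : p ∈ e.source)
    (hp : p ∈ F 0) {k : Fin l} (hpk : p ∈ F k.succ) :
    ∃ i', i' ≠ i ∧ coord e p i' = 0 ∧ ∀ᶠ u in 𝓝 p, (u ∈ F k.succ ↔ coord e u i' = 0) := by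
  obtain ⟨i', hi', hFi'⟩ := (hsys.isFaceSet k.succ).exists_index hpk hs.mem hpe
  have h1 : ∀ᶠ u in 𝓝 p, (u ∈ F 0 ↔ coord e u i = 0) := by
    filter_upwards [e.open_source.mem_nhds hpe] with u hu using hs.face u hu
  exact ⟨i', (hsys.index_ne (Fin.succ_ne_zero k).symm hp h1 hFi').symm, hi', hFi'⟩

variable [ChartedSpace (EuclideanQuadrant m) (Double X (F 0))]

/-- On F 0 the i-th doubled coordinate is 1, so F 0 is no longer a boundary face, while the
equations of the other faces are unchanged. -/
theorem IsDoubleStructure.isFaceSystem (h : IsDoubleStructure hF V) (hsys : IsFaceSystem m F) :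
    IsFaceSystem m (fun k : Fin l => Double.fold (F 0) ⁻¹' F k.succ) := by
  have := h.isManifold
  refine ⟨fun k => ⟨(hsys.isFaceSet k.succ).isClosed.preimage Double.continuous_fold, ?_⟩, ?_, ?_⟩
  · intro d hd
    obtain ⟨b, p, rfl⟩ := Double.exists_incl d
    have hpk : p ∈ F k.succ := hd
    by_cases hp : p ∈ F 0
    · obtain ⟨e, i, hpe, hs⟩ := h.exists_isStraight p hp
      obtain ⟨i', hne, hi', hFi'⟩ := hs.exists_index hsys hpe hp hpk
      refine ⟨_, h.mem_maximalAtlas _ (.double e i hs), hpe, i', ?_, ?_⟩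
      · rw [coord_doubleChart _ _ _ hpe, setCoord_of_ne hne, hi']
      · have h1 : Tendsto (Double.fold (F 0)) (𝓝 (Double.incl (F 0) b p)) (𝓝 p) :=
          Double.continuous_fold.tendsto _
        filter_upwards [h1.eventually hFi', h1.eventually (e.open_source.mem_nhds hpe)] with d hd hde
        obtain ⟨b', u, rfl⟩ := Double.exists_incl d
        have hue : u ∈ e.source := hde
        rw [coord_doubleChart _ _ _ hue, setCoord_of_ne hne]
        exact hd
    · have he := IsManifold.chart_mem_maximalAtlas (I := cornerModel m) (n := ∞) p
      have hpe := mem_chart_source (EuclideanQuadrant m) p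
      obtain ⟨i, hi, hFi⟩ := (hsys.isFaceSet k.succ).exists_index hpk he hpe
      refine ⟨_, h.mem_maximalAtlas _ (.copy b _ he), ⟨p, ⟨hpe, hp⟩, rfl⟩, i, hi, ?_⟩
      have h1 : Tendsto (Double.fold (F 0)) (𝓝 (Double.incl (F 0) b p)) (𝓝 p) :=
        Double.continuous_fold.tendsto _
      exact h1.eventually hFi
  · intro d hd
    obtain ⟨b, p, rfl⟩ := Double.exists_incl d
    by_cases hp : p ∈ F 0
    · obtain ⟨e, i, hpe, hs⟩ := h.exists_isStraight p hp
      obtain ⟨i', hi'⟩ := exists_coord_eq_zero_of_mem_codimOnePart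
        (h.mem_maximalAtlas _ (.double e i hs)) hpe hd
      rw [coord_doubleChart _ _ _ hpe] at hi'
      have hne : i' ≠ i := by
        rintro rfl
        rw [setCoord_same, (hs.face p hpe).1 hp] at hi'
        simp at hi'
      rw [setCoord_of_ne hne] at hi'
      obtain ⟨U, hU, hpU, hUe, S, hS, -⟩ := exists_localFaces hs.mem hpe univ_mem
      -- The open i'-th face near p consists of points of codimension one that are not in F 0, so
      -- the other members cover it; their union is closed and thus contains p.
      have hsub : S i' ⊆ ⋃ k : Fin l, F k.succ := by
        intro u hu
        obtain ⟨k, hk⟩ := hsys.exists_mem u ((hS i').2.1 hu)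
        have huU := (hS i').2.2.1 u hu
        have hue := (hUe huU.1).1
        refine k.cases (motive := fun k => u ∈ F k → u ∈ ⋃ k : Fin l, F k.succ) (fun h0 => ?_)
          (fun j hj => mem_iUnion.2 ⟨j, hj⟩) hk
        exact absurd (codimOnePart_unique hs.mem hue ((hS i').2.1 hu) huU.2 ((hs.face u hue).1 h0)) hne
      have hcl : IsClosed (⋃ k : Fin l, F k.succ) :=
        isClosed_iUnion_of_finite fun k => (hsys.isFaceSet k.succ).isClosed
      have hp' : p ∈ ⋃ k : Fin l, F k.succ := hcl.closure_subset_iff.2 hsub ((hS i').2.2.2 p hpU hi')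
      obtain ⟨k, hk⟩ := mem_iUnion.1 hp'
      exact ⟨k, hk⟩
    · obtain ⟨k, hk⟩ := hsys.exists_mem p ((h.mem_codimOnePart_iff hp).1 hd)
      exact k.cases (motive := fun k => p ∈ F k → ∃ j : Fin l, p ∈ F j.succ) (fun h0 => absurd h0 hp)
          (fun j hj => ⟨j, hj⟩) hk
  · intro d hd j k hj hk
    obtain ⟨b, p, rfl⟩ := Double.exists_incl d
    by_cases hp : p ∈ F 0
    · obtain ⟨e, i, hpe, hs⟩ := h.exists_isStraight p hp
      obtain ⟨i₁, hne₁, hi₁, hFi₁⟩ := hs.exists_index hsys hpe hp hj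
      obtain ⟨i₂, hne₂, hi₂, hFi₂⟩ := hs.exists_index hsys hpe hp hk
      have h12 : i₁ = i₂ := by
        refine codimOnePart_unique (h.mem_maximalAtlas _ (.double e i hs)) hpe hd ?_ ?_
        · rw [coord_doubleChart _ _ _ hpe, setCoord_of_ne hne₁, hi₁]
        · rw [coord_doubleChart _ _ _ hpe, setCoord_of_ne hne₂, hi₂]
      by_contra hjk
      exact hsys.index_ne (fun h => hjk (Fin.succ_injective l h)) hj hFi₁ hFi₂ h12
    · exact Fin.succ_injective l
        (hsys.eq_of_mem p ((h.mem_codimOnePart_iff hp).1 hd) _ _ hj hk)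

end DoubleFaces

/-! ### Diffeomorphisms and boundary hypersurfaces -/

section BoundaryImage

variable {m : ℕ} {X : Type*} [TopologicalSpace X] [ChartedSpace (EuclideanQuadrant m) X]
  [IsManifold (cornerModel m) ∞ X]

/-- Diffeomorphisms permute the boundary hypersurfaces. -/
theorem image_mem_boundaryHypersurfaces (φ : X ≃ₜ X)
    (hφ : ContMDiff (cornerModel m) (cornerModel m) ∞ φ)
    (hφ' : ContMDiff (cornerModel m) (cornerModel m) ∞ φ.symm) {H : Set X}
    (hH : H ∈ boundaryHypersurfaces m X) : φ '' H ∈ boundaryHypersurfaces m X := by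
  have hmem : ∀ x, φ x ∈ codimOnePart m X ↔ x ∈ codimOnePart m X := by
    intro x
    rw [mem_codimOnePart_iff (IsManifold.chart_mem_maximalAtlas x) (mem_chart_source _ x),
      mem_codimOnePart_iff (IsManifold.chart_mem_maximalAtlas (φ x)) (mem_chart_source _ (φ x)),
      codim_eq_of_inverse (hφ x) (hφ' (φ x)) (Eventually.of_forall φ.symm_apply_apply)
        (Eventually.of_forall φ.apply_symm_apply) (IsManifold.chart_mem_maximalAtlas x)
        (mem_chart_source _ x) (IsManifold.chart_mem_maximalAtlas (φ x)) (mem_chart_source _ (φ x))]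
  obtain ⟨x, hx, rfl⟩ := hH
  refine ⟨φ x, (hmem x).2 hx, ?_⟩
  have himg : φ '' codimOnePart m X = codimOnePart m X := by
    ext y
    constructor
    · rintro ⟨x, hx, rfl⟩
      exact (hmem x).2 hx
    · intro hy
      refine ⟨φ.symm y, ?_, φ.apply_symm_apply y⟩
      rw [← hmem, φ.apply_symm_apply]
      exact hy
  rw [φ.image_closure, φ.image_connectedComponentIn hx, himg]

end BoundaryImage

/-! ### The extended action on the double -/

section DoubleAction

/-- The action of `ℤ₂` on the labels of the two copies. -/
def flipLabel (ε : Multiplicative (ZMod 2)) (b : Bool) : Bool := if ε = 1 then b else !b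

theorem flipLabel_mul (ε ε' : Multiplicative (ZMod 2)) (b : Bool) :
    flipLabel (ε * ε') b = flipLabel ε (flipLabel ε' b) := by
  revert ε ε' b
  decide

theorem labelSign_flipLabel (ε : Multiplicative (ZMod 2)) (b : Bool) :
    labelSign (flipLabel ε b) = (if ε = 1 then 1 else -1) * labelSign b := by
  by_cases h : ε = 1
  · simp [flipLabel, h]
  · cases b <;> simp [flipLabel, h, labelSign]

variable {m : ℕ} {X : Type*} {F : Set X} {Γ G : Type*} [Group Γ] [Group G] [MulAction (Γ × G) X]

/-- The action on the double for which `ℤ₂` interchanges the two copies. -/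
@[reducible]
def doubleAction (hF : ∀ (k : Γ × G), ∀ x ∈ F, k • x ∈ F) :
    MulAction ((Multiplicative (ZMod 2) × Γ) × G) (Double X F) where
  smul k := Double.map (flipLabel k.1.1) (fun x => (k.1.2, k.2) • x) (hF _)
  one_smul d := by
    obtain ⟨b, x, rfl⟩ := Double.exists_incl d
    exact congrArg (Double.incl F b) (one_smul (Γ × G) x)
  mul_smul k k' d := by
    obtain ⟨b, x, rfl⟩ := Double.exists_incl d
    change Double.incl F (flipLabel (k.1.1 * k'.1.1) b) (((k.1.2, k.2) * (k'.1.2, k'.2) : Γ × G) • x) =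
      Double.incl F (flipLabel k.1.1 (flipLabel k'.1.1 b))
        (((k.1.2, k.2) : Γ × G) • ((k'.1.2, k'.2) : Γ × G) • x)
    rw [flipLabel_mul, mul_smul]

variable [TopologicalSpace X] [ChartedSpace (EuclideanQuadrant m) X]
  [IsManifold (cornerModel m) ∞ X] [ChartedSpace (EuclideanQuadrant m) (Double X F)]
  {E : Type*} [NormedAddCommGroup E] [NormedSpace ℝ E] [TopologicalSpace G] [ChartedSpace E G]
  {V : ∀ x : X, TangentSpace (cornerModel m) x} {hF : IsClosed F}

/-- At F this is the computation in straight charts with parameter in G and τ = ±1 according to the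
swap. Off F the action is folding, followed by the action on X and the inclusion of a copy. -/
theorem IsDoubleStructure.isSmoothAction (h : IsDoubleStructure hF V)
    (hact : IsSmoothAction m E Γ G X) (hFk : ∀ (k : Γ × G), ∀ x ∈ F, k • x ∈ F)
    (hVk : ∀ (k : Γ × G) (x : X),
      mfderiv (cornerModel m) (cornerModel m) (fun y => k • y) x (V x) = V (k • x)) :
    letI := doubleAction hFk
    IsSmoothAction m E (Multiplicative (ZMod 2) × Γ) G (Double X F) := by
  let _ := doubleAction hFk
  have := h.isManifold
  rintro ⟨ε, γ⟩ ⟨g, d⟩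
  obtain ⟨b, x, rfl⟩ := Double.exists_incl d
  change ContMDiffAt (𝓘(ℝ, E).prod (cornerModel m)) (cornerModel m) ∞
    (fun p : G × Double X F => Double.map (flipLabel ε) (fun x => ((γ, p.1) : Γ × G) • x) (hFk _) p.2)
      (g, Double.incl F b x)
  by_cases hx : x ∈ F
  · obtain ⟨e, i, hxe, hs⟩ := h.exists_isStraight x hx
    obtain ⟨e', i', hxe', hs'⟩ := h.exists_isStraight (((γ, g) : Γ × G) • x) (hFk _ x hx)
    have h1 := contMDiffWithinAt_coord_map (J := 𝓘(ℝ, E)) (N := G) hs hs'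
      (f := fun g x => ((γ, g) : Γ × G) • x) (hact γ) (fun g => hFk (γ, g)) (fun g => hVk (γ, g))
      (labelSign_flipLabel ε) hx hxe hxe' b
    have h2 : ContMDiffAt (𝓘(ℝ, E).prod (cornerModel m)) (𝓘(ℝ, E).prod 𝓘(ℝ, EuclideanSpace ℝ (Fin m))) ∞
        (fun p : G × Double X F => (p.1, coord (doubleChart hs.face hs.lt_one) p.2))
        (g, Double.incl F b x) := by
      refine contMDiffAt_fst.prodMk ?_
      exact ContMDiffAt.comp (g := coord (doubleChart hs.face hs.lt_one)) (g, Double.incl F b x)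
        (contMDiffAt_coord (h.mem_maximalAtlas _ (.double e i hs)) hxe) contMDiffAt_snd
    have h3 := ContMDiffWithinAt.comp (s := univ) (g, Double.incl F b x) h1 h2.contMDiffWithinAt
      fun p _ => mk_mem_prod (mem_univ _) (coord_mem _ p.2)
    rw [contMDiffWithinAt_univ] at h3
    refine contMDiffAt_of_coord (h.mem_maximalAtlas _ (.double e' i' hs')) ?_
      (h3.congr_of_eventuallyEq ?_)
    · have h4 : Tendsto (fun p : G × Double X F => ((γ, p.1) : Γ × G) • Double.fold F p.2)
          (𝓝 (g, Double.incl F b x)) (𝓝 (((γ, g) : Γ × G) • x)) :=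
        ((hact γ).continuous.comp
          (continuous_fst.prodMk (Double.continuous_fold.comp continuous_snd))).tendsto
            (g, Double.incl F b x)
      filter_upwards [h4.eventually (e'.open_source.mem_nhds hxe')] with p hp
      change Double.fold F (Double.map _ _ _ p.2) ∈ e'.source
      rw [Double.fold_map]
      exact hp
    · filter_upwards [(continuous_snd (X := G)).continuousAt.eventually
        ((doubleChart hs.face hs.lt_one).open_source.mem_nhds hxe)] with p hp
      exact congrArg (fun d => coord (doubleChart hs'.face hs'.lt_one) (Double.map (flipLabel ε)
        (fun x => ((γ, p.1) : Γ × G) • x) (hFk _) d))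
        (uncoord_coord (e := doubleChart hs.face hs.lt_one) hp).symm
  · have h1 : ContMDiffAt (𝓘(ℝ, E).prod (cornerModel m)) (𝓘(ℝ, E).prod (cornerModel m)) ∞
        (fun p : G × Double X F => (p.1, Double.fold F p.2)) (g, Double.incl F b x) := by
      refine contMDiffAt_fst.prodMk ?_
      exact ContMDiffAt.comp (g := Double.fold F) (g, Double.incl F b x) (h.contMDiffAt_fold hx)
        contMDiffAt_snd
    have h2 := ((h.contMDiff_incl (flipLabel ε b)).comp (hact γ)).contMDiffAt.comp
      (g, Double.incl F b x) h1
    refine h2.congr_of_eventuallyEq ?_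
    filter_upwards [(continuous_snd (X := G)).continuousAt.eventually
      (Double.eventually_eq_incl_fold hF b hx)] with p hp
    rw [hp, Double.map_incl]
    rfl

end DoubleAction

/-! ### Density of the complement of a face set -/

section FaceComplement

variable {m : ℕ} {X : Type*} [TopologicalSpace X] [ChartedSpace (EuclideanQuadrant m) X]

/-- A point of F is a limit of points whose i-th coordinate is positive. -/
theorem IsFaceSet.dense_compl {F : Set X} (hF : IsFaceSet m F) : Dense Fᶜ := by
  intro p
  by_cases hp : p ∈ F
  · obtain ⟨e, he, hpe, i, hi, hFi⟩ := hF.exists_chart p hp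
    have hw : ∀ r, coord e p r = 0 → 0 ≤ (EuclideanSpace.single i (1 : ℝ)) r := fun r _ => by
      by_cases h : r = i <;> simp [h]
    have hc : Continuous fun t : ℝ => coord e p + t • EuclideanSpace.single i (1 : ℝ) := by fun_prop
    have h0 : Tendsto (fun t : ℝ => coord e p + t • EuclideanSpace.single i (1 : ℝ)) (𝓝[>] 0)
        (𝓝 (coord e p)) := (hc.tendsto' 0 _ (by simp)).mono_left nhdsWithin_le_nhds
    have h1 := (tendsto_uncoord hpe).comp h0
    refine mem_closure_of_tendsto h1 ?_
    filter_upwards [h1.eventually hFi, h0.eventually (eventually_symm_mem_target hpe),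
      (eventually_add_smul_mem_quadrant (coord_mem e p) hw).filter_mono
        (nhdsWithin_mono _ Ioi_subset_Ici_self), self_mem_nhdsWithin] with t h2 h3 h4 h5 h6
    have h7 := h2.1 h6
    simp only [comp_apply] at h7
    rw [coord_uncoord h4 h3] at h7
    have h8 : t = 0 := by simpa [hi] using h7
    exact (mem_Ioi.1 h5).ne' h8
  · exact _root_.subset_closure hp

end FaceComplement

/-! ### Fundamental domains under doubling -/

section FundamentalDomain

variable {X Y K A A' : Type*} [TopologicalSpace X] [CompactSpace X] [TopologicalSpace Y] [T2Space Y]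
  [Group K] [MulAction K Y] [Group A] [Group A']

/-- A fundamental domain for the action of a group through a homomorphism. -/
def IsFundamentalDomainVia (φ : A →* K) (D : Set Y) : Prop :=
  letI : MulAction A Y := MulAction.compHom Y φ
  IsFundamentalDomain A D

/-- If a double is a fundamental domain for `A`, then the first copy is a fundamental domain for
`ℤ₂ × A`. -/
theorem IsFundamentalDomainVia.double {F : Set X} (hF : IsClosed F) (hFd : Dense Fᶜ)
    {j : Double X F → Y} (hj : IsEmbedding j) {φ : A →* K} {φ' : A' →* K}
    (hD : IsFundamentalDomainVia φ (range j)) (ψ : Multiplicative (ZMod 2) →* K)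
    (hψ : ∀ ε b x, ψ ε • j (Double.incl F b x) = j (Double.incl F (flipLabel ε b) x))
    (t : A' → A) (s : A' → Multiplicative (ZMod 2)) (hts : ∀ a ε, ∃ a', t a' = a ∧ s a' = ε)
    (hone : ∀ a', t a' = 1 → s a' = 1 → a' = 1)
    (hφ' : ∀ a', φ' a' = φ (t a') * ψ (s a')) (hφ'' : ∀ a', φ' a' = ψ (s a') * φ (t a')) :
    IsFundamentalDomainVia φ' (range fun x => j (Double.incl F true x)) := by
  obtain ⟨hD1, hD2, hD3⟩ := hD
  have hsub : (range fun x => j (Double.incl F true x)) ⊆ range j := by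
    rintro _ ⟨x, rfl⟩
    exact mem_range_self _
  have hflip : ∀ ε : Multiplicative (ZMod 2), ε ≠ 1 → ∀ b, flipLabel ε b = !b := fun ε hε b =>
    if_neg hε
  let _ : MulAction A' Y := MulAction.compHom Y φ'
  refine IsFundamentalDomain.mk (Γ := A') ?_ ?_ ?_
  · have hcl : IsClosed (range fun x => j (Double.incl F true x)) :=
      (isCompact_range (hj.continuous.comp (Double.continuous_incl true))).isClosed
    refine Subset.antisymm (hcl.closure_subset_iff.2 interior_subset) ?_
    -- W is open in Y and meets the range of j exactly in the first copy without F, so points of W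
    -- interior to the range of j are interior to the first copy. The rest is density of the
    -- complement of F.
    obtain ⟨W, hW, hWO⟩ := hj.isOpen_iff.1
      (Double.isOpen_image_incl true hF.isOpen_compl disjoint_compl_left)
    have h1 : W ∩ interior (range j) ⊆ interior (range fun x => j (Double.incl F true x)) := by
      refine interior_maximal ?_ (hW.inter isOpen_interior)
      rintro y ⟨hyW, hy⟩
      obtain ⟨d, rfl⟩ := interior_subset hy
      have hd : d ∈ j ⁻¹' W := hyW
      rw [hWO] at hd
      obtain ⟨x, -, rfl⟩ := hd
      exact ⟨x, rfl⟩
    rintro _ ⟨x, rfl⟩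
    have h2 := image_closure_subset_closure_image
      (hj.continuous.comp (Double.continuous_incl (F := F) true)) ⟨x, hFd x, rfl⟩
    refine closure_minimal ?_ isClosed_closure h2
    rintro _ ⟨u, hu, rfl⟩
    have huW : j (Double.incl F true u) ∈ W := by
      have : Double.incl F true u ∈ j ⁻¹' W := by rw [hWO]; exact ⟨u, hu, rfl⟩
      exact this
    have h3 : j (Double.incl F true u) ∈ closure (interior (range j)) := by
      rw [hD1]; exact mem_range_self _
    exact closure_mono h1 (hW.inter_closure ⟨huW, h3⟩)
  -- After the swap both points lie in the range of j and in one A-orbit, so they agree there; the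
  -- underlying point of X does not see the swap.
  · have huniq : ∀ y y' a', y ∈ (range fun x => j (Double.incl F true x)) →
        y' ∈ (range fun x => j (Double.incl F true x)) → φ' a' • y = y' → y = y' := by
      rintro _ _ a' ⟨u, rfl⟩ ⟨v, rfl⟩ h
      dsimp only at h ⊢
      rw [hφ', mul_smul, hψ] at h
      have h1 := (hD2 (j (Double.incl F (flipLabel (s a') true) u))).unique
        ⟨mem_range_self _, ⟨1, by
          change φ 1 • j (Double.incl F (flipLabel (s a') true) u) = _
          rw [map_one, one_smul]⟩⟩
        ⟨mem_range_self (Double.incl F true v), ⟨t a', h⟩⟩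
      rw [(Double.incl_eq_incl_iff.1 (hj.injective h1)).1]
    intro y
    obtain ⟨_, ⟨⟨d, rfl⟩, a, ha⟩, -⟩ := hD2 y
    have ha' : φ a • y = j d := ha
    obtain ⟨b, x, rfl⟩ := Double.exists_incl d
    -- An element of A moves y into the range of j; if it lands in the second copy, the swap takes
    -- it to the first.
    obtain ⟨ε, hε⟩ := (by decide : ∀ b, ∃ ε, flipLabel ε b = true) b
    obtain ⟨a', rfl, rfl⟩ := hts a ε
    have hy : φ' a' • y = j (Double.incl F true x) := by
      rw [hφ'', mul_smul, ha', hψ, hε]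
    refine ⟨_, ⟨⟨x, rfl⟩, ⟨a', hy⟩⟩, ?_⟩
    rintro y' ⟨hy', a'', ha''⟩
    have ha'' : φ' a'' • y = y' := ha''
    refine (huniq _ _ (a'' * a'⁻¹) ⟨x, rfl⟩ hy' ?_).symm
    change φ' (a'' * a'⁻¹) • j (Double.incl F true x) = y'
    rw [map_mul, mul_smul, ← ha'', ← hy, map_inv, inv_smul_smul]
  · intro a' ha'
    rw [Set.disjoint_left]
    rintro _ ⟨_, ⟨u, rfl⟩, rfl⟩ hint
    change φ' a' • j (Double.incl F true u) ∈ _ at hint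
    rw [hφ', mul_smul, hψ] at hint
    -- If the A-component is trivial, a' is the swap. A point of the second copy in the interior of
    -- the first would have, by density, such points off F near it, where the copies are disjoint.
    -- Otherwise disjointness for the larger domain applies.
    by_cases ht : t a' = 1
    · have hs : s a' ≠ 1 := fun hs => ha' (hone a' ht hs)
      rw [ht, map_one, one_smul, hflip _ hs] at hint
      have hopen : IsOpen ((fun v => j (Double.incl F false v)) ⁻¹'
          interior (range fun x => j (Double.incl F true x))) :=
        isOpen_interior.preimage (hj.continuous.comp (Double.continuous_incl false))
      obtain ⟨v, hv, hvF⟩ := hFd.inter_open_nonempty _ hopen ⟨u, hint⟩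
      obtain ⟨w, hw⟩ := interior_subset (mem_preimage.1 hv)
      have h1 := Double.incl_eq_incl_iff.1 (hj.injective hw)
      refine hvF ?_
      rw [← h1.1]
      exact h1.2.resolve_left (by simp)
    · exact Set.disjoint_left.1 (hD3 (t a') ht) ⟨_, mem_range_self _, rfl⟩
        (interior_mono hsub hint)

end FundamentalDomain

/-! ### One doubling step -/

section Step

variable {m l : ℕ} {X : Type*} [TopologicalSpace X] [ChartedSpace (EuclideanQuadrant m) X]
  {E Γ G : Type*} [NormedAddCommGroup E] [NormedSpace ℝ E] [Group Γ] [Group G]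
  [TopologicalSpace G] [ChartedSpace E G] [MulAction (Γ × G) X]

theorem IsSmoothCornerEmbedding.comp {Y Z : Type*} [TopologicalSpace Y]
    [ChartedSpace (EuclideanQuadrant m) Y] [TopologicalSpace Z]
    [ChartedSpace (EuclideanQuadrant m) Z] {g : Y → Z} {f : X → Y}
    (hg : IsSmoothCornerEmbedding m g) (hf : IsSmoothCornerEmbedding m f) :
    IsSmoothCornerEmbedding m (fun x => g (f x)) := by
  refine ⟨hg.contMDiff.comp hf.contMDiff, hg.isEmbedding.comp hf.isEmbedding, fun x => ?_⟩
  have h := mfderiv_comp x ((hg.contMDiff (f x)).mdifferentiableAt (by simp))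
    ((hf.contMDiff x).mdifferentiableAt (by simp))
  intro v w hvw
  apply hf.injective_mfderiv x
  apply hg.injective_mfderiv (f x)
  have h2 : mfderiv (cornerModel m) (cornerModel m) (g ∘ f) x v =
      mfderiv (cornerModel m) (cornerModel m) (g ∘ f) x w := hvw
  rw [h] at h2
  exact h2

theorem IsSmoothCornerEmbedding.id : IsSmoothCornerEmbedding m (fun x : X => x) := by
  refine ⟨contMDiff_id, IsEmbedding.id, fun x => ?_⟩
  intro v w hvw
  have h : mfderiv (cornerModel m) (cornerModel m) (_root_.id : X → X) x v =
    mfderiv (cornerModel m) (cornerModel m) (_root_.id : X → X) x w := hvw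
  rw [mfderiv_id] at h
  exact h

theorem IsSmoothAction.image_mem_boundaryHypersurfaces [IsManifold (cornerModel m) ∞ X]
    (h : IsSmoothAction m E Γ G X) (k : Γ × G) {H : Set X} (hH : H ∈ boundaryHypersurfaces m X) :
    (fun x => k • x) '' H ∈ boundaryHypersurfaces m X :=
  CornerDoubling.image_mem_boundaryHypersurfaces
    { toEquiv := MulAction.toPerm k
      continuous_toFun := (h.contMDiff k).continuous
      continuous_invFun := (h.contMDiff k⁻¹).continuous } (h.contMDiff k) (h.contMDiff k⁻¹) hH

variable [LieGroup 𝓘(ℝ, E) ∞ G]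

/-- The double across an invariant collective boundary hypersurface. -/
theorem exists_double [Finite Γ] [CompactSpace G] [T2Space G]
    (hM : IsCompactManifoldWithCorners m X) {B : Fin (l + 1) → Set (Set X)}
    (hB : IsBoundaryPartition m B) (hact : IsSmoothAction m E Γ G X)
    (hFk : ∀ (i : Fin (l + 1)) (k : Γ × G), ∀ x ∈ ⋃₀ B i, k • x ∈ ⋃₀ B i) :
    ∃ _ : ChartedSpace (EuclideanQuadrant m) (Double X (⋃₀ B 0)),
      letI := doubleAction (hFk 0)
      IsCompactManifoldWithCorners m (Double X (⋃₀ B 0)) ∧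
      (∀ b, IsSmoothCornerEmbedding m (Double.incl (⋃₀ B 0) b)) ∧
      IsBoundaryPartition m (fun i : Fin l => inducedCollection m (⋃₀ B 0) (B i.succ)) ∧
      IsSmoothAction m E (Multiplicative (ZMod 2) × Γ) G (Double X (⋃₀ B 0)) ∧
      ∀ (i : Fin l) (k : (Multiplicative (ZMod 2) × Γ) × G),
        ∀ H ∈ inducedCollection m (⋃₀ B 0) (B i.succ),
          (fun d => k • d) '' H ∈ inducedCollection m (⋃₀ B 0) (B i.succ) := by
  have := hM.compactSpace
  have := hM.t2Space
  have := hM.isManifold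
  have hsys := hB.isFaceSystem hM
  obtain ⟨V, hV, hVF, hVk⟩ := hact.exists_invariant_field (hsys.isFaceSet 0) (hFk 0)
  obtain ⟨ch, h⟩ := exists_isDoubleStructure (hsys.isFaceSet 0) hV hVF
  have hman := h.isManifold
  have hsys' := h.isFaceSystem hsys
  have hact' := h.isSmoothAction hact (hFk 0) hVk
  refine ⟨ch, ⟨inferInstance, Double.t2Space (hsys.isFaceSet 0).isClosed, hman,
    fun H hH => hsys'.isEmbeddedHypersurface hH⟩, h.isSmoothCornerEmbedding,
    hsys'.isBoundaryPartition, hact', ?_⟩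
  rintro i k H ⟨hH, hHi⟩
  refine ⟨@IsSmoothAction.image_mem_boundaryHypersurfaces m _ _ _ E _ G _ _ _ _ _ _
    (doubleAction (hFk 0)) hman hact' k _ hH, ?_⟩
  rintro _ ⟨d, hd, rfl⟩
  have h1 := hFk i.succ (k.1.2, k.2) _ (hHi hd)
  change Double.fold _ (Double.map _ _ _ d) ∈ ⋃₀ B i.succ
  rwa [Double.fold_map]

end Step

/-! ### Induction on the number of collections -/

section Successive

/-- The actions on a successive doubling: the last manifold is boundaryless, the factors `ℤ₂` act
by interchanging the copies, and the action of `Γ × G` on the first manifold is extended. -/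
structure IsDoublingAction (E Γ G : Type*) [NormedAddCommGroup E] [NormedSpace ℝ E] [Group Γ]
    [Group G] [TopologicalSpace G] [ChartedSpace E G] {m l : ℕ} {X : Type u} [TopologicalSpace X]
    [ChartedSpace (EuclideanQuadrant m) X] {B : Fin l → Set (Set X)} [MulAction (Γ × G) X] (D : SuccessiveDoubling m l X B)
    [MulAction ((Z2Pow l × Γ) × G) D.Total] : Prop where
  isManifold : IsCompactManifoldWithCorners m D.Total
  boundaryless : BoundarylessManifold (cornerModel m) D.Total
  isSmoothAction : IsSmoothAction m E (Z2Pow l × Γ) G D.Total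
  isEmbedding : IsSmoothCornerEmbedding m D.incl
  smul_incl : ∀ (γ : Γ) (g : G) (x : X), (((1, γ), g) : (Z2Pow l × Γ) × G) • D.incl x =
    D.incl (((γ, g) : Γ × G) • x)
  isFundamentalDomain : IsFundamentalDomainVia
    ((MonoidHom.inl (Z2Pow l × Γ) G).comp (MonoidHom.inl (Z2Pow l) Γ)) (range D.incl)

/-- Regroup the factors `ℤ₂`. -/
def splitHom (l : ℕ) (Γ G : Type*) [Group Γ] [Group G] :
    (Z2Pow (l + 1) × Γ) × G →* (Z2Pow l × (Multiplicative (ZMod 2) × Γ)) × G where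
  toFun k := ((Fin.tail k.1.1, (k.1.1 0, k.1.2)), k.2)
  map_one' := rfl
  map_mul' _ _ := rfl

variable {m : ℕ} {E G : Type*} [NormedAddCommGroup E] [NormedSpace ℝ E] [Group G]
  [TopologicalSpace G] [ChartedSpace E G] [LieGroup 𝓘(ℝ, E) ∞ G] [CompactSpace G] [T2Space G]

/-- Doubling across B 0 removes one collection and adds a swap, and later doublings have to respect
that swap. Hence the induction runs over all actions of Γ × G with Γ finite: the hypothesis is
applied to the double with ℤ₂ × Γ in place of Γ. -/
theorem exists_isDoublingAction (l : ℕ) : ∀ (X : Type u) [TopologicalSpace X]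
    [ChartedSpace (EuclideanQuadrant m) X] (Γ : Type) [Group Γ] [Finite Γ] [MulAction (Γ × G) X]
    (B : Fin l → Set (Set X)), IsCompactManifoldWithCorners m X → IsBoundaryPartition m B →
    IsSmoothAction m E Γ G X →
    (∀ (i : Fin l) (k : Γ × G), ∀ H ∈ B i, (fun x => k • x) '' H ∈ B i) →
    ∃ (D : SuccessiveDoubling m l X B) (_ : MulAction ((Z2Pow l × Γ) × G) D.Total),
      IsDoublingAction E Γ G D := by
  induction l with
  | zero =>
    intro X _ _ Γ _ _ _ B hM hB hact hGB
    have := hM.isManifold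
    let a : MulAction ((Z2Pow 0 × Γ) × G) X :=
      MulAction.compHom X (MonoidHom.prodMap (MonoidHom.snd (Z2Pow 0) Γ) (MonoidHom.id G))
    refine ⟨.done X B, a, ?_⟩
    refine @IsDoublingAction.mk E Γ G _ _ _ _ _ _ m 0 X _ _ B _ (.done X B) a hM ?_
      (fun k => hact k.2) IsSmoothCornerEmbedding.id (fun _ _ _ => rfl) ?_
    -- A partition with no members leaves no boundary hypersurface, hence no point of codimension
    -- one.
    · change BoundarylessManifold (cornerModel m) X
      refine boundarylessManifold_of_codimOnePart_eq_empty (eq_empty_of_forall_notMem fun x hx => ?_)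
      obtain ⟨i, -⟩ := hB.existsUnique _ ⟨x, hx, rfl⟩
      exact i.elim0
    · let _ : MulAction (Z2Pow 0) X := MulAction.compHom X
        ((MonoidHom.inl (Z2Pow 0 × Γ) G).comp (MonoidHom.inl (Z2Pow 0) Γ))
      have hr : range (fun x : X => x) = univ := range_id
      change IsFundamentalDomain (Z2Pow 0) (range (fun x : X => x))
      rw [hr]
      refine ⟨by simp, fun y => ⟨y, ⟨trivial, MulAction.mem_orbit_self y⟩, ?_⟩, fun γ hγ =>
        absurd (Subsingleton.elim γ 1) hγ⟩
      rintro _ ⟨-, γ, rfl⟩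
      change γ • y = y
      rw [Subsingleton.elim γ 1, one_smul]
  | succ l ih =>
    intro X _ _ Γ _ _ _ B hM hB hact hGB
    have hFk : ∀ (i : Fin (l + 1)) (k : Γ × G), ∀ x ∈ ⋃₀ B i, k • x ∈ ⋃₀ B i := by
      rintro i k x ⟨H, hH, hx⟩
      exact ⟨_, hGB i k H hH, ⟨x, hx, rfl⟩⟩
    have := hM.isManifold
    have hface := (hB.isFaceSystem hM).isFaceSet 0
    obtain ⟨_, h1, h2, h3, h4, h5⟩ := exists_double hM hB hact hFk
    let _ := doubleAction (hFk 0)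
    obtain ⟨D, a, hD⟩ := ih (Double X (⋃₀ B 0)) (Multiplicative (ZMod 2) × Γ) _ h1 h3 h4 h5
    have := hM.compactSpace
    have := hD.isManifold.t2Space
    -- The zeroth factor of ℤ₂^(l+1) is the swap of the first double, which the inductive hypothesis
    -- counts as part of Γ.
    let a' : MulAction ((Z2Pow (l + 1) × Γ) × G) D.Total := MulAction.compHom _ (splitHom l Γ G)
    refine ⟨.step l X B h1 h2 h3 D, a', ?_⟩
    refine @IsDoublingAction.mk E Γ G _ _ _ _ _ _ m (l + 1) X _ _ B _ (.step l X B h1 h2 h3 D) a'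
      hD.isManifold hD.boundaryless (fun k => hD.isSmoothAction (Fin.tail k.1, (k.1 0, k.2)))
      (hD.isEmbedding.comp (h2 true)) (fun γ g x => hD.smul_incl (1, γ) g _) ?_
    have hfd := IsFundamentalDomainVia.double hface.isClosed hface.dense_compl
      hD.isEmbedding.isEmbedding hD.isFundamentalDomain
      (φ' := (splitHom l Γ G).comp
        ((MonoidHom.inl (Z2Pow (l + 1) × Γ) G).comp (MonoidHom.inl (Z2Pow (l + 1)) Γ)))
      ((MonoidHom.inl (Z2Pow l × (Multiplicative (ZMod 2) × Γ)) G).comp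
        ((MonoidHom.inr (Z2Pow l) (Multiplicative (ZMod 2) × Γ)).comp (MonoidHom.inl _ Γ)))
      (fun ε b x => by
        refine (hD.smul_incl (ε, 1) 1 _).trans ?_
        exact congrArg (fun y => D.incl (Double.incl (⋃₀ B 0) (flipLabel ε b) y))
          (one_smul (Γ × G) x))
      Fin.tail (fun z => z 0) (fun z ε => ⟨Fin.cons ε z, Fin.tail_cons _ _, Fin.cons_zero _ _⟩)
      (fun z h0 h1 => by
        rw [← Fin.cons_self_tail z, h0, h1]
        funext i
        exact Fin.cases rfl (fun _ => rfl) i)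
      (fun z => by
        refine Prod.ext (Prod.ext ?_ (Prod.ext ?_ ?_)) ?_
        · exact (mul_one _).symm
        · exact (one_mul _).symm
        · exact (one_mul _).symm
        · exact (one_mul _).symm)
      (fun z => by
        refine Prod.ext (Prod.ext ?_ (Prod.ext ?_ ?_)) ?_
        · exact (one_mul _).symm
        · exact (mul_one _).symm
        · exact (one_mul _).symm
        · exact (one_mul _).symm)
    exact hfd

end Successive

end CornerDoubling

/-! ### The theorem -/

open CornerDoubling in
theorem mainTheorem4 {m l : ℕ}
    {E : Type*} [NormedAddCommGroup E] [NormedSpace ℝ E] [FiniteDimensional ℝ E]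
    {G : Type*} [Group G] [TopologicalSpace G] [ChartedSpace E G] [LieGroup 𝓘(ℝ, E) ∞ G]
    [CompactSpace G] [T2Space G]
    {M : Type*} [TopologicalSpace M] [ChartedSpace (EuclideanQuadrant m) M]
    (hM : IsCompactManifoldWithCorners m M)
    [MulAction G M] [ContMDiffSMul 𝓘(ℝ, E) (cornerModel m) ∞ G M]
    (B : Fin l → Set (Set M)) (hB : IsBoundaryPartition m B)
    (hGB : ∀ (i : Fin l) (g : G), ∀ H ∈ B i, (fun x : M => g • x) '' H ∈ B i) :
    ∃ D : SuccessiveDoubling m l M B,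
      IsCompactManifoldWithCorners m D.Total ∧
      BoundarylessManifold (cornerModel m) D.Total ∧
      ∃ _ : MulAction (Z2Pow l × G) D.Total,
        (∀ γ : Z2Pow l, ContMDiff (𝓘(ℝ, E).prod (cornerModel m)) (cornerModel m) ∞
          (fun p : G × D.Total => ((γ, p.1) : Z2Pow l × G) • p.2)) ∧
        IsSmoothCornerEmbedding m D.incl ∧
        (∀ (g : G) (x : M), ((1, g) : Z2Pow l × G) • D.incl x = D.incl (g • x)) ∧
        letI : MulAction (Z2Pow l) D.Total :=
          MulAction.compHom D.Total (MonoidHom.inl (Z2Pow l) G)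
        IsFundamentalDomain (Z2Pow l) (range D.incl) := by
  -- No swaps have been made at the start, so Γ is trivial.
  let _ : MulAction (Unit × G) M := MulAction.compHom M (MonoidHom.snd Unit G)
  have hact : IsSmoothAction m E Unit G M := fun _ =>
    ContMDiffSMul.contMDiff_smul (I := 𝓘(ℝ, E)) (I' := cornerModel m) (n := ∞) (G := G) (M := M)
  obtain ⟨D, a, hD⟩ := exists_isDoublingAction (E := E) (G := G) l M Unit B hM hB hact
    fun i k => hGB i k.2
  let ψ : Z2Pow l × G →* (Z2Pow l × Unit) × G :=
    MonoidHom.prodMap (MonoidHom.inl (Z2Pow l) Unit) (MonoidHom.id G)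
  exact ⟨D, hD.isManifold, hD.boundaryless, MulAction.compHom D.Total ψ,
    fun γ => hD.isSmoothAction (γ, ()), hD.isEmbedding, fun g x => hD.smul_incl () g x,
    hD.isFundamentalDomain⟩
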